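/- Let $K$ be an algebraically closed field of characteristic zero (for instance $\mathbb{C}$) and for each $t\ge 1$ let $\varepsilon_t\in K$ be a primitive $t$-th root of unity. Let $1<q<n$ be coprime integers, and let $\mathbb{D}_{n,q}\subset GL(2,K)$ be the group $$\mathbb{D}_{n,q}=\begin{cases}\langle \psi_{2q},\tau,\varphi_{2(n-q)}\rangle & n-q \text{ odd},\\ \langle \psi_{2q},\tau\varphi_{4(n-q)}\rangle & n-q\text{ even},\end{cases}\qquad \psi_k=\begin{pmatrix}\varepsilon_k&0\\0&\varepsilon_k^{-1}\end{pmatrix},\ \tau=\begin{pmatrix}0&\varepsilon_4\\ \varepsilon_4&0\end{pmatrix},\ \varphi_k=\begin{pmatrix}\varepsilon_k&0\\0&\varepsilon_k\end{pmatrix},$$ acting on $K[x,y]$ by linear substitution of the variables. *Combinatorial data.* Write $[\beta_1,\dots,\beta_X]=\beta_1-\frac{1}{\beta_2-\frac{1}{\ddots-\frac1{\beta_X}}}$ and let $\frac nq=[\alpha_1,\dots,\alpha_N]$ and $\frac n{n-q}=[a_2,\dots,a_{e-1}]$ be the Hirzebruch–Jung continued fraction expansions (all entries integers $\geq 2$).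 Let $\nu<N$ be the largest integer with $\alpha_1=\dots=\alpha_\nu=2$ ($\nu=0$ if there is none), and assume $\nu<N-1$. Put $l_j=2+\sum_{p=1}^{j}(\alpha_p-2)$ and $$c_2=1,\ c_3=0,\ c_4=1;\qquad d_2=0,\ d_3=1,\ d_4=a_3-1;\qquad t_2=a_2,\ t_3=a_2-1,\ t_4=a_3(a_2-1)-1,$$ with $c_j=a_{j-1}c_{j-1}-c_{j-2}$, $d_j=a_{j-1}d_{j-1}-d_{j-2}$, $t_j=a_{j-1}t_{j-1}-t_{j-2}$ for $5\le j\le e$, and $r_j=(n-q)t_j-q(c_j+d_j)$ for $2\le j\le e$. Set $$w_2=(x^q+y^q)(x^q+(-1)^{a_2}y^q),\quad w_3=(x^q-y^q)(x^q+(-1)^{a_2}y^q),$$ $$v_2=x^{2q}+(-1)^{a_2}y^{2q},\quad v_3=x^{2q}+(-1)^{a_2-1}y^{2q}.$$ *The quivers.* $\mathtt{D}_1$ is the quiver with vertices $R,W_{\nu+1},W_{\nu+2},\dots,W_N$ and the following arrows, labelled by polynomials: - $R\to W_{\nu+1}$ labelled $w_2$; - $W_{\nu+1}\to R$ labelled $(xy)^{r_2}$,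 and $W_{\nu+1}\to R$ labelled $(xy)^{2r_3}w_2$; - for each $\nu+1\le t\le N-1$: $W_t\to W_{t+1}$ labelled $w_2^{c_{l_t}}w_3^{d_{l_t}}$, and $W_{t+1}\to W_t$ labelled $(xy)^{r_{l_t}}$; - $W_N\to R$ labelled $w_2^{c_{l_N}}w_3^{d_{l_N}}$, and $R\to W_N$ labelled $(xy)^{r_{l_N}}$; - for each $2\le t\le\alpha_{\nu+1}-2$: $W_{\nu+1}\to R$ labelled $(xy)^{r_{t+2}}w_2^{c_{t+1}}w_3^{d_{t+1}}$; - for each $\nu+1<s\le N$ and each $1\le t\le\alpha_s-2$: $W_s\to R$ labelled $(xy)^{r_{t+l_{s-1}}}w_2^{c_{t-1+l_{s-1}}}w_3^{d_{t-1+l_{s-1}}}$. $\mathtt{D}_2$ is obtained from $\mathtt{D}_1$ by replacing $w_2,w_3$ by $v_2,v_3$ in all labels. The polynomial of a path is the product of the labels of its arrows ($1$ for a trivial path). **Proposition.** At every vertex $v$ of $\mathtt{D}_1$, every invariant polynomial $f\in K[x,y]^{\mathbb{D}_{n,q}}$ is a $K$-linear combination of polynomials of paths from $v$ to $v$ (compositions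 of cycles at $v$). If any single arrow is removed from $\mathtt{D}_1$, this is no longer true: in the remaining quiver there are a vertex and an invariant polynomial that is not such a combination at that vertex. Both statements also hold for $\mathtt{D}_2$. -/

import Mathlib

namespace DihedralQuiver

open MvPolynomial

/-! ### Hirzebruch–Jung continued fractions and the combinatorial series -/

/-- The Hirzebruch–Jung continued fraction expansion `[β₁, …, β_X]` of `m / k`, computed by
`m / k = c - 1 / (k / (c * k - m))` with `c = ⌈m / k⌉`; it stops when the denominator is `0`. -/
def hjExpansion : ℕ → ℕ → List ℕ
  | _, 0 => []
  | m, k + 1 => (m + k) / (k + 1) :: hjExpansion (k + 1) ((m + k) / (k + 1) * (k + 1) - m)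
termination_by _ k => k
decreasing_by
  have h := Nat.div_mul_le_self (m + k) (k + 1)
  omega

/-- The value `β₁ - 1 / (β₂ - 1 / (⋯ - 1 / β_X))` (since `0⁻¹ = 0`, `[β]` has value `β`). -/
def hjValue : List ℕ → ℚ
  | [] => 0
  | b :: l => b - (hjValue l)⁻¹

theorem hjValue_hjExpansion (m k : ℕ) : hjValue (hjExpansion m k) = (m : ℚ) / k := by
  induction k using Nat.strong_induction_on generalizing m with
  | _ k ih =>
    cases k with
    | zero => simp [hjExpansion, hjValue]
    | succ k =>
      have h1 := Nat.div_mul_le_self (m + k) (k + 1)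
      have h2 : m ≤ (m + k) / (k + 1) * (k + 1) := by
        have := Nat.div_add_mod (m + k) (k + 1)
        have h3 := Nat.mod_lt (m + k) (Nat.succ_pos k)
        rw [Nat.mul_comm] at this
        simp only [Nat.succ_eq_add_one] at h3
        omega
      rw [hjExpansion, hjValue, ih _ (by omega), Nat.cast_sub h2]
      push_cast
      field_simp
      ring

theorem two_le_of_mem_hjExpansion (m k : ℕ) (hkm : k < m) :
    ∀ b ∈ hjExpansion m k, 2 ≤ b := by
  induction k using Nat.strong_induction_on generalizing m with
  | _ k ih =>
    cases k with
    | zero => simp [hjExpansion]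
    | succ k =>
      have h1 := Nat.div_mul_le_self (m + k) (k + 1)
      intro b hb
      rw [hjExpansion, List.mem_cons] at hb
      rcases hb with rfl | hb
      · rw [Nat.le_div_iff_mul_le (Nat.succ_pos k)]
        omega
      · exact ih _ (by omega) _ (by omega) b hb

/-- `N`, the length of `n / q = [α₁, …, α_N]`. -/
def len (n q : ℕ) : ℕ := (hjExpansion n q).length

/-- The entries `α_t`, `1 ≤ t ≤ N`, of `n / q = [α₁, …, α_N]`. -/
def alpha (n q t : ℕ) : ℕ := (hjExpansion n q).getD (t - 1) 0

/-- The entries `a_j`, `2 ≤ j ≤ e - 1`, of `n / (n - q) = [a₂, …, a_{e-1}]`. -/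
def aEntry (n q j : ℕ) : ℕ := (hjExpansion n (n - q)).getD (j - 2) 0

/-- `ν < N`, the largest integer such that `α₁ = ⋯ = α_ν = 2` (and `0` if there is none). -/
def nu (n q : ℕ) : ℕ := Nat.findGreatest (fun s => ∀ t ∈ Finset.Icc 1 s, alpha n q t = 2) (len n q - 1)

/-- The `l`-series `l_j = 2 + ∑_{p=1}^{j} (α_p - 2)` of `n / q` (every `α_p` is at least `2`). -/
def lSeries (n q j : ℕ) : ℕ := 2 + ∑ p ∈ Finset.Icc 1 j, (alpha n q p - 2)

/-- The `c`-series, meaningful for `2 ≤ j ≤ e`. -/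
def cSeries (n q : ℕ) : ℕ → ℤ
  | 0 => 0
  | 1 => 0
  | 2 => 1
  | 3 => 0
  | 4 => 1
  | j + 5 => aEntry n q (j + 4) * cSeries n q (j + 4) - cSeries n q (j + 3)

/-- The `d`-series, meaningful for `2 ≤ j ≤ e`. -/
def dSeries (n q : ℕ) : ℕ → ℤ
  | 0 => 0
  | 1 => 0
  | 2 => 0
  | 3 => 1
  | 4 => aEntry n q 3 - 1
  | j + 5 => aEntry n q (j + 4) * dSeries n q (j + 4) - dSeries n q (j + 3)

/-- The `t`-series, meaningful for `2 ≤ j ≤ e`. -/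
def tSeries (n q : ℕ) : ℕ → ℤ
  | 0 => 0
  | 1 => 0
  | 2 => aEntry n q 2
  | 3 => aEntry n q 2 - 1
  | 4 => aEntry n q 3 * (aEntry n q 2 - 1) - 1
  | j + 5 => aEntry n q (j + 4) * tSeries n q (j + 4) - tSeries n q (j + 3)

/-- The `r`-series `r_j = (n - q) t_j - q (c_j + d_j)`, meaningful for `2 ≤ j ≤ e`. -/
def rSeries (n q j : ℕ) : ℤ :=
  ((n : ℤ) - q) * tSeries n q j - q * (cSeries n q j + dSeries n q j)

/-! ### The dihedral group and its invariants -/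

section Group

variable {K : Type*} [Field K]

/-- `ψ_k`, where `ε t` is the chosen primitive `t`-th root of unity. -/
def psi (ε : ℕ → K) (k : ℕ) : Matrix (Fin 2) (Fin 2) K := !![ε k, 0; 0, (ε k)⁻¹]

/-- `τ`. -/
def tau (ε : ℕ → K) : Matrix (Fin 2) (Fin 2) K := !![0, ε 4; ε 4, 0]

/-- `φ_k`. -/
def phi (ε : ℕ → K) (k : ℕ) : Matrix (Fin 2) (Fin 2) K := !![ε k, 0; 0, ε k]

/-- The generating matrices of `𝔻_{n,q}`. -/
def generators (ε : ℕ → K) (n q : ℕ) : Set (Matrix (Fin 2) (Fin 2) K) :=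
  if (n - q) % 2 = 1 then {psi ε (2 * q), tau ε, phi ε (2 * (n - q))}
  else {psi ε (2 * q), tau ε * phi ε (4 * (n - q))}

/-- The group `𝔻_{n,q} ⊆ GL(2, K)`. -/
def dihedralGroup (ε : ℕ → K) (n q : ℕ) : Subgroup (GL (Fin 2) K) :=
  Subgroup.closure {g | (g : Matrix (Fin 2) (Fin 2) K) ∈ generators ε n q}

/-- Linear substitution of the variables: `x_i ↦ ∑ j, g_{ij} x_j`. -/
noncomputable def substitute (g : GL (Fin 2) K) :
    MvPolynomial (Fin 2) K →ₐ[K] MvPolynomial (Fin 2) K :=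
  aeval fun i => ∑ j, C ((g : Matrix (Fin 2) (Fin 2) K) i j) * X j

/-- The invariant ring `K[x, y]^G` of a group `G` of matrices. -/
def invariantRing (G : Subgroup (GL (Fin 2) K)) : Subalgebra K (MvPolynomial (Fin 2) K) where
  carrier := {f | ∀ g ∈ G, substitute g f = f}
  mul_mem' ha hb g hg := by rw [map_mul, ha g hg, hb g hg]
  add_mem' ha hb g hg := by rw [map_add, ha g hg, hb g hg]
  algebraMap_mem' c g _ := (substitute g).commutes c

end Group

/-! ### Quivers with labelled arrows -/

/-- A quiver whose arrows carry labels in `A`. -/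
structure LabelledQuiver (A : Type*) where
  Vertex : Type
  Arrow : Type
  source : Arrow → Vertex
  target : Arrow → Vertex
  label : Arrow → A

namespace LabelledQuiver

instance {A : Type*} (Q : LabelledQuiver A) : Quiver Q.Vertex where
  Hom v w := {a : Q.Arrow // Q.source a = v ∧ Q.target a = w}

/-- The quiver with one arrow removed. -/
def delete {A : Type*} (Q : LabelledQuiver A) (a : Q.Arrow) : LabelledQuiver A where
  Vertex := Q.Vertex
  Arrow := {b : Q.Arrow // b ≠ a}
  source b := Q.source b
  target b := Q.target b
  label b := Q.label b

/-- The label of an arrow, seen as an element of a `Hom` type. -/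
def homLabel {A : Type*} (Q : LabelledQuiver A) {v w : Q.Vertex} (a : v ⟶ w) : A :=
  Q.label a.1

/-- The polynomial of a path: the product of the labels of its arrows (`1` for a trivial path). -/
def pathLabel {A : Type*} [Monoid A] (Q : LabelledQuiver A) {v w : Q.Vertex}
    (p : Quiver.Path v w) : A :=
  p.weight Q.homLabel

/-- At every vertex `v`, every element of `S` is a (`K`-linear) sum of compositions of cycles
at `v`, that is, of polynomials of paths from `v` to `v`. -/
def SeesAll {K A : Type*} [CommSemiring K] [Semiring A] [Algebra K A] (Q : LabelledQuiver A)
    (S : Subalgebra K A) : Prop :=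
  ∀ v : Q.Vertex, ∀ f ∈ S,
    f ∈ Submodule.span K (Set.range fun p : Quiver.Path v v => Q.pathLabel p)

end LabelledQuiver

/-! ### The quivers `D₁` and `D₂` -/

/-- The vertices: `R`, and `W t` for the module `W_{i_t}`, `ν + 1 ≤ t ≤ N`. -/
inductive Vertex (n q : ℕ) : Type
  | R : Vertex n q
  | W (t : ℕ) (h : nu n q + 1 ≤ t) (h' : t ≤ len n q) : Vertex n q

/-- The arrows; see `arrowSource`, `arrowTarget`, `arrowLabel`. -/
inductive Arrow (n q : ℕ) : Type
  | up : Arrow n q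
  | down : Arrow n q
  | g : Arrow n q
  | fwd (t : ℕ) (h : nu n q + 1 ≤ t) (h' : t < len n q) : Arrow n q
  | bwd (t : ℕ) (h : nu n q + 1 ≤ t) (h' : t < len n q) : Arrow n q
  | out : Arrow n q
  | into : Arrow n q
  | extraFirst (t : ℕ) (h : 2 ≤ t) (h' : t + 2 ≤ alpha n q (nu n q + 1)) : Arrow n q
  | extra (s t : ℕ) (hs : nu n q + 1 < s) (hs' : s ≤ len n q)
      (h : 1 ≤ t) (h' : t + 2 ≤ alpha n q s) : Arrow n q

/-- The source of an arrow. -/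
def arrowSource {n q : ℕ} (hν : nu n q + 1 < len n q) : Arrow n q → Vertex n q
  | .up => .R
  | .down => .W (nu n q + 1) le_rfl hν.le
  | .g => .W (nu n q + 1) le_rfl hν.le
  | .fwd t h h' => .W t h h'.le
  | .bwd t h h' => .W (t + 1) (h.trans t.le_succ) h'
  | .out => .W (len n q) hν.le le_rfl
  | .into => .R
  | .extraFirst _ _ _ => .W (nu n q + 1) le_rfl hν.le
  | .extra s _ hs hs' _ _ => .W s hs.le hs'

/-- The target of an arrow. -/
def arrowTarget {n q : ℕ} (hν : nu n q + 1 < len n q) : Arrow n q → Vertex n q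
  | .up => .W (nu n q + 1) le_rfl hν.le
  | .down => .R
  | .g => .R
  | .fwd t h h' => .W (t + 1) (h.trans t.le_succ) h'
  | .bwd t h h' => .W t h h'.le
  | .out => .R
  | .into => .W (len n q) hν.le le_rfl
  | .extraFirst _ _ _ => .R
  | .extra _ _ _ _ _ _ => .R

section Labels

variable {K : Type*} [Field K]

/-- The label of an arrow, in terms of `u₂`, `u₃` (which are `w₂`, `w₃` for `D₁` and `v₂`, `v₃`
for `D₂`). The exponents are non-negative integers; `Int.toNat` only changes their type. -/
noncomputable def arrowLabel {n q : ℕ} (u₂ u₃ : MvPolynomial (Fin 2) K) :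
    Arrow n q → MvPolynomial (Fin 2) K
  | .up => u₂
  | .down => (X 0 * X 1) ^ (rSeries n q 2).toNat
  | .g => (X 0 * X 1) ^ (2 * rSeries n q 3).toNat * u₂
  | .fwd t _ _ =>
      u₂ ^ (cSeries n q (lSeries n q t)).toNat * u₃ ^ (dSeries n q (lSeries n q t)).toNat
  | .bwd t _ _ => (X 0 * X 1) ^ (rSeries n q (lSeries n q t)).toNat
  | .out =>
      u₂ ^ (cSeries n q (lSeries n q (len n q))).toNat *
        u₃ ^ (dSeries n q (lSeries n q (len n q))).toNat
  | .into => (X 0 * X 1) ^ (rSeries n q (lSeries n q (len n q))).toNat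
  | .extraFirst t _ _ =>
      (X 0 * X 1) ^ (rSeries n q (t + 2)).toNat *
        u₂ ^ (cSeries n q (t + 1)).toNat * u₃ ^ (dSeries n q (t + 1)).toNat
  | .extra s t _ _ _ _ =>
      (X 0 * X 1) ^ (rSeries n q (t + lSeries n q (s - 1))).toNat *
        u₂ ^ (cSeries n q (t - 1 + lSeries n q (s - 1))).toNat *
        u₃ ^ (dSeries n q (t - 1 + lSeries n q (s - 1))).toNat

/-- The common shape of `D₁` and `D₂`. -/
noncomputable def quiverD {n q : ℕ} (hν : nu n q + 1 < len n q)
    (u₂ u₃ : MvPolynomial (Fin 2) K) : LabelledQuiver (MvPolynomial (Fin 2) K) where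
  Vertex := Vertex n q
  Arrow := Arrow n q
  source := arrowSource hν
  target := arrowTarget hν
  label := arrowLabel u₂ u₃

variable (K)

/-- `w₂ = (x^q + y^q)(x^q + (-1)^{a₂} y^q)`. -/
noncomputable def w₂ (n q : ℕ) : MvPolynomial (Fin 2) K :=
  (X 0 ^ q + X 1 ^ q) * (X 0 ^ q + (-1) ^ aEntry n q 2 * X 1 ^ q)

/-- `w₃ = (x^q - y^q)(x^q + (-1)^{a₂} y^q)`. -/
noncomputable def w₃ (n q : ℕ) : MvPolynomial (Fin 2) K :=
  (X 0 ^ q - X 1 ^ q) * (X 0 ^ q + (-1) ^ aEntry n q 2 * X 1 ^ q)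

/-- `v₂ = x^{2q} + (-1)^{a₂} y^{2q}`. -/
noncomputable def v₂ (n q : ℕ) : MvPolynomial (Fin 2) K :=
  X 0 ^ (2 * q) + (-1) ^ aEntry n q 2 * X 1 ^ (2 * q)

/-- `v₃ = x^{2q} + (-1)^{a₂ - 1} y^{2q}` (here `a₂ ≥ 2`). -/
noncomputable def v₃ (n q : ℕ) : MvPolynomial (Fin 2) K :=
  X 0 ^ (2 * q) + (-1) ^ (aEntry n q 2 - 1) * X 1 ^ (2 * q)

/-- The polynomial-labelled quiver `D₁` of `𝔻_{n,q}`, defined when `ν < N - 1`. -/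
noncomputable def D₁ {n q : ℕ} (hν : nu n q + 1 < len n q) :
    LabelledQuiver (MvPolynomial (Fin 2) K) :=
  quiverD hν (w₂ K n q) (w₃ K n q)

/-- The polynomial-labelled quiver `D₂` of `𝔻_{n,q}`, defined when `ν < N - 1`. -/
noncomputable def D₂ {n q : ℕ} (hν : nu n q + 1 < len n q) :
    LabelledQuiver (MvPolynomial (Fin 2) K) :=
  quiverD hν (v₂ K n q) (v₃ K n q)

end Labels

end DihedralQuiver

namespace DihedralQuiver

open MvPolynomial

/-! ### Duality of the two continued fraction expansions -/

/-! Invariants. The diagonal elements of the group leave only monomials whose exponents have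
difference divisible by `2q` and sum divisible by `2(n-q)`; averaging with the swap turns these into
`symMonomial K n q m k`, indexed by lattice points `(m, k)` with `q k ≤ (n - q) m`
(`mem_span_symMonomial`). A product `(xy)^b u₂^i u₃^j` of matching degree and swap sign, with `i + j
= k`, equals a nonzero multiple of `symMonomial K n q m k` plus terms of smaller `k`
(`pow_mul_pow_sub_mem`). By induction on `k` it is therefore enough to have, at every vertex, a
cycle for each lattice point whose symmetrized monomial is nonzero.

Cycles. The points `(t_j, k_j)`, `k_j = c_j + d_j`, preceded by the virtual point `(1, 0)`, form a
chain in which neighbours have determinant one, so they subdivide the cone into unimodular pieces.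
The point `(1, 0)` itself is not available, but `(2, 0)` and `(a₂, 1) = (1, 0) + (t_3, k_3)` are,
and parity shows that this suffices (`isCycleType_of_le`). What remains is that each generator
labels a cycle at each vertex (`walk_generator`). Riemenschneider duality (`isDual_hjExpansion`)
says that `a_j - 2` counts the `s < N` with `l_s = j`. The recurrences then telescope into sums over
`r_{l_s}`, `c_{l_s}`, `d_{l_s}`, which are exactly the exponents collected along the backward and
forward chains. An extra arrow with exponent `r_J` closes the forward chain to generator `J` and the
backward chain to generator `J - 1`.

Minimality. For each arrow one vertex and one invariant are tested against the cycles of the same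
degree avoiding that arrow (`not_seesAll_delete`). Without an arrow of the upward chain, every such
cycle at `R` has a factor `xy`: evaluate at `(1, 0)`. For the backward chain, `down` and `g`, the
test is an algebra where `xy = 1` and `u₃ = 0`: the cycles either die or land in a line missing the
invariant (`exists_algHom_eq_zero`). For the extra arrows, since `r` decreases and `k` increases, no
remaining cycle has the right `i + j`, and leading terms after `y ↦ 1` separate the invariant from
the other cycles (`not_seesAll_delete_of_span`). -/

theorem hjExpansion_of_pos (m : ℕ) {k : ℕ} (hk : 0 < k) :
    hjExpansion m k = (m + k - 1) / k :: hjExpansion k ((m + k - 1) / k * k - m) := by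
  cases k with
  | zero => omega
  | succ k => rw [hjExpansion]; rfl

theorem hjExpansion_add_of_lt {A B : ℕ} (hB : 0 < B) (h : B < A) :
    hjExpansion (A + B) A = 2 :: hjExpansion A (A - B) := by
  rw [hjExpansion_of_pos _ (by omega)]
  have : (A + B + A - 1) / A = 2 := by
    rw [Nat.div_eq_iff (by omega)]
    omega
  rw [this]
  congr 2
  omega

theorem hjExpansion_add_self {A : ℕ} (hA : 0 < A) : hjExpansion (A + A) A = [2] := by
  rw [hjExpansion_of_pos _ hA]
  have : (A + A + A - 1) / A = 2 := by
    rw [Nat.div_eq_iff hA]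
    omega
  rw [this, show 2 * A - (A + A) = 0 by omega, hjExpansion]

theorem exists_hjExpansion_add {A B : ℕ} (hA : 0 < A) :
    ∃ x xs, hjExpansion B A = x :: xs ∧ hjExpansion (A + B) A = (x + 1) :: xs := by
  refine ⟨_, _, hjExpansion_of_pos _ hA, ?_⟩
  rw [hjExpansion_of_pos _ hA]
  have : (A + B + A - 1) / A = (B + A - 1) / A + 1 := by
    rw [show A + B + A - 1 = (B + A - 1) + A by omega, Nat.add_div_right _ hA]
  rw [this]
  congr 2
  rw [Nat.add_mul]
  omega

/-- The `l`-series of a list. -/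
def listL (α : List ℕ) (j : ℕ) : ℕ := 2 + ∑ p ∈ Finset.range j, (α.getD p 0 - 2)

/-- The list `a` is read off from the columns of the dot diagram with rows given by `α`. -/
def IsDual (α a : List ℕ) : Prop :=
  a.length + 1 = listL α α.length ∧ ∀ j, j < a.length → a.getD j 0 =
    2 + ∑ s ∈ Finset.range (α.length - 1), if listL α (s + 1) = j + 2 then 1 else 0

theorem listL_cons_two (α : List ℕ) (j : ℕ) : listL (2 :: α) (j + 1) = listL α j := by
  simp [listL, Finset.sum_range_succ']

theorem listL_cons_succ {x : ℕ} (hx : 2 ≤ x) (xs : List ℕ) (j : ℕ) :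
    listL ((x + 1) :: xs) (j + 1) = listL (x :: xs) (j + 1) + 1 := by
  simp [listL, Finset.sum_range_succ']
  omega

/-- A new top row with a single dot adds one dot to the first column. The old list must be nonempty
because the last row is excluded from the count, and the new row has to be a different one. -/
theorem IsDual.cons_two {α xs : List ℕ} {x : ℕ} (h : IsDual α (x :: xs)) (hα : α ≠ []) :
    IsDual (2 :: α) ((x + 1) :: xs) := by
  obtain ⟨M, hM⟩ : ∃ M, α.length = M + 1 :=
    Nat.exists_eq_succ_of_ne_zero (by simpa using hα)
  refine ⟨by simpa [listL_cons_two] using h.1, fun j hj => ?_⟩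
  have h2 := h.2 j (by simpa using hj)
  simp only [List.length_cons, Nat.add_sub_cancel, listL_cons_two, hM] at h2 ⊢
  rw [Finset.sum_range_succ']
  cases j with
  | zero =>
    simp only [List.getD_cons_zero] at h2 ⊢
    simp [listL] at h2 ⊢
    omega
  | succ j =>
    simp only [List.getD_cons_succ] at h2 ⊢
    rw [h2]
    simp [listL]

theorem IsDual.cons_succ {xs a : List ℕ} {x : ℕ} (h : IsDual (x :: xs) a) (hx : 2 ≤ x) :
    IsDual ((x + 1) :: xs) (2 :: a) := by
  refine ⟨by simpa [listL_cons_succ hx] using h.1, fun j hj => ?_⟩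
  simp only [List.length_cons, Nat.add_sub_cancel, listL_cons_succ hx]
  cases j with
  | zero =>
    have h3 : ∀ s, listL (x :: xs) (s + 1) ≠ 1 := fun s => by simp only [listL]; omega
    simp [h3]
  | succ j =>
    have h2 := h.2 j (by simpa using hj)
    simp only [List.length_cons, Nat.add_sub_cancel] at h2
    simpa using h2

/-- Riemenschneider duality by the subtractive Euclidean algorithm on `(A, B)`: when `A < B`, one
expansion has its first entry raised by one and the other gains a leading `2`; when `A > B` the
roles are exchanged. The algorithm ends at `A = B`, where both expansions are `[2]`. -/
theorem isDual_hjExpansion {A B : ℕ} (hA : 0 < A) (hB : 0 < B) :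
    IsDual (hjExpansion (A + B) A) (hjExpansion (A + B) B) := by
  induction hn : A + B using Nat.strong_induction_on generalizing A B with
  | _ n ih =>
    subst hn
    rcases lt_trichotomy A B with h | h | h
    · have := ih B (by omega) hA (B := B - A) (by omega) (by omega)
      obtain ⟨x, xs, h1, h2⟩ := exists_hjExpansion_add (B := B) hA
      rw [h2, add_comm A B, hjExpansion_add_of_lt hA h]
      rw [h1] at this
      refine this.cons_succ (two_le_of_mem_hjExpansion B A h x ?_)
      rw [h1]
      simp
    · subst h
      rw [hjExpansion_add_self hA]
      refine ⟨by simp [listL], fun j hj => ?_⟩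
      obtain rfl : j = 0 := by simpa using hj
      simp
    · have := ih A (by omega) (A := A - B) (B := B) (by omega) hB (by omega)
      obtain ⟨x, xs, h1, h2⟩ := exists_hjExpansion_add (A := B) (B := A) hB
      rw [add_comm A B, h2, add_comm B A, hjExpansion_add_of_lt hB h]
      rw [h1] at this
      refine this.cons_two ?_
      rw [hjExpansion_of_pos _ (by omega)]
      simp

/-! ### Remainders of a Hirzebruch–Jung expansion -/

/-- The sequence of remainders in the computation of `hjExpansion m k`. -/
def hjRem (m k : ℕ) : ℕ → ℤ
  | 0 => m
  | 1 => k
  | j + 2 => (hjExpansion m k).getD j 0 * hjRem m k (j + 1) - hjRem m k j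

theorem hjRem_tail (m : ℕ) {k : ℕ} (hk : 0 < k) (j : ℕ) :
    hjRem m k (j + 1) = hjRem k ((m + k - 1) / k * k - m) j := by
  induction j using Nat.twoStepInduction with
  | zero => rfl
  | one =>
    have h1 : m ≤ (m + k - 1) / k * k := by
      have := Nat.div_add_mod (m + k - 1) k
      have h3 := Nat.mod_lt (m + k - 1) hk
      rw [Nat.mul_comm] at this
      omega
    simp [hjRem, hjExpansion_of_pos m hk, Nat.cast_sub h1]
  | more j h1 h2 =>
    rw [hjRem, h1, h2, hjRem, hjExpansion_of_pos m hk]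
    simp

theorem hjRem_lt_and_pos {m k : ℕ} (hkm : k < m) {j : ℕ} (hj : j ≤ (hjExpansion m k).length) :
    hjRem m k (j + 1) < hjRem m k j ∧ 0 < hjRem m k j := by
  induction k using Nat.strong_induction_on generalizing m j with
  | _ k ih =>
    rcases Nat.eq_zero_or_pos k with rfl | hk
    · simp [hjExpansion] at hj
      subst hj
      simp [hjRem]
      omega
    · cases j with
      | zero => simp [hjRem]; omega
      | succ j =>
        have h2 := Nat.div_mul_le_self (m + k - 1) k
        rw [hjExpansion_of_pos m hk, List.length_cons] at hj
        rw [hjRem_tail m hk, hjRem_tail m hk]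
        exact ih _ (by omega) (by omega) (by omega)

theorem hjRem_length_add_one (m k : ℕ) : hjRem m k ((hjExpansion m k).length + 1) = 0 := by
  induction k using Nat.strong_induction_on generalizing m with
  | _ k ih =>
    rcases Nat.eq_zero_or_pos k with rfl | hk
    · simp [hjExpansion, hjRem]
    · by_cases hm : m = 0
      · subst hm
        have h0 : (k - 1) / k = 0 := Nat.div_eq_of_lt (by omega)
        simp [hjExpansion_of_pos 0 hk, h0, hjExpansion, hjRem]
      · have h2 := Nat.div_mul_le_self (m + k - 1) k
        rw [hjRem_tail m hk, hjExpansion_of_pos m hk, List.length_cons]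
        exact ih _ (by omega) _

/-! ### Numerical properties of the series -/

theorem lSeries_eq_listL (n q j : ℕ) : lSeries n q j = listL (hjExpansion n q) j := by
  simp only [lSeries, listL, alpha]
  congr 1
  rw [← Finset.Ico_add_one_right_eq_Icc, Finset.sum_Ico_eq_sum_range]
  simp

theorem lSeries_succ (n q j : ℕ) : lSeries n q (j + 1) = lSeries n q j + (alpha n q (j + 1) - 2) := by
  simp [lSeries, Finset.sum_Icc_succ_top, add_assoc]

theorem lSeries_mono (n q : ℕ) : Monotone (lSeries n q) :=
  monotone_nat_of_le_succ fun j => by rw [lSeries_succ]; omega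

theorem alpha_eq_two {n q t : ℕ} (ht : 1 ≤ t) (h : t ≤ nu n q) : alpha n q t = 2 :=
  Nat.findGreatest_spec (P := fun s => ∀ t ∈ Finset.Icc 1 s, alpha n q t = 2) (m := 0)
    (Nat.zero_le _) (by simp) t (Finset.mem_Icc.2 ⟨ht, h⟩)

theorem two_le_alpha {n q t : ℕ} (hqn : q < n) (ht : 1 ≤ t) (h : t ≤ len n q) :
    2 ≤ alpha n q t := by
  rw [alpha, List.getD_eq_getElem _ _ (show t - 1 < (hjExpansion n q).length by
    rw [← len]; omega)]
  exact two_le_of_mem_hjExpansion n q hqn _ (List.getElem_mem _)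

theorem lSeries_eq_two {n q t : ℕ} (h : t ≤ nu n q) : lSeries n q t = 2 := by
  simp only [lSeries, Nat.add_eq_left]
  refine Finset.sum_eq_zero fun p hp => ?_
  rw [Finset.mem_Icc] at hp
  simp [alpha_eq_two hp.1 (hp.2.trans h)]

theorem three_le_alpha_nu_add_one {n q : ℕ} (hqn : q < n) (hν : nu n q + 1 < len n q) :
    3 ≤ alpha n q (nu n q + 1) := by
  have h2 := two_le_alpha hqn (Nat.le_add_left 1 (nu n q)) hν.le
  have h3 := Nat.findGreatest_is_greatest
    (P := fun s => ∀ t ∈ Finset.Icc 1 s, alpha n q t = 2) (n := len n q - 1)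
    (k := nu n q + 1) (Nat.lt_succ_self _) (by omega)
  by_contra! h4
  refine h3 fun t ht => ?_
  rw [Finset.mem_Icc] at ht
  rcases Nat.lt_or_ge (nu n q) t with h5 | h5
  · obtain rfl : t = nu n q + 1 := by omega
    omega
  · exact alpha_eq_two ht.1 h5

theorem lSeries_nu_add_one {n q : ℕ} (hqn : q < n) (hν : nu n q + 1 < len n q) :
    lSeries n q (nu n q + 1) = alpha n q (nu n q + 1) := by
  have := three_le_alpha_nu_add_one hqn hν
  rw [lSeries_succ, lSeries_eq_two le_rfl]
  omega

theorem isDual_of_lt {n q : ℕ} (hq : 0 < q) (hqn : q < n) :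
    IsDual (hjExpansion n q) (hjExpansion n (n - q)) := by
  have := isDual_hjExpansion hq (show 0 < n - q by omega)
  rwa [Nat.add_sub_cancel' hqn.le] at this

theorem length_hjExpansion_sub {n q : ℕ} (hq : 0 < q) (hqn : q < n) :
    (hjExpansion n (n - q)).length + 1 = lSeries n q (len n q) := by
  rw [(isDual_of_lt hq hqn).1, lSeries_eq_listL, len]

/-- The dot diagram in the indexing of the series. The row `s = N` is omitted, as no further row
starts in its last column. -/
theorem aEntry_eq {n q j : ℕ} (hq : 0 < q) (hqn : q < n) (h2 : 2 ≤ j)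
    (hj : j ≤ lSeries n q (len n q)) :
    aEntry n q j = 2 + ∑ s ∈ Finset.Ico 1 (len n q), if lSeries n q s = j then 1 else 0 := by
  have := length_hjExpansion_sub hq hqn
  rw [aEntry, (isDual_of_lt hq hqn).2 _ (by omega), Finset.sum_Ico_eq_sum_range, ← len]
  simp only [lSeries_eq_listL, Nat.sub_add_cancel h2, add_comm]

theorem rSeries_succ_succ (n q j : ℕ) : rSeries n q (j + 5) =
    aEntry n q (j + 4) * rSeries n q (j + 4) - rSeries n q (j + 3) := by
  simp only [rSeries, cSeries, dSeries, tSeries]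
  ring

/-- From index `3` on, `r` obeys the Euclidean recurrence for `n / (n - q)`, hence is positive,
strictly decreasing and ends in `0`. The remainder preceding `r_3` is `n - q`, not `r_2`. -/
theorem rSeries_eq_hjRem {n q : ℕ} (hqn : q < n) (j : ℕ) :
    rSeries n q (j + 3) = hjRem n (n - q) (j + 2) := by
  induction j using Nat.twoStepInduction with
  | zero =>
    simp [rSeries, cSeries, dSeries, tSeries, hjRem, aEntry, Nat.cast_sub hqn.le]
    ring
  | one =>
    simp [rSeries, cSeries, dSeries, tSeries, hjRem, aEntry, Nat.cast_sub hqn.le]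
    ring
  | more j h1 h2 =>
    rw [rSeries_succ_succ, h1, h2, hjRem]
    rfl

/-- Both sides satisfy the same recurrence. This identity gives the parity of `t_j`, and with it the
swap sign of the generators. -/
theorem tSeries_eq (n q j : ℕ) : tSeries n q (j + 3) = dSeries n q (j + 3) +
    (aEntry n q 2 - 2) * (cSeries n q (j + 3) + dSeries n q (j + 3)) := by
  induction j using Nat.twoStepInduction with
  | zero => simp [cSeries, dSeries, tSeries]; ring
  | one => simp [cSeries, dSeries, tSeries]; ring
  | more j h1 h2 =>
    rw [tSeries, h1, h2, cSeries, dSeries]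
    ring

/-- Consecutive pairs `(t_j, c_j + d_j)` satisfy a recurrence with transition matrix of determinant
one, so the determinant of neighbours never changes. -/
theorem det_tSeries (n q j : ℕ) :
    tSeries n q (j + 3) * (cSeries n q (j + 4) + dSeries n q (j + 4)) =
      tSeries n q (j + 4) * (cSeries n q (j + 3) + dSeries n q (j + 3)) + 1 := by
  induction j with
  | zero => simp [cSeries, dSeries, tSeries, mul_comm]
  | succ j ih =>
    rw [show j + 1 + 4 = j + 5 from rfl, show j + 1 + 3 = j + 4 from rfl, tSeries, cSeries, dSeries]
    linear_combination ih

/-! ### Telescoped recurrences from the dot diagram -/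

section

variable {n q : ℕ}

theorem sum_aEntry_sub_two (hq : 0 < q) (hqn : q < n) {j : ℕ} (h2 : 2 ≤ j)
    (hj : j ≤ lSeries n q (len n q)) (X : ℕ → ℤ) :
    ((aEntry n q j : ℤ) - 2) * X j =
      ∑ s ∈ Finset.Ico 1 (len n q), if lSeries n q s = j then X (lSeries n q s) else 0 := by
  rw [aEntry_eq hq hqn h2 hj]
  push_cast
  rw [add_sub_cancel_left, Finset.sum_mul]
  refine Finset.sum_congr rfl fun s _ => ?_
  split_ifs with h <;> simp [h]

/-- The recurrence says that the difference grows by `(a_j - 2) X_j` at each step, and duality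
rewrites this as a sum over rows. The initial term is `1` for `c` and `0` for `d`, which are the
exponents of the arrow `up`. -/
theorem diff_series (hq : 0 < q) (hqn : q < n) (X : ℕ → ℤ)
    (hX : ∀ j, X (j + 5) = aEntry n q (j + 4) * X (j + 4) - X (j + 3))
    (j : ℕ) (hj : j + 3 ≤ lSeries n q (len n q)) :
    X (j + 4) - X (j + 3) = X 4 - X 3 - (aEntry n q 3 - 2) * X 3 +
      ∑ s ∈ Finset.Ico 1 (len n q),
        if 3 ≤ lSeries n q s ∧ lSeries n q s ≤ j + 3 then X (lSeries n q s) else 0 := by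
  induction j with
  | zero =>
    rw [sum_aEntry_sub_two hq hqn (by norm_num) (by omega)]
    simp only [zero_add, ← le_antisymm_iff, eq_comm (a := 3)]
    ring
  | succ j ih =>
    have h1 := ih (by omega)
    have h2 := sum_aEntry_sub_two hq hqn (j := j + 4) (by omega) (by omega) X
    have h3 : ∀ s, (if 3 ≤ lSeries n q s ∧ lSeries n q s ≤ j + 1 + 3 then X (lSeries n q s) else 0)
        = (if 3 ≤ lSeries n q s ∧ lSeries n q s ≤ j + 3 then X (lSeries n q s) else 0) +
          if lSeries n q s = j + 4 then X (lSeries n q s) else 0 := by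
      intro s
      split_ifs <;> omega
    simp only [h3, Finset.sum_add_distrib]
    rw [show j + 1 + 4 = j + 5 from rfl, hX, show j + 1 + 3 = j + 4 from rfl]
    linear_combination h1 + h2

/-- The same telescoping from the other end, starting at the final remainder `0`; `i` is the
distance to that end. The sum therefore runs over the rows with large `l_s`, those crossed by a
backward chain from `W_N`. -/
theorem hjRem_sub_succ (hq : 0 < q) (hqn : q < n) (i j : ℕ)
    (hj : i + j + 2 = lSeries n q (len n q)) :
    hjRem n (n - q) (j + 1) - hjRem n (n - q) (j + 2) =
      hjRem n (n - q) (lSeries n q (len n q) - 1) +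
      ∑ s ∈ Finset.Ico 1 (len n q), if j + 2 < lSeries n q s then
        hjRem n (n - q) (lSeries n q s - 1) else 0 := by
  induction i generalizing j with
  | zero =>
    have h := length_hjExpansion_sub hq hqn
    have h0 := hjRem_length_add_one n (n - q)
    rw [show (hjExpansion n (n - q)).length + 1 = j + 2 by omega] at h0
    rw [h0, Finset.sum_eq_zero, ← hj]
    · simp
    · intro s hs
      rw [if_neg]
      have := lSeries_mono n q (Finset.mem_Ico.1 hs).2.le
      omega
  | succ i ih =>
    have h1 := ih (j + 1) (by omega)
    have h2 := sum_aEntry_sub_two hq hqn (j := j + 3) (by omega) (by omega)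
      (fun j => hjRem n (n - q) (j - 1))
    have h3 : ∀ s, (if j + 2 < lSeries n q s then hjRem n (n - q) (lSeries n q s - 1) else 0)
        = (if j + 1 + 2 < lSeries n q s then hjRem n (n - q) (lSeries n q s - 1) else 0) +
          if lSeries n q s = j + 3 then hjRem n (n - q) (lSeries n q s - 1) else 0 := by
      intro s
      split_ifs <;> omega
    simp only [h3, Finset.sum_add_distrib, ← h2]
    have h4 : hjRem n (n - q) (j + 1 + 2) = aEntry n q (j + 3) * hjRem n (n - q) (j + 2) -
      hjRem n (n - q) (j + 1) := rfl
    rw [h4] at h1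
    simp only [show j + 3 - 1 = j + 2 from rfl]
    rw [show j + 1 + 1 = j + 2 from rfl] at h1
    linear_combination h1

end

/-! ### The exponents as natural numbers -/

/-- The `r`-series as natural numbers. -/
def rNat (n q j : ℕ) : ℕ := (rSeries n q j).toNat

/-- The `c`-series as natural numbers. -/
def cNat (n q j : ℕ) : ℕ := (cSeries n q j).toNat

/-- The `d`-series as natural numbers. -/
def dNat (n q j : ℕ) : ℕ := (dSeries n q j).toNat

/-- The sum of the `c`-series and the `d`-series. -/
def kNat (n q j : ℕ) : ℕ := cNat n q j + dNat n q j

/-- The `t`-series as natural numbers. -/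
def tNat (n q j : ℕ) : ℕ := (tSeries n q j).toNat

theorem three_le_lSeries {n q t : ℕ} (hqn : q < n) (hν : nu n q + 1 < len n q)
    (ht : nu n q + 1 ≤ t) : 3 ≤ lSeries n q t :=
  ((three_le_alpha_nu_add_one hqn hν).trans (lSeries_nu_add_one hqn hν).ge).trans
    (lSeries_mono n q ht)

theorem nu_lt_of_three_le {n q t : ℕ} (h : 3 ≤ lSeries n q t) : nu n q + 1 ≤ t := by
  by_contra! h2
  have := lSeries_eq_two (show t ≤ nu n q by omega)
  omega

theorem sum_ite_Ico {a b c d : ℕ} (P : ℕ → Prop) [DecidablePred P] (X : ℕ → ℤ)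
    (h : ∀ s, (a ≤ s ∧ s < b) ∧ P s ↔ c ≤ s ∧ s < d) :
    (∑ s ∈ Finset.Ico a b, if P s then X s else 0) = ∑ s ∈ Finset.Ico c d, X s := by
  rw [← Finset.sum_filter]
  refine Finset.sum_congr ?_ fun _ _ => rfl
  ext s
  simp only [Finset.mem_filter, Finset.mem_Ico, h]

section

variable {n q : ℕ}

theorem cSeries_dSeries_succ (hq : 0 < q) (hqn : q < n) (j : ℕ)
    (hj : j + 3 ≤ lSeries n q (len n q)) :
    (cSeries n q (j + 4) = cSeries n q (j + 3) + 1 + ∑ s ∈ Finset.Ico 1 (len n q),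
      if 3 ≤ lSeries n q s ∧ lSeries n q s ≤ j + 3 then cSeries n q (lSeries n q s) else 0) ∧
    (dSeries n q (j + 4) = dSeries n q (j + 3) + ∑ s ∈ Finset.Ico 1 (len n q),
      if 3 ≤ lSeries n q s ∧ lSeries n q s ≤ j + 3 then dSeries n q (lSeries n q s) else 0) := by
  have h1 := diff_series hq hqn (cSeries n q) (fun j => rfl) j hj
  have h2 := diff_series hq hqn (dSeries n q) (fun j => rfl) j hj
  simp only [show cSeries n q 4 = 1 from rfl, show cSeries n q 3 = 0 from rfl] at h1
  simp only [show dSeries n q 4 = aEntry n q 3 - 1 from rfl, show dSeries n q 3 = 1 from rfl] at h2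
  constructor <;> linarith

theorem cSeries_dSeries_nonneg (hq : 0 < q) (hqn : q < n) (j : ℕ)
    (hj : j + 3 ≤ lSeries n q (len n q) + 1) :
    0 ≤ cSeries n q (j + 3) ∧ 1 ≤ dSeries n q (j + 3) := by
  induction j using Nat.strong_induction_on with
  | _ j ih =>
    cases j with
    | zero => simp [cSeries, dSeries]
    | succ j =>
      obtain ⟨h1, h2⟩ := cSeries_dSeries_succ hq hqn j (by omega)
      have h3 := ih j (by omega) (by omega)
      have h4 : ∀ s, 3 ≤ lSeries n q s ∧ lSeries n q s ≤ j + 3 →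
          0 ≤ cSeries n q (lSeries n q s) ∧ 1 ≤ dSeries n q (lSeries n q s) := by
        intro s hs
        have := ih (lSeries n q s - 3) (by omega) (by omega)
        rwa [Nat.sub_add_cancel hs.1] at this
      rw [show j + 1 + 3 = j + 4 from rfl, h1, h2]
      constructor
      · have : 0 ≤ ∑ s ∈ Finset.Ico 1 (len n q), if 3 ≤ lSeries n q s ∧ lSeries n q s ≤ j + 3 then
            cSeries n q (lSeries n q s) else 0 :=
          Finset.sum_nonneg fun s _ => by
            split_ifs with h
            · exact (h4 s h).1
            · exact le_rfl
        linarith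
      · have : 0 ≤ ∑ s ∈ Finset.Ico 1 (len n q), if 3 ≤ lSeries n q s ∧ lSeries n q s ≤ j + 3 then
            dSeries n q (lSeries n q s) else 0 :=
          Finset.sum_nonneg fun s _ => by
            split_ifs with h
            · exact zero_le_one.trans (h4 s h).2
            · exact le_rfl
        linarith

end

section

variable {n q : ℕ}

theorem rSeries_facts (hq : 0 < q) (hqn : q < n) :
    (∀ j, 3 ≤ j → j ≤ lSeries n q (len n q) → 0 < rSeries n q j ∧
      rSeries n q (j + 1) < rSeries n q j) ∧ rSeries n q (lSeries n q (len n q) + 1) = 0 := by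
  have hl := length_hjExpansion_sub hq hqn
  constructor
  · intro j h3 hj
    obtain ⟨j, rfl⟩ := Nat.exists_eq_add_of_le' h3
    have := hjRem_lt_and_pos (m := n) (k := n - q) (by omega) (j := j + 2) (by omega)
    rw [rSeries_eq_hjRem hqn, show j + 3 + 1 = (j + 1) + 3 from rfl, rSeries_eq_hjRem hqn]
    exact this.symm
  · have h0 := hjRem_length_add_one n (n - q)
    have h1 : (hjExpansion n (n - q)).length ≠ 0 := by
      rw [hjExpansion_of_pos _ (by omega)]
      simp
    rw [show lSeries n q (len n q) + 1 = (lSeries n q (len n q) - 2) + 3 by omega,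
      rSeries_eq_hjRem hqn, ← h0]
    congr 1
    omega

theorem rNat_cast (hq : 0 < q) (hqn : q < n) {j : ℕ} (h3 : 3 ≤ j)
    (hj : j ≤ lSeries n q (len n q) + 1) : (rNat n q j : ℤ) = rSeries n q j := by
  refine Int.toNat_of_nonneg ?_
  rcases Nat.lt_or_ge (lSeries n q (len n q)) j with h | h
  · obtain rfl : j = lSeries n q (len n q) + 1 := by omega
    exact (rSeries_facts hq hqn).2.ge
  · exact ((rSeries_facts hq hqn).1 j h3 h).1.le

theorem cNat_cast (hq : 0 < q) (hqn : q < n) {j : ℕ} (h2 : 2 ≤ j)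
    (hj : j ≤ lSeries n q (len n q) + 1) : (cNat n q j : ℤ) = cSeries n q j := by
  refine Int.toNat_of_nonneg ?_
  rcases Nat.lt_or_ge j 3 with h | h
  · obtain rfl : j = 2 := by omega
    simp [cSeries]
  · have := cSeries_dSeries_nonneg hq hqn (j - 3) (by omega)
    rw [Nat.sub_add_cancel h] at this
    exact this.1

theorem dNat_cast (hq : 0 < q) (hqn : q < n) {j : ℕ} (h2 : 2 ≤ j)
    (hj : j ≤ lSeries n q (len n q) + 1) : (dNat n q j : ℤ) = dSeries n q j := by
  refine Int.toNat_of_nonneg ?_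
  rcases Nat.lt_or_ge j 3 with h | h
  · obtain rfl : j = 2 := by omega
    simp [dSeries]
  · have := cSeries_dSeries_nonneg hq hqn (j - 3) (by omega)
    rw [Nat.sub_add_cancel h] at this
    exact zero_le_one.trans this.2

theorem two_le_aEntry_two (hq : 0 < q) (hqn : q < n) : 2 ≤ aEntry n q 2 := by
  refine two_le_of_mem_hjExpansion n (n - q) (by omega) _ ?_
  rw [aEntry, hjExpansion_of_pos _ (by omega)]
  simp

theorem tNat_cast (hq : 0 < q) (hqn : q < n) {j : ℕ} (h2 : 2 ≤ j)
    (hj : j ≤ lSeries n q (len n q) + 1) : (tNat n q j : ℤ) = tSeries n q j := by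
  refine Int.toNat_of_nonneg ?_
  rcases Nat.lt_or_ge j 3 with h | h
  · obtain rfl : j = 2 := by omega
    simp [tSeries]
  · have := cSeries_dSeries_nonneg hq hqn (j - 3) (by omega)
    have h4 := tSeries_eq n q (j - 3)
    rw [Nat.sub_add_cancel h] at this h4
    have h5 : (2 : ℤ) ≤ aEntry n q 2 := by exact_mod_cast two_le_aEntry_two hq hqn
    rw [h4]
    have := mul_nonneg (sub_nonneg.2 h5) (add_nonneg this.1 (zero_le_one.trans this.2))
    linarith

theorem lSeries_len_pos (hqn : q < n) (hν : nu n q + 1 < len n q) :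
    3 ≤ lSeries n q (len n q) := three_le_lSeries hqn hν hν.le

theorem rNat_sum (hq : 0 < q) (hqn : q < n) {s J : ℕ} (hs : 1 ≤ s)
    (hs1 : lSeries n q (s - 1) ≤ J) (hs2 : J < lSeries n q s) (hs3 : s ≤ len n q)
    (h2 : 2 ≤ J) (h3 : 3 ≤ lSeries n q (len n q)) :
    hjRem n (n - q) (J - 1) = rNat n q (J + 1) +
      ∑ p ∈ Finset.Ico s (len n q), rNat n q (lSeries n q p) +
      rNat n q (lSeries n q (len n q)) := by
  have hl := lSeries_mono n q hs3
  obtain ⟨j, rfl⟩ := Nat.exists_eq_add_of_le' h2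
  have h := hjRem_sub_succ hq hqn (lSeries n q (len n q) - 2 - j) j (by omega)
  have hr : ∀ i, 3 ≤ i → i ≤ lSeries n q (len n q) →
      hjRem n (n - q) (i - 1) = rNat n q i := by
    intro i hi hi2
    rw [rNat_cast hq hqn hi (by omega)]
    obtain ⟨i, rfl⟩ := Nat.exists_eq_add_of_le' hi
    rw [rSeries_eq_hjRem hqn]
    rfl
  rw [sum_ite_Ico (c := s) (d := len n q) (fun s => j + 2 < lSeries n q s)
    (fun s => hjRem n (n - q) (lSeries n q s - 1)), hr _ h3 le_rfl] at h
  · push_cast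
    rw [← hr (j + 2 + 1) (by omega) (by omega)]
    simp only [Nat.add_sub_cancel]
    rw [Finset.sum_congr rfl (g := fun p => (rNat n q (lSeries n q p) : ℤ))] at h
    · linarith
    · intro p hp
      rw [Finset.mem_Ico] at hp
      have := lSeries_mono n q hp.1
      have := lSeries_mono n q hp.2.le
      exact hr _ (by omega) (by omega)
  · intro p
    constructor
    · rintro ⟨⟨h1, h2⟩, h3⟩
      refine ⟨?_, h2⟩
      by_contra! h4
      have := lSeries_mono n q (show p ≤ s - 1 by omega)
      omega
    · rintro ⟨h1, h2⟩
      have := lSeries_mono n q h1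
      exact ⟨⟨by omega, h2⟩, by omega⟩

theorem sum_ite_lSeries {s J : ℕ} (hqn : q < n) (hν : nu n q + 1 < len n q)
    (hs1 : lSeries n q (s - 1) ≤ J)
    (hs2 : J < lSeries n q s ∨ s = len n q) (hs3 : s ≤ len n q) (X : ℕ → ℤ) :
    (∑ p ∈ Finset.Ico 1 (len n q), if 3 ≤ lSeries n q p ∧ lSeries n q p ≤ J then
      X (lSeries n q p) else 0) = ∑ p ∈ Finset.Ico (nu n q + 1) s, X (lSeries n q p) := by
  refine sum_ite_Ico (fun p => 3 ≤ lSeries n q p ∧ lSeries n q p ≤ J) _ fun p => ?_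
  constructor
  · rintro ⟨⟨h1, h2⟩, h3, h4⟩
    refine ⟨nu_lt_of_three_le h3, ?_⟩
    by_contra! h5
    have := lSeries_mono n q h5
    omega
  · rintro ⟨h1, h2⟩
    have := lSeries_mono n q (show p ≤ s - 1 by omega)
    exact ⟨⟨by omega, by omega⟩, three_le_lSeries hqn hν h1, by omega⟩

theorem cNat_dNat_sum {s J : ℕ} (hq : 0 < q) (hqn : q < n) (hν : nu n q + 1 < len n q)
    (hs3 : s ≤ len n q) (hs1 : lSeries n q (s - 1) ≤ J)
    (hs2 : J < lSeries n q s ∨ s = len n q) (hJ : J ≤ lSeries n q (len n q)) (h3 : 3 ≤ J) :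
    cNat n q (J + 1) = cNat n q J + 1 + ∑ p ∈ Finset.Ico (nu n q + 1) s, cNat n q (lSeries n q p) ∧
    dNat n q (J + 1) = dNat n q J + ∑ p ∈ Finset.Ico (nu n q + 1) s, dNat n q (lSeries n q p) := by
  obtain ⟨j, rfl⟩ := Nat.exists_eq_add_of_le' h3
  obtain ⟨h4, h5⟩ := cSeries_dSeries_succ hq hqn j hJ
  rw [sum_ite_lSeries hqn hν hs1 hs2 hs3] at h4 h5
  zify
  rw [cNat_cast hq hqn (by omega) (by omega), cNat_cast hq hqn (by omega) (by omega),
    dNat_cast hq hqn (by omega) (by omega), dNat_cast hq hqn (by omega) (by omega)]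
  have h6 : ∀ p ∈ Finset.Ico (nu n q + 1) s, 2 ≤ lSeries n q p ∧
      lSeries n q p ≤ lSeries n q (len n q) + 1 := by
    intro p hp
    rw [Finset.mem_Ico] at hp
    have := lSeries_mono n q (hp.2.le.trans hs3)
    have := three_le_lSeries hqn hν hp.1
    omega
  rw [Finset.sum_congr rfl fun p hp => cNat_cast hq hqn (h6 p hp).1 (h6 p hp).2,
    Finset.sum_congr rfl fun p hp => dNat_cast hq hqn (h6 p hp).1 (h6 p hp).2]
  exact ⟨h4, h5⟩

end

/-- The numerical properties of the exponents on which the proof is based. -/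
structure Numerics (n q : ℕ) : Prop where
  nu_lt : nu n q + 1 < len n q
  q_pos : 0 < q
  q_lt : q < n
  l_mono : Monotone (lSeries n q)
  l_nu : lSeries n q (nu n q) = 2
  l_succ : ∀ s, lSeries n q (s + 1) = lSeries n q s + (alpha n q (s + 1) - 2)
  l_first : lSeries n q (nu n q + 1) = alpha n q (nu n q + 1)
  three_le_l : ∀ s, nu n q + 1 ≤ s → 3 ≤ lSeries n q s
  two_le_a : 2 ≤ aEntry n q 2
  r_two : rNat n q 2 = rNat n q 3 + (n - q)
  r_pos : ∀ j, 3 ≤ j → j ≤ lSeries n q (len n q) → 0 < rNat n q j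
  r_last : rNat n q (lSeries n q (len n q) + 1) = 0
  r_anti : ∀ i j, 3 ≤ i → i < j → j ≤ lSeries n q (len n q) + 1 → rNat n q j < rNat n q i
  r_sum : ∀ s J, nu n q + 1 ≤ s → s ≤ len n q → lSeries n q (s - 1) ≤ J → J < lSeries n q s →
    3 ≤ J → rNat n q J = rNat n q (J + 1) + ∑ p ∈ Finset.Ico s (len n q), rNat n q (lSeries n q p) +
      rNat n q (lSeries n q (len n q))
  r_sum_all : n - q = rNat n q 3 + ∑ p ∈ Finset.Ico (nu n q + 1) (len n q), rNat n q (lSeries n q p) +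
      rNat n q (lSeries n q (len n q))
  c_sum : ∀ s J, nu n q + 1 ≤ s → s ≤ len n q → lSeries n q (s - 1) ≤ J →
    (J < lSeries n q s ∨ s = len n q) → J ≤ lSeries n q (len n q) → 3 ≤ J →
    cNat n q (J + 1) = cNat n q J + 1 + ∑ p ∈ Finset.Ico (nu n q + 1) s, cNat n q (lSeries n q p)
  d_sum : ∀ s J, nu n q + 1 ≤ s → s ≤ len n q → lSeries n q (s - 1) ≤ J →
    (J < lSeries n q s ∨ s = len n q) → J ≤ lSeries n q (len n q) → 3 ≤ J →
    dNat n q (J + 1) = dNat n q J + ∑ p ∈ Finset.Ico (nu n q + 1) s, dNat n q (lSeries n q p)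
  one_le_d : ∀ j, 3 ≤ j → j ≤ lSeries n q (len n q) + 1 → 1 ≤ dNat n q j
  k_strictMono : ∀ i j, 3 ≤ i → i < j → j ≤ lSeries n q (len n q) + 1 → kNat n q i < kNat n q j
  r_type : ∀ j, 2 ≤ j → j ≤ lSeries n q (len n q) + 1 →
    (n - q) * tNat n q j = rNat n q j + q * kNat n q j
  t_eq : ∀ j, 3 ≤ j → j ≤ lSeries n q (len n q) + 1 →
    tNat n q j = dNat n q j + (aEntry n q 2 - 2) * kNat n q j
  det : ∀ j, 3 ≤ j → j ≤ lSeries n q (len n q) →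
    tNat n q j * kNat n q (j + 1) = tNat n q (j + 1) * kNat n q j + 1

theorem numerics {n q : ℕ} (hq : 0 < q) (hqn : q < n) (hν : nu n q + 1 < len n q) :
    Numerics n q where
  nu_lt := hν
  q_pos := hq
  q_lt := hqn
  l_mono := lSeries_mono n q
  l_nu := lSeries_eq_two le_rfl
  l_succ := lSeries_succ n q
  l_first := lSeries_nu_add_one hqn hν
  three_le_l s := three_le_lSeries hqn hν
  two_le_a := two_le_aEntry_two hq hqn
  r_two := by
    have h3 := lSeries_len_pos hqn hν
    have h1 := rNat_cast hq hqn le_rfl (by omega)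
    have h2 : rSeries n q 2 = rSeries n q 3 + ((n : ℤ) - q) := by
      simp [rSeries, cSeries, dSeries, tSeries]
      ring
    rw [rNat, h2, ← h1, ← Nat.cast_sub hqn.le, ← Nat.cast_add, Int.toNat_natCast]
  r_pos j h3 hj := by
    zify
    rw [rNat_cast hq hqn h3 (by omega)]
    exact ((rSeries_facts hq hqn).1 j h3 hj).1
  r_last := by rw [rNat, (rSeries_facts hq hqn).2]; rfl
  r_anti i j h3 hij hj := by
    induction j, hij using Nat.le_induction with
    | base =>
      zify
      rw [rNat_cast hq hqn h3 (by omega), rNat_cast hq hqn (by omega) hj]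
      exact ((rSeries_facts hq hqn).1 i h3 (by omega)).2
    | succ j hij ih =>
      refine lt_trans ?_ (ih (by omega))
      zify
      rw [rNat_cast hq hqn (by omega) hj, rNat_cast hq hqn (by omega) (by omega)]
      exact ((rSeries_facts hq hqn).1 j (by omega) (by omega)).2
  r_sum s J h0 h1 h2 h3 h4 := by
    have h := rNat_sum hq hqn (by omega) h2 h3 h1 (by omega) (lSeries_len_pos hqn hν)
    have h5 := lSeries_mono n q h1
    rw [show J - 1 = (J - 3) + 2 by omega, ← rSeries_eq_hjRem hqn, Nat.sub_add_cancel h4,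
      ← rNat_cast hq hqn h4 (by omega)] at h
    exact_mod_cast h
  r_sum_all := by
    have h := rNat_sum (s := nu n q + 1) (J := 2) hq hqn (by omega) (lSeries_eq_two le_rfl).le
      (three_le_lSeries hqn hν le_rfl) hν.le le_rfl (lSeries_len_pos hqn hν)
    have h5 : hjRem n (n - q) (2 - 1) = (n - q : ℕ) := rfl
    rw [h5] at h
    exact_mod_cast h
  c_sum s J _ h1 h2 h3 h4 h5 := (cNat_dNat_sum hq hqn hν h1 h2 h3 h4 h5).1
  d_sum s J _ h1 h2 h3 h4 h5 := (cNat_dNat_sum hq hqn hν h1 h2 h3 h4 h5).2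
  one_le_d j h3 hj := by
    have h := (cSeries_dSeries_nonneg hq hqn (j - 3) (by omega)).2
    rw [Nat.sub_add_cancel h3, ← dNat_cast hq hqn (by omega) hj] at h
    exact_mod_cast h
  k_strictMono i j h3 hij hj := by
    have key : ∀ J, 3 ≤ J → J ≤ lSeries n q (len n q) → kNat n q J < kNat n q (J + 1) := by
      intro J h3 hJ
      obtain ⟨s, h0, h1, h2, h4⟩ : ∃ s, nu n q + 1 ≤ s ∧ s ≤ len n q ∧ lSeries n q (s - 1) ≤ J ∧
          (J < lSeries n q s ∨ s = len n q) := by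
        -- The required `s` is the first with `l_s > J`; for `J = l_N` there is none, and `s = N`
        -- serves instead.
        by_cases h : ∃ s, J < lSeries n q s ∧ s ≤ len n q
        · classical
          have h1 := Nat.find_spec h
          have h0 := nu_lt_of_three_le (h3.trans h1.1.le)
          refine ⟨Nat.find h, h0, h1.2, ?_, Or.inl h1.1⟩
          have h2 := Nat.find_min h (m := Nat.find h - 1) (by omega)
          push Not at h2
          by_contra! h4
          have := h2 h4
          omega
        · push Not at h
          refine ⟨len n q, hν.le, le_rfl, ?_, Or.inr rfl⟩
          by_contra! h4
          have := h _ h4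
          omega
      obtain ⟨h5, h6⟩ := cNat_dNat_sum hq hqn hν h1 h2 h4 hJ h3
      rw [kNat, kNat, h5, h6]
      omega
    induction j, hij using Nat.le_induction with
    | base => exact key i h3 (by omega)
    | succ j hij ih => exact (ih (by omega)).trans (key j (by omega) (by omega))
  r_type j h2 hj := by
    have hc := cNat_cast hq hqn h2 hj
    have hd := dNat_cast hq hqn h2 hj
    have ht := tNat_cast hq hqn h2 hj
    have hr : (rNat n q j : ℤ) = rSeries n q j := by
      rcases Nat.lt_or_ge j 3 with h | h
      · obtain rfl : j = 2 := by omega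
        have h3 := rNat_cast hq hqn le_rfl (by have := lSeries_len_pos hqn hν; omega)
        refine Int.toNat_of_nonneg ?_
        have h4 : rSeries n q 2 = rSeries n q 3 + ((n : ℤ) - q) := by
          simp [rSeries, cSeries, dSeries, tSeries]
          ring
        rw [h4]
        omega
      · exact rNat_cast hq hqn h hj
    zify [hqn.le]
    rw [kNat, Nat.cast_add, hc, hd, ht, hr, rSeries]
    ring
  t_eq j h3 hj := by
    have h := tSeries_eq n q (j - 3)
    rw [Nat.sub_add_cancel h3, ← cNat_cast hq hqn (by omega) hj,
      ← dNat_cast hq hqn (by omega) hj, ← tNat_cast hq hqn (by omega) hj] at h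
    zify [two_le_aEntry_two hq hqn]
    rw [kNat, h]
    push_cast
    ring
  det j h3 hj := by
    have h := det_tSeries n q (j - 3)
    rw [Nat.sub_add_cancel h3, show j - 3 + 4 = j + 1 by omega,
      ← cNat_cast hq hqn (by omega) (by omega),
      ← dNat_cast hq hqn (by omega) (by omega), ← tNat_cast hq hqn (by omega) (by omega),
      ← cNat_cast hq hqn (by omega) (by omega),
      ← dNat_cast hq hqn (by omega) (by omega), ← tNat_cast hq hqn (by omega) (by omega)] at h
    zify
    rw [kNat, kNat]
    push_cast
    exact h

/-! ### Walks -/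

section

variable {n q : ℕ}

/-- The exponent of `xy` in the label of an arrow. -/
def arrowB : Arrow n q → ℕ
  | .up => 0
  | .down => rNat n q 2
  | .g => 2 * rNat n q 3
  | .fwd _ _ _ => 0
  | .bwd t _ _ => rNat n q (lSeries n q t)
  | .out => 0
  | .into => rNat n q (lSeries n q (len n q))
  | .extraFirst t _ _ => rNat n q (t + 2)
  | .extra s t _ _ _ _ => rNat n q (t + lSeries n q (s - 1))

/-- The exponent of `u₂` in the label of an arrow. -/
def arrowI : Arrow n q → ℕ
  | .up => 1
  | .down => 0
  | .g => 1
  | .fwd t _ _ => cNat n q (lSeries n q t)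
  | .bwd _ _ _ => 0
  | .out => cNat n q (lSeries n q (len n q))
  | .into => 0
  | .extraFirst t _ _ => cNat n q (t + 1)
  | .extra s t _ _ _ _ => cNat n q (t - 1 + lSeries n q (s - 1))

/-- The exponent of `u₃` in the label of an arrow. -/
def arrowJ : Arrow n q → ℕ
  | .up => 0
  | .down => 0
  | .g => 0
  | .fwd t _ _ => dNat n q (lSeries n q t)
  | .bwd _ _ _ => 0
  | .out => dNat n q (lSeries n q (len n q))
  | .into => 0
  | .extraFirst t _ _ => dNat n q (t + 1)
  | .extra s t _ _ _ _ => dNat n q (t - 1 + lSeries n q (s - 1))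

/-- `Walk hν A v w b i j`: there is a path from `v` to `w` with arrows in `A` and with label
`(xy) ^ b * u₂ ^ i * u₃ ^ j`. -/
inductive Walk (hν : nu n q + 1 < len n q) (A : Set (Arrow n q)) (v : Vertex n q) :
    Vertex n q → ℕ → ℕ → ℕ → Prop
  | nil : Walk hν A v v 0 0 0
  | cons {b i j : ℕ} (a : Arrow n q) (ha : a ∈ A) (h : Walk hν A v (arrowSource hν a) b i j) :
      Walk hν A v (arrowTarget hν a) (b + arrowB a) (i + arrowI a) (j + arrowJ a)

variable {hν : nu n q + 1 < len n q} {A : Set (Arrow n q)}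

theorem Walk.single (a : Arrow n q) (ha : a ∈ A) :
    Walk hν A (arrowSource hν a) (arrowTarget hν a) (arrowB a) (arrowI a) (arrowJ a) := by
  simpa using Walk.cons a ha (Walk.nil (hν := hν))

theorem Walk.trans {u v w : Vertex n q} {b i j b' i' j' : ℕ} (h : Walk hν A u v b i j)
    (h' : Walk hν A v w b' i' j') : Walk hν A u w (b + b') (i + i') (j + j') := by
  induction h' with
  | nil => exact h
  | cons a ha _ ih => simpa only [add_assoc] using Walk.cons a ha ih

theorem Walk.cast {u v : Vertex n q} {b i j b' i' j' : ℕ} (h : Walk hν A u v b i j)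
    (hb : b = b') (hi : i = i') (hj : j = j') : Walk hν A u v b' i' j' := by
  subst hb hi hj
  exact h

theorem walk_fwd {s t : ℕ} (hs : nu n q + 1 ≤ s) (hst : s ≤ t) (ht : t ≤ len n q) :
    Walk hν Set.univ (.W s hs (hst.trans ht)) (.W t (hs.trans hst) ht) 0
      (∑ p ∈ Finset.Ico s t, cNat n q (lSeries n q p))
      (∑ p ∈ Finset.Ico s t, dNat n q (lSeries n q p)) := by
  induction t, hst using Nat.le_induction with
  | base => simpa using Walk.nil
  | succ t hst ih =>
    rw [Finset.sum_Ico_succ_top hst, Finset.sum_Ico_succ_top hst]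
    exact Walk.cons (.fwd t (hs.trans hst) ht) (Set.mem_univ _) (ih (by omega))

theorem walk_bwd {s t : ℕ} (hs : nu n q + 1 ≤ s) (hst : s ≤ t) (ht : t ≤ len n q) :
    Walk hν Set.univ (.W t (hs.trans hst) ht) (.W s hs (hst.trans ht))
      (∑ p ∈ Finset.Ico s t, rNat n q (lSeries n q p)) 0 0 := by
  induction t, hst using Nat.le_induction with
  | base => simpa using Walk.nil
  | succ t hst ih =>
    rw [Finset.sum_Ico_succ_top hst]
    exact ((Walk.single (.bwd t (hs.trans hst) ht) (Set.mem_univ _)).trans (ih (by omega))).cast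
      (add_comm _ _) rfl rfl

theorem exists_block {J : ℕ} (h3 : 3 ≤ J)
    (hJ : J ≤ lSeries n q (len n q)) : ∃ s, nu n q + 1 ≤ s ∧ s ≤ len n q ∧
      lSeries n q (s - 1) < J ∧ J ≤ lSeries n q s := by
  classical
  have h : ∃ s, J ≤ lSeries n q s := ⟨_, hJ⟩
  have h1 := Nat.find_spec h
  have h0 := nu_lt_of_three_le (h3.trans h1)
  exact ⟨Nat.find h, h0, Nat.find_min' h hJ,
    not_le.1 (Nat.find_min h (m := Nat.find h - 1) (by omega)), h1⟩

/-- Both kinds of extra arrow, indexed uniformly by the exponent `r_J`. Block `s` consists of the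
`J` with `l_{s-1} < J ≤ l_s`; in the first block `J = 3` is absent, since there the parameter starts
at `2`. -/
theorem walk_extra (H : Numerics n q) {s J : ℕ} (h4 : 4 ≤ J) (hs : nu n q + 1 ≤ s)
    (hs' : s ≤ len n q) (h1 : lSeries n q (s - 1) < J) (h2 : J ≤ lSeries n q s) :
    Walk hν Set.univ (.W s hs hs') .R (rNat n q J) (cNat n q (J - 1)) (dNat n q (J - 1)) := by
  rcases hs.eq_or_lt with h | h
  · subst h
    refine (Walk.single (.extraFirst (J - 2) (by omega) ?_) (Set.mem_univ _)).cast ?_ ?_ ?_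
    · rw [← H.l_first]
      omega
    · simp only [arrowB]
      congr 1
      omega
    · simp only [arrowI]
      congr 1
      omega
    · simp only [arrowJ]
      congr 1
      omega
  · have h5 := H.l_succ (s - 1)
    rw [Nat.sub_add_cancel (by omega)] at h5
    refine (Walk.single (.extra s (J - lSeries n q (s - 1)) h hs' (by omega) (by omega))
      (Set.mem_univ _)).cast ?_ ?_ ?_
    · simp only [arrowB]
      congr 1
      omega
    · simp only [arrowI]
      congr 1
      omega
    · simp only [arrowJ]
      congr 1
      omega

theorem walk_into_bwd {t : ℕ} (hs : nu n q + 1 ≤ t) (ht : t ≤ len n q) :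
    Walk hν Set.univ .R (.W t hs ht) (rNat n q (lSeries n q (len n q)) +
      ∑ p ∈ Finset.Ico t (len n q), rNat n q (lSeries n q p)) 0 0 :=
  (Walk.single (hν := hν) (.into) (Set.mem_univ _)).trans (walk_bwd hs ht le_rfl)

theorem walk_up_fwd {t : ℕ} (hs : nu n q + 1 ≤ t) (ht : t ≤ len n q) :
    Walk hν Set.univ .R (.W t hs ht) 0
      (1 + ∑ p ∈ Finset.Ico (nu n q + 1) t, cNat n q (lSeries n q p))
      (∑ p ∈ Finset.Ico (nu n q + 1) t, dNat n q (lSeries n q p)) :=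
  ((Walk.single (hν := hν) (.up) (Set.mem_univ _)).trans (walk_fwd le_rfl hs ht)).cast rfl rfl
    (zero_add _)

/-- A closed walk which passes through both `v` and `w`. -/
def ClosedThrough (hν : nu n q + 1 < len n q) (v w : Vertex n q) (b i j : ℕ) : Prop :=
  Walk hν Set.univ v v b i j ∧ Walk hν Set.univ w w b i j

theorem Walk.closedThrough {v w : Vertex n q} {b i j b' i' j' b'' i'' j'' : ℕ}
    (h : Walk hν Set.univ v w b i j) (h' : Walk hν Set.univ w v b' i' j')
    (hb : b + b' = b'') (hi : i + i' = i'') (hj : j + j' = j'') :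
    ClosedThrough hν v w b'' i'' j'' :=
  ⟨(h.trans h').cast hb hi hj, (h'.trans h).cast (by omega) (by omega) (by omega)⟩

/-- The full backward chain, including `into`, collects `n - q - r_3`, and `down` adds `r_2 = r_3 +
(n - q)`. -/
theorem closedThrough_one (H : Numerics n q) {t : ℕ} (hs : nu n q + 1 ≤ t) (ht : t ≤ len n q) :
    ClosedThrough hν .R (.W t hs ht) (2 * (n - q)) 0 0 := by
  refine (walk_into_bwd hs ht).closedThrough
    ((walk_bwd le_rfl hs ht).trans (Walk.single (.down) (Set.mem_univ _))) ?_ rfl rfl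
  have h1 := H.r_sum_all
  have h2 := H.r_two
  have h3 := Finset.sum_Ico_consecutive (fun p => rNat n q (lSeries n q p)) hs ht
  simp only [arrowB]
  omega

/-- The same chain closed by `g`, whose exponent `2 r_3` is what turns `n - q - r_3` into `r_2`. -/
theorem closedThrough_two (H : Numerics n q) {t : ℕ} (hs : nu n q + 1 ≤ t) (ht : t ≤ len n q) :
    ClosedThrough hν .R (.W t hs ht) (rNat n q 2) 1 0 := by
  refine (walk_into_bwd hs ht).closedThrough
    ((walk_bwd le_rfl hs ht).trans (Walk.single (.g) (Set.mem_univ _))) ?_ rfl rfl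
  have h1 := H.r_sum_all
  have h2 := H.r_two
  have h3 := Finset.sum_Ico_consecutive (fun p => rNat n q (lSeries n q p)) hs ht
  simp only [arrowB]
  omega

/-- The forward chain through `W_t` to the block of `J`, closed by the extra arrow `r_J`; the chain
supplies exactly the increments `c_J - c_{J-1}` and `d_J - d_{J-1}`. -/
theorem closedThrough_of_lt (H : Numerics n q) {t J : ℕ} (hs : nu n q + 1 ≤ t)
    (ht : t ≤ len n q) (hJ : lSeries n q t < J) (hJ' : J ≤ lSeries n q (len n q)) :
    ClosedThrough hν .R (.W t hs ht) (rNat n q J) (cNat n q J) (dNat n q J) := by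
  have h3 := H.three_le_l t hs
  obtain ⟨s, hs1, hs2, hs3, hs4⟩ := exists_block (by omega) hJ'
  have hts : t ≤ s := by
    by_contra! h
    have := H.l_mono h.le
    omega
  refine (walk_up_fwd hs ht).closedThrough
    ((walk_fwd hs hts hs2).trans (walk_extra H (by omega) hs1 hs2 hs3 hs4)) (by simp) ?_ ?_
  · have h1 := H.c_sum s (J - 1) hs1 hs2 (by omega) (by omega) (by omega) (by omega)
    have h2 := Finset.sum_Ico_consecutive (fun p => cNat n q (lSeries n q p)) hs hts
    rw [Nat.sub_add_cancel (by omega)] at h1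
    omega
  · have h1 := H.d_sum s (J - 1) hs1 hs2 (by omega) (by omega) (by omega) (by omega)
    have h2 := Finset.sum_Ico_consecutive (fun p => dNat n q (lSeries n q p)) hs hts
    rw [Nat.sub_add_cancel (by omega)] at h1
    omega

theorem closedThrough_last (H : Numerics n q) {t : ℕ} (hs : nu n q + 1 ≤ t)
    (ht : t ≤ len n q) : ClosedThrough hν .R (.W t hs ht) (rNat n q (lSeries n q (len n q) + 1))
      (cNat n q (lSeries n q (len n q) + 1)) (dNat n q (lSeries n q (len n q) + 1)) := by
  have h3 := H.three_le_l _ H.nu_lt.le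
  have h4 := H.l_mono (Nat.sub_le (len n q) 1)
  refine (walk_up_fwd hs ht).closedThrough
    ((walk_fwd hs ht le_rfl).trans (Walk.single (.out) (Set.mem_univ _))) ?_ ?_ ?_
  · rw [H.r_last]
    rfl
  · have h1 := H.c_sum (len n q) _ H.nu_lt.le le_rfl h4 (Or.inr rfl) le_rfl h3
    have h2 := Finset.sum_Ico_consecutive (fun p => cNat n q (lSeries n q p)) hs ht
    simp only [arrowI]
    omega
  · have h1 := H.d_sum (len n q) _ H.nu_lt.le le_rfl h4 (Or.inr rfl) le_rfl h3
    have h2 := Finset.sum_Ico_consecutive (fun p => dNat n q (lSeries n q p)) hs ht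
    simp only [arrowJ]
    omega

/-- The backward chain through `W_t` to the block of `J + 1`, closed by the extra arrow `r_{J+1}`;
the chain supplies `r_J - r_{J+1}`. -/
theorem closedThrough_of_gt (H : Numerics n q) {t J : ℕ} (hs : nu n q + 1 ≤ t)
    (ht : t ≤ len n q) (h3 : 3 ≤ J) (hJ : J < lSeries n q t) :
    ClosedThrough hν .R (.W t hs ht) (rNat n q J) (cNat n q J) (dNat n q J) := by
  have hl := H.l_mono ht
  obtain ⟨s, hs1, hs2, hs3, hs4⟩ := exists_block (n := n) (q := q) (J := J + 1) (by omega) (by omega)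
  have hts : s ≤ t := by
    by_contra! h
    have := H.l_mono (show t ≤ s - 1 by omega)
    omega
  refine (walk_into_bwd hs ht).closedThrough
    ((walk_bwd hs1 hts ht).trans (walk_extra H (by omega) hs1 hs2 hs3 hs4)) ?_ (by simp) (by simp)
  have h1 := H.r_sum s J hs1 hs2 (by omega) (by omega) h3
  have h2 := Finset.sum_Ico_consecutive (fun p => rNat n q (lSeries n q p)) hts ht
  omega

theorem closedThrough_len (H : Numerics n q) :
    ClosedThrough hν .R (.W (len n q) H.nu_lt.le le_rfl) (rNat n q (lSeries n q (len n q)))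
      (cNat n q (lSeries n q (len n q))) (dNat n q (lSeries n q (len n q))) :=
  (Walk.single (.into) (Set.mem_univ _)).closedThrough (Walk.single (.out) (Set.mem_univ _)) rfl
    (zero_add _) (zero_add _)

theorem walk_at_len (H : Numerics n q) {J : ℕ} (h3 : 3 ≤ J)
    (hJ : J ≤ lSeries n q (len n q) + 1) :
    ClosedThrough hν .R (.W (len n q) H.nu_lt.le le_rfl) (rNat n q J) (cNat n q J)
      (dNat n q J) := by
  rcases hJ.eq_or_lt with rfl | h
  · exact closedThrough_last H _ _
  rcases (Nat.le_of_lt_succ h).eq_or_lt with rfl | h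
  · exact closedThrough_len H
  · exact closedThrough_of_gt H _ _ h3 h

/-- Every generator of the ring of invariants is the label of a cycle at every vertex. -/
theorem walk_generator (H : Numerics n q) (v : Vertex n q) :
    Walk hν Set.univ v v (2 * (n - q)) 0 0 ∧ Walk hν Set.univ v v (rNat n q 2) 1 0 ∧
      ∀ J, 3 ≤ J → J ≤ lSeries n q (len n q) + 1 →
        Walk hν Set.univ v v (rNat n q J) (cNat n q J) (dNat n q J) := by
  cases v with
  | R => exact ⟨(closedThrough_one H H.nu_lt.le le_rfl).1, (closedThrough_two H H.nu_lt.le le_rfl).1,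
      fun J h3 hJ => (walk_at_len H h3 hJ).1⟩
  | W t h h' =>
    refine ⟨(closedThrough_one H h h').2, (closedThrough_two H h h').2, fun J h3 hJ => ?_⟩
    rcases h'.eq_or_lt with rfl | h''
    · exact (walk_at_len H h3 hJ).2
    rcases hJ.eq_or_lt with rfl | hJ
    · exact (closedThrough_last H h h').2
    rcases lt_trichotomy (lSeries n q t) J with h1 | h1 | h1
    · exact (closedThrough_of_lt H h h' h1 (by omega)).2
    · subst h1
      exact ((Walk.single (.fwd t h h'') (Set.mem_univ _)).trans (Walk.single (.bwd t h h'') (Set.mem_univ _))).cast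
        (zero_add _) rfl rfl
    · exact (closedThrough_of_gt H h h' h3 h1).2

end

section

variable {n q : ℕ} {hν : nu n q + 1 < len n q}

/-! ### Cycles of every degree -/

/-- There is a cycle at `v` whose label has degree `2 * (n - q) * m` and degree `k` in `u₂`, `u₃`,
and which has the symmetry of an invariant. -/
def IsCycleType (hν : nu n q + 1 < len n q) (v : Vertex n q) (m k : ℕ) : Prop :=
  ∃ b i j, Walk hν Set.univ v v b i j ∧ i + j = k ∧ b + q * k = (n - q) * m ∧
    Even (j + m + aEntry n q 2 * k)

theorem IsCycleType.zero (v : Vertex n q) : IsCycleType hν v 0 0 :=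
  ⟨0, 0, 0, Walk.nil, rfl, rfl, by simp⟩

theorem IsCycleType.add {v : Vertex n q} {m k m' k' : ℕ} (h : IsCycleType hν v m k)
    (h' : IsCycleType hν v m' k') : IsCycleType hν v (m + m') (k + k') := by
  obtain ⟨b, i, j, h1, h2, h3, h4⟩ := h
  obtain ⟨b', i', j', h1', h2', h3', h4'⟩ := h'
  refine ⟨_, _, _, h1.trans h1', by omega, by linarith, ?_⟩
  have := h4.add h4'
  rw [Nat.even_iff] at this ⊢
  rw [mul_add]
  omega

theorem IsCycleType.mul {v : Vertex n q} {m k : ℕ} (h : IsCycleType hν v m k) (x : ℕ) :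
    IsCycleType hν v (x * m) (x * k) := by
  induction x with
  | zero => simpa using IsCycleType.zero v
  | succ x ih => simpa [add_mul] using ih.add h

theorem IsCycleType.one (H : Numerics n q) (v : Vertex n q) : IsCycleType hν v 2 0 :=
  ⟨_, _, _, (walk_generator H v).1, rfl, by ring, by simp⟩

theorem IsCycleType.two (H : Numerics n q) (v : Vertex n q) :
    IsCycleType hν v (aEntry n q 2) 1 := by
  refine ⟨_, _, _, (walk_generator H v).2.1, rfl, ?_, by simp⟩
  have h3 := H.three_le_l _ H.nu_lt.le
  exact (H.r_type 2 le_rfl (by omega)).symm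

theorem IsCycleType.of_three_le (H : Numerics n q) (v : Vertex n q) {J : ℕ} (h3 : 3 ≤ J)
    (hJ : J ≤ lSeries n q (len n q) + 1) : IsCycleType hν v (tNat n q J) (kNat n q J) := by
  refine ⟨_, _, _, (walk_generator H v).2.2 J h3 hJ, rfl, (H.r_type J (by omega) hJ).symm, ?_⟩
  -- The swap sign of `u₂^c u₃^d` is `(-1)^(a₂ k + d)`, and this formula for `t_J` shows that it
  -- equals `(-1)^(t_J)`.
  rw [H.t_eq J h3 hJ]
  obtain ⟨a, ha⟩ := Nat.exists_eq_add_of_le' H.two_le_a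
  rw [ha, Nat.add_sub_cancel]
  exact ⟨dNat n q J + (a + 1) * kNat n q J, by ring⟩

theorem tNat_three (H : Numerics n q) : tNat n q 3 = aEntry n q 2 - 1 := by
  have := H.two_le_a
  rw [tNat, tSeries]
  omega

/-- Either `(m, k)` lies between `(1, 0)` and `(t_3, k_3)`, where parity has to be watched, or it
lies in a unimodular cone spanned by two neighbouring generators. The excluded points, `k = 0` with
`m` odd, have zero symmetrized monomial. -/
theorem isCycleType_of_le (H : Numerics n q) (v : Vertex n q) {m k : ℕ}
    (h : q * k ≤ (n - q) * m) (hmk : 0 < k ∨ Even m) : IsCycleType hν v m k := by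
  have hl := H.three_le_l _ H.nu_lt.le
  have ha := H.two_le_a
  have hk3 : kNat n q 3 = 1 := rfl
  have ht3 := tNat_three H
  have z3 := IsCycleType.of_three_le (hν := hν) H v le_rfl (show 3 ≤ _ by omega)
  rw [hk3, ht3] at z3
  by_cases hm : (aEntry n q 2 - 1) * k ≤ m
  · obtain ⟨s, rfl⟩ := Nat.exists_eq_add_of_le hm
    rcases Nat.even_or_odd s with hs | ⟨s, rfl⟩
    · obtain ⟨s, rfl⟩ := hs
      convert (z3.mul k).add ((IsCycleType.one H v).mul s) using 1
      · ring
      · ring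
    -- An odd surplus `s` is absorbed by replacing one copy of `(a₂ - 1, 1)` by `(a₂, 1)`, so at
    -- least one copy is needed.
    · have hk : 0 < k := by
        rcases hmk with h | h
        · exact h
        · by_contra! h0
          obtain rfl : k = 0 := by omega
          rw [mul_zero, zero_add] at h
          exact absurd h (by simp)
      obtain ⟨k, rfl⟩ := Nat.exists_eq_add_of_lt hk
      convert ((z3.mul k).add (IsCycleType.two H v)).add ((IsCycleType.one H v).mul s) using 1
      · obtain ⟨a, ha⟩ := Nat.exists_eq_add_of_le' ha
        rw [ha, show a + 2 - 1 = a + 1 by omega]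
        ring
      · ring
  -- The last generator has `r = 0`, so it spans the boundary ray `q k = (n - q) m` of the cone.
  · have hlast : tNat n q (lSeries n q (len n q) + 1) * k ≤
        m * kNat n q (lSeries n q (len n q) + 1) := by
      have h1 := H.r_type (lSeries n q (len n q) + 1) (by omega) le_rfl
      rw [H.r_last, zero_add] at h1
      have h2 := H.q_lt
      refine Nat.le_of_mul_le_mul_left (c := n - q) ?_ (by omega)
      calc (n - q) * (tNat n q (lSeries n q (len n q) + 1) * k)
          = kNat n q (lSeries n q (len n q) + 1) * (q * k) := by rw [← mul_assoc, h1]; ring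
        _ ≤ kNat n q (lSeries n q (len n q) + 1) * ((n - q) * m) := Nat.mul_le_mul_left _ h
        _ = _ := by ring
    classical
    have hex : ∃ J, 3 ≤ J ∧ tNat n q (J + 1) * k ≤ m * kNat n q (J + 1) := ⟨_, hl, hlast⟩
    obtain ⟨J, hJ, hmin⟩ : ∃ J, (3 ≤ J ∧ tNat n q (J + 1) * k ≤ m * kNat n q (J + 1)) ∧
        ∀ i < J, ¬ (3 ≤ i ∧ tNat n q (i + 1) * k ≤ m * kNat n q (i + 1)) :=
      ⟨Nat.find hex, Nat.find_spec hex, fun i hi => Nat.find_min hex hi⟩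
    have hJl : J ≤ lSeries n q (len n q) := by
      by_contra! h1
      exact hmin _ h1 ⟨hl, hlast⟩
    have hJ2 : m * kNat n q J ≤ tNat n q J * k := by
      rcases hJ.1.eq_or_lt with h1 | h1
      · rw [← h1, hk3, ht3]
        omega
      · have := hmin (J - 1) (by omega)
        rw [Nat.sub_add_cancel (by omega)] at this
        omega
    have hdet := H.det J hJ.1 hJl
    obtain ⟨x, hx⟩ := Nat.exists_eq_add_of_le hJ.2
    obtain ⟨y, hy⟩ := Nat.exists_eq_add_of_le hJ2
    -- Cramer's rule: `x` and `y` are the minors of `(m, k)` against the two neighbouring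
    -- generators, whose determinant is one.
    convert ((IsCycleType.of_three_le H v hJ.1 (by omega)).mul x).add
      ((IsCycleType.of_three_le H v (J := J + 1) (by omega) (by omega)).mul y) using 1
    · zify at hdet hx hy ⊢
      linear_combination (-(m : ℤ)) * hdet + (tNat n q J : ℤ) * hx + (tNat n q (J + 1) : ℤ) * hy
    · zify at hdet hx hy ⊢
      linear_combination (-(k : ℤ)) * hdet + (kNat n q J : ℤ) * hx + (kNat n q (J + 1) : ℤ) * hy

end

/-! ### Invariance under the group -/

section

variable {K : Type*} [Field K]

/-- The substitution `x ↦ a x`, `y ↦ b y`. -/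
noncomputable def diagSubst (a b : K) : MvPolynomial (Fin 2) K →ₐ[K] MvPolynomial (Fin 2) K :=
  aeval ![C a * X 0, C b * X 1]

/-- The substitution `x ↦ c y`, `y ↦ c x`. -/
noncomputable def swapSubst (c : K) : MvPolynomial (Fin 2) K →ₐ[K] MvPolynomial (Fin 2) K :=
  aeval ![C c * X 1, C c * X 0]

theorem substitute_eq_diagSubst {g : GL (Fin 2) K} {a b : K}
    (h : (g : Matrix (Fin 2) (Fin 2) K) = !![a, 0; 0, b]) : substitute g = diagSubst a b := by
  refine MvPolynomial.algHom_ext fun i => ?_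
  fin_cases i <;> simp [substitute, diagSubst, h, Fin.sum_univ_two]

theorem substitute_eq_swapSubst {g : GL (Fin 2) K} {c : K}
    (h : (g : Matrix (Fin 2) (Fin 2) K) = !![0, c; c, 0]) : substitute g = swapSubst c := by
  refine MvPolynomial.algHom_ext fun i => ?_
  fin_cases i <;> simp [substitute, swapSubst, h, Fin.sum_univ_two]

theorem substitute_one : substitute (1 : GL (Fin 2) K) = AlgHom.id K _ := by
  refine MvPolynomial.algHom_ext fun i => ?_
  fin_cases i <;> simp [substitute, Fin.sum_univ_two]

theorem substitute_mul (g h : GL (Fin 2) K) :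
    substitute (g * h) = (substitute h).comp (substitute g) := by
  refine MvPolynomial.algHom_ext fun i => ?_
  simp only [substitute, AlgHom.comp_apply, aeval_X, Fin.sum_univ_two, Units.val_mul,
    Matrix.mul_apply, map_add, map_mul, MvPolynomial.algHom_C, algebraMap_eq]
  ring

theorem mem_invariantRing_closure {s : Set (GL (Fin 2) K)} {f : MvPolynomial (Fin 2) K} :
    f ∈ invariantRing (Subgroup.closure s) ↔ ∀ g ∈ s, substitute g f = f := by
  constructor
  · exact fun h g hg => h g (Subgroup.subset_closure hg)
  · intro h g hg
    induction hg using Subgroup.closure_induction with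
    | mem g hg => exact h g hg
    | one => rw [substitute_one]; rfl
    | mul g g' _ _ hg hg' => rw [substitute_mul, AlgHom.comp_apply, hg, hg']
    | inv g _ hg =>
      nth_rw 1 [← hg]
      rw [← AlgHom.comp_apply, ← substitute_mul, mul_inv_cancel, substitute_one]
      rfl

theorem swapSubst_swapSubst (c : K) (f : MvPolynomial (Fin 2) K) :
    swapSubst c (swapSubst c f) = diagSubst (c ^ 2) (c ^ 2) f := by
  rw [← AlgHom.comp_apply]
  congr 1
  refine MvPolynomial.algHom_ext fun i => ?_
  fin_cases i <;> simp [swapSubst, diagSubst, algHom_C] <;> ring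

theorem forall_generator_iff (M : Matrix (Fin 2) (Fin 2) K) (hM : M.det ≠ 0)
    (φ : MvPolynomial (Fin 2) K →ₐ[K] MvPolynomial (Fin 2) K)
    (hφ : ∀ g : GL (Fin 2) K, (g : Matrix (Fin 2) (Fin 2) K) = M → substitute g = φ)
    (f : MvPolynomial (Fin 2) K) :
    (∀ g : GL (Fin 2) K, (g : Matrix (Fin 2) (Fin 2) K) = M → substitute g f = f) ↔ φ f = f := by
  constructor
  · intro h
    have := h (Matrix.GeneralLinearGroup.mkOfDetNeZero M hM) rfl
    rwa [hφ _ rfl] at this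
  · intro h g hg
    rw [hφ g hg, h]

/-- A common form for both parities of `n - q`: one diagonal, one scalar and one swap condition.
Divisibility is claimed only for even exponents because, for `n - q` even, the scalar is the square
of the swap constant, namely `-ε_{4(n-q)}²`, and an even exponent removes the sign. -/
theorem mem_invariantRing_iff (ε : ℕ → K) (hε : ∀ t, 0 < t → IsPrimitiveRoot (ε t) t)
    {n q : ℕ} (hq : 0 < q) (hqn : q < n) :
    ∃ ζ c : K, (∀ e, Even e → ζ ^ e = 1 → 2 * (n - q) ∣ e) ∧ ζ ^ (2 * (n - q)) = 1 ∧
      c ^ (2 * (n - q)) = -1 ∧ ∀ f, f ∈ invariantRing (dihedralGroup ε n q) ↔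
        diagSubst (ε (2 * q)) (ε (2 * q))⁻¹ f = f ∧ swapSubst c f = f ∧ diagSubst ζ ζ f = f := by
  have h4 : ε 4 ≠ 0 := (hε 4 (by norm_num)).ne_zero (by norm_num)
  have h42 : ε 4 ^ 2 = -1 := by
    have h1 : (ε 4 ^ 2) ^ 2 = 1 := by rw [← pow_mul]; exact (hε 4 (by norm_num)).pow_eq_one
    rcases mul_self_eq_one_iff.1 ((sq _).symm.trans h1) with h | h
    · exact absurd h ((hε 4 (by norm_num)).pow_ne_one_of_pos_of_lt (by norm_num) (by norm_num))
    · exact h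
  have h2q : ε (2 * q) ≠ 0 := (hε (2 * q) (by omega)).ne_zero (by omega)
  have hpsi : (psi ε (2 * q)).det ≠ 0 := by simp [psi, h2q]
  have hpsi' := forall_generator_iff _ hpsi _ (fun g hg => substitute_eq_diagSubst hg)
  rcases Nat.mod_two_eq_zero_or_one (n - q) with hpar | hpar
  · have h1 : ε (4 * (n - q)) ≠ 0 := (hε (4 * (n - q)) (by omega)).ne_zero (by omega)
    have hp := hε (4 * (n - q)) (by omega)
    have h2 : ε (4 * (n - q)) ^ (2 * (n - q)) = -1 := by
      have h1 : (ε (4 * (n - q)) ^ (2 * (n - q))) ^ 2 = 1 := by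
        rw [← pow_mul, show 2 * (n - q) * 2 = 4 * (n - q) by ring]
        exact hp.pow_eq_one
      rcases mul_self_eq_one_iff.1 ((sq _).symm.trans h1) with h | h
      · exact absurd h (hp.pow_ne_one_of_pos_of_lt (by omega) (by omega))
      · exact h
    have hc : (ε 4 * ε (4 * (n - q))) ^ (2 * (n - q)) = -1 := by
      rw [mul_pow, h2, pow_mul, h42, (Nat.even_iff.2 hpar).neg_one_pow, one_mul]
    have htau : tau ε * phi ε (4 * (n - q)) =
        !![0, ε 4 * ε (4 * (n - q)); ε 4 * ε (4 * (n - q)), 0] := by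
      simp [tau, phi]
    have hdet : (tau ε * phi ε (4 * (n - q))).det ≠ 0 := by
      rw [htau]
      simp [h1, h4]
    have htau' := forall_generator_iff _ hdet _
      (fun g hg => substitute_eq_swapSubst (hg.trans htau))
    refine ⟨(ε 4 * ε (4 * (n - q))) ^ 2, ε 4 * ε (4 * (n - q)), ?_, ?_, hc, fun f => ?_⟩
    · rintro e he h
      rw [mul_pow, h42, neg_one_mul, he.neg_pow, ← pow_mul] at h
      have := hp.dvd_of_pow_eq_one _ h
      rw [show 4 * (n - q) = 2 * (2 * (n - q)) by ring] at this
      exact Nat.dvd_of_mul_dvd_mul_left (by norm_num) this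
    · rw [← pow_mul, mul_comm 2, pow_mul, hc]
      simp
    · have hg : generators ε n q = {psi ε (2 * q), tau ε * phi ε (4 * (n - q))} := by
        rw [generators, if_neg (by omega)]
      rw [dihedralGroup, mem_invariantRing_closure]
      simp only [hg, Set.mem_ofPred_eq, Set.mem_insert_iff, Set.mem_singleton_iff, or_imp,
        forall_and, hpsi', htau']
      refine and_congr_right fun _ => ⟨fun h => ⟨h, ?_⟩, fun h => h.1⟩
      rw [← swapSubst_swapSubst, h, h]
  · have h1 : ε (2 * (n - q)) ≠ 0 := (hε (2 * (n - q)) (by omega)).ne_zero (by omega)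
    have hp := hε (2 * (n - q)) (by omega)
    have htau' := forall_generator_iff (tau ε) (by simp [tau, h4]) _
      (fun g hg => substitute_eq_swapSubst hg)
    have hphi' := forall_generator_iff (phi ε (2 * (n - q))) (by simp [phi, h1]) _
      (fun g hg => substitute_eq_diagSubst hg)
    refine ⟨ε (2 * (n - q)), ε 4, fun e _ h => hp.dvd_of_pow_eq_one _ h, hp.pow_eq_one, ?_,
      fun f => ?_⟩
    · rw [pow_mul, h42, (Nat.odd_iff.2 hpar).neg_one_pow]
    · have hg : generators ε n q = {psi ε (2 * q), tau ε, phi ε (2 * (n - q))} := by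
        rw [generators, if_pos hpar]
      rw [dihedralGroup, mem_invariantRing_closure]
      simp only [hg, Set.mem_ofPred_eq, Set.mem_insert_iff, Set.mem_singleton_iff, or_imp,
        forall_and, hpsi', htau', hphi']

theorem diagSubst_monomial (a b : K) (d : Fin 2 →₀ ℕ) (r : K) :
    diagSubst a b (monomial d r) = C (a ^ d 0 * b ^ d 1) * monomial d r := by
  rw [diagSubst, aeval_monomial, Finsupp.prod_fintype _ _ (by simp), monomial_eq,
    Finsupp.prod_fintype _ _ (by simp)]
  simp [Fin.prod_univ_two, algebraMap_eq]
  ring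

theorem coeff_diagSubst (a b : K) (d : Fin 2 →₀ ℕ) (f : MvPolynomial (Fin 2) K) :
    coeff d (diagSubst a b f) = a ^ d 0 * b ^ d 1 * coeff d f := by
  classical
  induction f using MvPolynomial.induction_on' with
  | monomial u r =>
    rw [diagSubst_monomial, coeff_C_mul, coeff_monomial]
    split_ifs with h
    · rw [h]
    · simp
  | add f g hf hg => rw [map_add, coeff_add, hf, hg, coeff_add, mul_add]

theorem swapSubst_monomial (c : K) (d : Fin 2 →₀ ℕ) (r : K) :
    swapSubst c (monomial d r) = C (r * c ^ (d 0 + d 1)) * (X 1 ^ d 0 * X 0 ^ d 1) := by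
  rw [swapSubst, aeval_monomial, Finsupp.prod_fintype _ _ (by simp)]
  simp [Fin.prod_univ_two, algebraMap_eq]
  ring

/-- The symmetrized monomial `(xy) ^ b (x ^ (2qk) + (-1) ^ m y ^ (2qk))` with
`b = (n - q) m - q k`. -/
noncomputable def symMonomial (K : Type*) [Field K] (n q m k : ℕ) : MvPolynomial (Fin 2) K :=
  (X 0 * X 1) ^ ((n - q) * m - q * k) * (X 0 ^ (2 * q * k) + (-1) ^ m * X 1 ^ (2 * q * k))

theorem symMonomial_mem (ε : ℕ → K) (hε : ∀ t, 0 < t → IsPrimitiveRoot (ε t) t)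
    {n q m k : ℕ} (hq : 0 < q) (hqn : q < n) (h : q * k ≤ (n - q) * m) :
    symMonomial K n q m k ∈ invariantRing (dihedralGroup ε n q) := by
  obtain ⟨ζ, c, -, hζ, hc, hf⟩ := mem_invariantRing_iff ε hε hq hqn
  obtain ⟨b, hb⟩ := Nat.exists_eq_add_of_le h
  have h1 := (hε (2 * q) (by omega)).pow_eq_one
  have h2 : ε (2 * q) ≠ 0 := (hε (2 * q) (by omega)).ne_zero (by omega)
  have hζ2 : ζ ^ (2 * b + 2 * q * k) = 1 := by
    rw [show 2 * b + 2 * q * k = 2 * (n - q) * m by rw [mul_assoc 2 (n - q), hb]; ring, pow_mul,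
      hζ, one_pow]
  have hc2 : c ^ (2 * b + 2 * q * k) = (-1) ^ m := by
    rw [show 2 * b + 2 * q * k = 2 * (n - q) * m by rw [mul_assoc 2 (n - q), hb]; ring, pow_mul, hc]
  have hm : ((-1 : MvPolynomial (Fin 2) K) ^ m) * (-1) ^ m = 1 := by
    rw [← mul_pow]
    simp
  rw [hf, symMonomial, hb, Nat.add_sub_cancel_left]
  refine ⟨?_, ?_, ?_⟩
  · simp only [diagSubst, map_mul, map_pow, map_add, map_neg, map_one, aeval_X,
      Matrix.cons_val_zero, Matrix.cons_val_one]
    have e1 : C (ε (2 * q)) * X 0 * (C (ε (2 * q))⁻¹ * X 1) =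
        (X 0 * X 1 : MvPolynomial (Fin 2) K) := by
      rw [mul_mul_mul_comm, ← C_mul, mul_inv_cancel₀ h2, C_1, one_mul]
    have e2 : (C (ε (2 * q)) : MvPolynomial (Fin 2) K) ^ (2 * q * k) = 1 := by
      rw [← C_pow, pow_mul, h1, one_pow, C_1]
    have e3 : (C (ε (2 * q))⁻¹ : MvPolynomial (Fin 2) K) ^ (2 * q * k) = 1 := by
      rw [← C_pow, inv_pow, pow_mul, h1, one_pow, inv_one, C_1]
    rw [e1, mul_pow (C _), mul_pow (C _), e2, e3, one_mul, one_mul]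
  · simp only [swapSubst, map_mul, map_pow, map_add, map_neg, map_one, aeval_X,
      Matrix.cons_val_zero, Matrix.cons_val_one]
    have e1 : (C c : MvPolynomial (Fin 2) K) ^ (2 * b + 2 * q * k) = (-1) ^ m := by
      rw [← C_pow, hc2]
      simp
    rw [pow_add, pow_mul] at e1
    linear_combination (X 0 * X 1) ^ b * (X 1 ^ (2 * q * k) + (-1) ^ m * X 0 ^ (2 * q * k)) * e1
      + (X 0 * X 1) ^ b * X 0 ^ (2 * q * k) * hm
  · simp only [diagSubst, map_mul, map_pow, map_add, map_neg, map_one, aeval_X,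
      Matrix.cons_val_zero, Matrix.cons_val_one]
    have e1 : (C ζ : MvPolynomial (Fin 2) K) ^ (2 * b + 2 * q * k) = 1 := by
      rw [← C_pow, hζ2, C_1]
    rw [pow_add, pow_mul] at e1
    linear_combination (X 0 * X 1) ^ b * (X 0 ^ (2 * q * k) + (-1) ^ m * X 1 ^ (2 * q * k)) * e1

/-- Diagonal substitutions act on each monomial by a scalar, so they restrict the support; averaging
with the swap then symmetrizes each surviving monomial. -/
theorem mem_span_symMonomial [CharZero K] (ε : ℕ → K)
    (hε : ∀ t, 0 < t → IsPrimitiveRoot (ε t) t) {n q : ℕ} (hq : 0 < q) (hqn : q < n)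
    {f : MvPolynomial (Fin 2) K} (hf : f ∈ invariantRing (dihedralGroup ε n q)) :
    f ∈ Submodule.span K {p | ∃ m k, q * k ≤ (n - q) * m ∧ p = symMonomial K n q m k} := by
  obtain ⟨ζ, c, hζ, -, hc, h⟩ := mem_invariantRing_iff ε hε hq hqn
  obtain ⟨h1, h2, h3⟩ := (h f).1 hf
  have h2q : ε (2 * q) ≠ 0 := (hε (2 * q) (by omega)).ne_zero (by omega)
  have hsupp : ∀ d ∈ f.support, ∃ m k, q * k ≤ (n - q) * m ∧
      (d 0 = (n - q) * m - q * k + 2 * q * k ∧ d 1 = (n - q) * m - q * k ∨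
        d 0 = (n - q) * m - q * k ∧ d 1 = (n - q) * m - q * k + 2 * q * k) := by
    intro d hd
    rw [mem_support_iff] at hd
    have e1 : ε (2 * q) ^ d 0 * (ε (2 * q))⁻¹ ^ d 1 = 1 := by
      have := coeff_diagSubst (ε (2 * q)) (ε (2 * q))⁻¹ d f
      rw [h1] at this
      exact (mul_eq_right₀ hd).1 this.symm
    have e3 : ζ ^ (d 0 + d 1) = 1 := by
      have := coeff_diagSubst ζ ζ d f
      rw [h3, ← pow_add] at this
      exact (mul_eq_right₀ hd).1 this.symm
    have key : ∀ i j : ℕ, i ≤ j → d 0 + d 1 = i + j → ε (2 * q) ^ (j - i) = 1 →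
        ∃ m k, q * k ≤ (n - q) * m ∧ j = (n - q) * m - q * k + 2 * q * k ∧
          i = (n - q) * m - q * k := by
      intro i j hij hd2 he
      obtain ⟨k, hk⟩ := (hε (2 * q) (by omega)).dvd_of_pow_eq_one _ he
      have hk2 : d 0 + d 1 = 2 * (i + q * k) := by
        rw [mul_assoc] at hk
        omega
      -- The total degree is even because the two exponents differ by a multiple of `2q`.
      obtain ⟨m, hm⟩ := hζ _ ⟨_, hk2.trans (two_mul _)⟩ e3
      rw [mul_assoc] at hm hk
      refine ⟨m, k, by omega, ?_, by omega⟩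
      rw [mul_assoc]
      omega
    rcases le_total (d 1) (d 0) with hle | hle
    · obtain ⟨m, k, hk, hj, hi⟩ := key _ _ hle (add_comm _ _) (by
        rw [← Nat.sub_add_cancel hle, pow_add, mul_assoc, inv_pow,
          mul_inv_cancel₀ (pow_ne_zero _ h2q), mul_one] at e1
        exact e1)
      exact ⟨m, k, hk, Or.inl ⟨hj, hi⟩⟩
    · obtain ⟨m, k, hk, hj, hi⟩ := key _ _ hle rfl (by
        rw [← Nat.sub_add_cancel hle, pow_add, mul_comm (_ ^ (d 1 - d 0)), ← mul_assoc, inv_pow,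
          mul_inv_cancel₀ (pow_ne_zero _ h2q), one_mul, inv_pow, inv_eq_one] at e1
        exact e1)
      exact ⟨m, k, hk, Or.inr ⟨hi, hj⟩⟩
  have hsum : f = (2⁻¹ : K) • (f + swapSubst c f) := by
    rw [h2, ← two_smul K f, smul_smul, inv_mul_cancel₀ two_ne_zero, one_smul]
  have hsum2 : f + swapSubst c f = ∑ d ∈ f.support,
      (monomial d (coeff d f) + swapSubst c (monomial d (coeff d f))) := by
    rw [Finset.sum_add_distrib, ← map_sum, support_sum_monomial_coeff]
  rw [hsum, hsum2]
  refine Submodule.smul_mem _ _ (Submodule.sum_mem _ fun d hd => ?_)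
  obtain ⟨m, k, hmk, hd⟩ := hsupp d hd
  have hmem : symMonomial K n q m k ∈ Submodule.span K
      {p | ∃ m k, q * k ≤ (n - q) * m ∧ p = symMonomial K n q m k} :=
    Submodule.subset_span ⟨m, k, hmk, rfl⟩
  have hcpow : c ^ (d 0 + d 1) = (-1) ^ m := by
    rw [← hc, ← pow_mul]
    congr 1
    rw [mul_assoc 2 (n - q)]
    simp only [mul_assoc] at hd
    omega
  have hmon : ∀ r : K, monomial d r = C r * (X 0 ^ d 0 * X 1 ^ d 1) := fun r => by
    rw [monomial_eq, Finsupp.prod_fintype _ _ (by simp), Fin.prod_univ_two]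
  rw [swapSubst_monomial, hcpow, hmon]
  have hm : ((-1 : MvPolynomial (Fin 2) K) ^ m) * (-1) ^ m = 1 := by
    rw [← mul_pow]
    simp
  rcases hd with ⟨h0, h1⟩ | ⟨h0, h1⟩
  · convert Submodule.smul_mem _ (coeff d f) hmem using 1
    rw [smul_eq_C_mul, symMonomial, h0, h1]
    simp only [C_mul, C_pow, C_neg, C_1]
    ring
  · convert Submodule.smul_mem _ (coeff d f * (-1) ^ m) hmem using 1
    rw [smul_eq_C_mul, symMonomial, h0, h1]
    simp only [C_mul, C_pow, C_neg, C_1]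
    linear_combination (-C (coeff d f) * (X 0 * X 1) ^ ((n - q) * m - q * k) *
      X 1 ^ (2 * q * k)) * hm

end

/-! ### Labels in terms of symmetrized monomials -/

section

variable {K : Type*} [Field K]

/-- `x ^ (2qk) + (-1) ^ e y ^ (2qk)`. -/
noncomputable def symPow (K : Type*) [Field K] (q k e : ℕ) : MvPolynomial (Fin 2) K :=
  X 0 ^ (2 * q * k) + (-1) ^ e * X 1 ^ (2 * q * k)

/-- The span of the polynomials `(xy) ^ (q (k - k')) * symPow K q k' e` with `k' < l`. -/
noncomputable def symSpan (K : Type*) [Field K] (q k e l : ℕ) :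
    Submodule K (MvPolynomial (Fin 2) K) :=
  Submodule.span K {p | ∃ k' < l, k' ≤ k ∧ p = (X 0 * X 1) ^ (q * (k - k')) * symPow K q k' e}

theorem mem_symSpan {q k e l k' : ℕ} (h : k' < l) (h' : k' ≤ k) :
    (X 0 * X 1) ^ (q * (k - k')) * symPow K q k' e ∈ symSpan K q k e l :=
  Submodule.subset_span ⟨k', h, h', rfl⟩

theorem symPow_congr {q k e e' : ℕ} (h : Even (e + e')) : symPow K q k e = symPow K q k e' := by
  rw [symPow, symPow, neg_one_pow_congr (Nat.even_add.1 h)]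

theorem symPow_mul (q k e f : ℕ) : symPow K q (k + 1) e * symPow K q 1 f =
    symPow K q (k + 2) (e + f) + (-1 : K) ^ f • ((X 0 * X 1) ^ (2 * q) * symPow K q k (e + f)) := by
  have hf : ((-1 : MvPolynomial (Fin 2) K) ^ f) * (-1) ^ f = 1 := by
    rw [← mul_pow]
    simp
  rw [smul_eq_C_mul]
  simp only [symPow, C_pow, C_neg, C_1]
  linear_combination (-((-1) ^ e) * (X 0 * X 1) ^ (2 * q) * X 1 ^ (2 * q * k)) * hf

theorem symPow_zero_mul (q e f : ℕ) : symPow K q 0 e * symPow K q 1 f =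
    ((1 : K) + (-1) ^ e) • symPow K q 1 f := by
  rw [smul_eq_C_mul]
  simp [symPow]

/-- The cross terms of the product carry `(xy)^(2q)` and the same sign `e + f`. The extra summand `c
(xy)^q` would keep the sign `e`, so it is permitted only when `f` is even. -/
theorem symPow_one_mul_mem {q k e f : ℕ} {c : K} (hc : c = 0 ∨ Even f) :
    symPow K q (k + 1) e * (symPow K q 1 f + C c * (X 0 * X 1) ^ q) - symPow K q (k + 2) (e + f) ∈
      symSpan K q (k + 2) (e + f) (k + 2) := by
  have h1 : symPow K q (k + 1) e * (symPow K q 1 f + C c * (X 0 * X 1) ^ q) -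
      symPow K q (k + 2) (e + f) = (-1 : K) ^ f • ((X 0 * X 1) ^ (q * (k + 2 - k)) *
        symPow K q k (e + f)) + c • ((X 0 * X 1) ^ (q * (k + 2 - (k + 1))) *
        symPow K q (k + 1) (e + f)) := by
    have h2 : c • ((X 0 * X 1) ^ q * symPow K q (k + 1) (e + f)) =
        c • ((X 0 * X 1) ^ q * symPow K q (k + 1) e) := by
      rcases hc with rfl | hf
      · simp
      · rw [symPow_congr (e := e + f) (e' := e)]
        rw [Nat.even_iff] at hf ⊢
        omega
    rw [show k + 2 - k = 2 by omega, show k + 2 - (k + 1) = 1 by omega, mul_one, h2, mul_add,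
      symPow_mul, mul_comm q 2, smul_eq_C_mul _ c]
    ring
  rw [h1]
  exact Submodule.add_mem _ (Submodule.smul_mem _ _ (mem_symSpan (by omega) (by omega)))
    (Submodule.smul_mem _ _ (mem_symSpan (by omega) (by omega)))

/-- `symPow K q 0 e` is the constant `1 + (-1)^e`, that is `2` or `0`; this is the source of the
factor `2⁻¹` in `topCoeff`. -/
theorem symPow_zero_mul_mem {q e f : ℕ} {c : K} (hc : c = 0 ∨ Even f) :
    symPow K q 0 e * (symPow K q 1 f + C c * (X 0 * X 1) ^ q) -
      ((1 : K) + (-1) ^ e) • symPow K q 1 (e + f) ∈ symSpan K q 1 (e + f) 1 := by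
  have h1 : symPow K q 0 e * (symPow K q 1 f + C c * (X 0 * X 1) ^ q) -
      ((1 : K) + (-1) ^ e) • symPow K q 1 (e + f) =
      c • ((X 0 * X 1) ^ (q * (1 - 0)) * symPow K q 0 (e + f)) := by
    have h2 : c • ((X 0 * X 1) ^ q * symPow K q 0 (e + f)) =
        c • ((X 0 * X 1) ^ q * symPow K q 0 e) := by
      rcases hc with rfl | hf
      · simp
      · rw [symPow_congr (e := e + f) (e' := e)]
        rw [Nat.even_iff] at hf ⊢
        omega
    have h3 : ((1 : K) + (-1) ^ e) • symPow K q 1 (e + f) =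
        ((1 : K) + (-1) ^ e) • symPow K q 1 f := by
      rcases Nat.even_or_odd e with he | he
      · rw [symPow_congr (e := e + f) (e' := f)]
        rw [Nat.even_iff] at he ⊢
        omega
      · simp [he.neg_one_pow]
    rw [Nat.sub_zero, mul_one, h2, h3, mul_add, symPow_zero_mul, smul_eq_C_mul _ c]
    ring
  rw [h1]
  exact Submodule.smul_mem _ _ (mem_symSpan (by omega) (by omega))

theorem mul_mem_symSpan {q k e f l : ℕ} {c : K} (hc : c = 0 ∨ Even f)
    {p : MvPolynomial (Fin 2) K} (hp : p ∈ symSpan K q k e l) :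
    p * (symPow K q 1 f + C c * (X 0 * X 1) ^ q) ∈ symSpan K q (k + 1) (e + f) (l + 1) := by
  induction hp using Submodule.span_induction with
  | zero => simp
  | add x y _ _ hx hy => rw [add_mul]; exact add_mem hx hy
  | smul r x _ hx => rw [smul_mul_assoc]; exact Submodule.smul_mem _ _ hx
  | mem p hp =>
    obtain ⟨k', hk', hk, rfl⟩ := hp
    have hT : ∀ k'' : ℕ, k'' ≤ l → k'' ≤ k' + 1 → ∀ p ∈ symSpan K q k'' (e + f) k'',
        (X 0 * X 1) ^ (q * (k + 1 - k'')) * p ∈ symSpan K q (k + 1) (e + f) (l + 1) := by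
      intro k'' hl1 hl2 p hp
      induction hp using Submodule.span_induction with
      | zero => simp
      | add x y _ _ hx hy => rw [mul_add]; exact add_mem hx hy
      | smul r x _ hx => rw [mul_smul_comm]; exact Submodule.smul_mem _ _ hx
      | mem p hp =>
        obtain ⟨i, hi, hi', rfl⟩ := hp
        rw [← mul_assoc, ← pow_add, ← mul_add,
          show k + 1 - k'' + (k'' - i) = k + 1 - i by omega]
        exact mem_symSpan (by omega) (by omega)
    rw [mul_assoc]
    cases k' with
    | zero =>
      have h1 := hT 1 (by omega) (by omega) _ (symPow_zero_mul_mem (q := q) (e := e) hc)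
      rw [mul_sub, sub_eq_add_neg, Nat.add_sub_cancel] at h1
      refine (Submodule.add_mem_iff_left _ (Submodule.neg_mem _ ?_)).1 h1
      rw [mul_smul_comm]
      refine Submodule.smul_mem _ _ ?_
      exact mem_symSpan (k := k + 1) (k' := 1) (l := l + 1) (by omega) (by omega)
    | succ k' =>
      have h1 := hT (k' + 2) (by omega) (by omega) _ (symPow_one_mul_mem (q := q) (e := e) hc)
      rw [mul_sub, sub_eq_add_neg, show k + 1 - (k' + 2) = k - (k' + 1) by omega] at h1
      refine (Submodule.add_mem_iff_left _ (Submodule.neg_mem _ ?_)).1 h1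
      rw [show k - (k' + 1) = k + 1 - (k' + 2) by omega]
      exact mem_symSpan (k := k + 1) (k' := k' + 2) (l := l + 1) (by omega) (by omega)

/-- The coefficient of `symPow K q k e` in a label. -/
noncomputable def topCoeff (K : Type*) [Field K] (k : ℕ) : K := if k = 0 then 2⁻¹ else 1

theorem topCoeff_ne_zero [CharZero K] (k : ℕ) : topCoeff K k ≠ 0 := by
  rw [topCoeff]
  split_ifs <;> simp

theorem sub_symPow_mem_step [CharZero K] {q k e f : ℕ} {c : K} (hc : c = 0 ∨ Even f)
    {p : MvPolynomial (Fin 2) K} (he : k = 0 → Even e)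
    (hp : p - topCoeff K k • symPow K q k e ∈ symSpan K q k e k) :
    p * (symPow K q 1 f + C c * (X 0 * X 1) ^ q) - topCoeff K (k + 1) • symPow K q (k + 1) (e + f) ∈
      symSpan K q (k + 1) (e + f) (k + 1) := by
  have h1 := mul_mem_symSpan hc hp
  have h2 : symPow K q k e * (symPow K q 1 f + C c * (X 0 * X 1) ^ q) -
      (topCoeff K k)⁻¹ • symPow K q (k + 1) (e + f) ∈ symSpan K q (k + 1) (e + f) (k + 1) := by
    cases k with
    | zero =>
      have := symPow_zero_mul_mem (q := q) (e := e) hc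
      rw [(he rfl).neg_one_pow, one_add_one_eq_two] at this
      simpa [topCoeff] using this
    | succ k => simpa [topCoeff] using symPow_one_mul_mem (q := q) (e := e) hc
  have h3 := add_mem h1 (Submodule.smul_mem _ (topCoeff K k) h2)
  rw [smul_sub, smul_smul, mul_inv_cancel₀ (topCoeff_ne_zero k)] at h3
  convert h3 using 1
  simp [topCoeff, sub_mul]

/-- The label of a path: `u₂` and `u₃` differ from `v₂` and `v₃` by multiples of `(xy) ^ q`. -/
theorem pow_mul_pow_sub_mem [CharZero K] {q a : ℕ} {c₂ c₃ : K} (h₂ : c₂ = 0 ∨ Even a)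
    (h₃ : c₃ = 0 ∨ Even (a + 1)) (i j : ℕ) :
    (symPow K q 1 a + C c₂ * (X 0 * X 1) ^ q) ^ i *
      (symPow K q 1 (a + 1) + C c₃ * (X 0 * X 1) ^ q) ^ j -
      topCoeff K (i + j) • symPow K q (i + j) (a * i + (a + 1) * j) ∈
      symSpan K q (i + j) (a * i + (a + 1) * j) (i + j) := by
  induction j with
  | zero =>
    induction i with
    | zero =>
      have : (1 : MvPolynomial (Fin 2) K) - ((2⁻¹ : K) • 1 + (2⁻¹ : K) • 1) = 0 := by
        rw [← add_smul]
        norm_num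
      simp [topCoeff, symPow, this]
    | succ i ih =>
      have := sub_symPow_mem_step h₂ (by rintro h; simp at h; simp [h]) ih
      simpa [pow_succ, mul_add] using this
  | succ j ih =>
    have := sub_symPow_mem_step h₃ (by rintro h; simp at h; simp [h]) ih
    rw [mul_assoc, ← pow_succ, add_assoc (a * i), ← Nat.mul_succ, add_assoc i] at this
    exact this

end

section

variable {K : Type*} [Field K] {n q : ℕ} {hν : nu n q + 1 < len n q}

/-! ### Paths and walks -/

/-- The polynomial `(xy) ^ b * u₂ ^ i * u₃ ^ j`. -/
noncomputable def labelOf (u₂ u₃ : MvPolynomial (Fin 2) K) (b i j : ℕ) : MvPolynomial (Fin 2) K :=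
  (X 0 * X 1) ^ b * u₂ ^ i * u₃ ^ j

theorem labelOf_mul (u₂ u₃ : MvPolynomial (Fin 2) K) (b i j b' i' j' : ℕ) :
    labelOf u₂ u₃ b i j * labelOf u₂ u₃ b' i' j' = labelOf u₂ u₃ (b + b') (i + i') (j + j') := by
  simp only [labelOf]
  ring

theorem arrowLabel_eq (u₂ u₃ : MvPolynomial (Fin 2) K) (a : Arrow n q) :
    arrowLabel u₂ u₃ a = labelOf u₂ u₃ (arrowB a) (arrowI a) (arrowJ a) := by
  cases a with
  | g =>
    have : (2 * rSeries n q 3).toNat = 2 * rNat n q 3 := by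
      rw [rNat]
      omega
    simp [arrowLabel, labelOf, arrowB, arrowI, arrowJ, this]
  | _ => simp [arrowLabel, labelOf, arrowB, arrowI, arrowJ, rNat, cNat, dNat]

theorem pathLabel_nil {A : Type*} [Monoid A] (Q : LabelledQuiver A) (v : Q.Vertex) :
    Q.pathLabel (Quiver.Path.nil : Quiver.Path v v) = 1 :=
  Quiver.Path.weight_nil _ _

theorem pathLabel_cons {A : Type*} [Monoid A] (Q : LabelledQuiver A) {u v w : Q.Vertex}
    (p : Quiver.Path u v) (e : v ⟶ w) : Q.pathLabel (p.cons e) = Q.pathLabel p * Q.homLabel e :=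
  Quiver.Path.weight_cons _ _ _

theorem exists_path_of_walk (u₂ u₃ : MvPolynomial (Fin 2) K) {v w : Vertex n q} {b i j : ℕ}
    (h : Walk hν Set.univ v w b i j) :
    ∃ p : Quiver.Path (V := (quiverD hν u₂ u₃).Vertex) v w,
      (quiverD hν u₂ u₃).pathLabel p = labelOf u₂ u₃ b i j := by
  induction h with
  | nil => exact ⟨Quiver.Path.nil, (pathLabel_nil _ _).trans (by simp [labelOf])⟩
  | cons a _ _ ih =>
    obtain ⟨p, hp⟩ := ih
    refine ⟨p.cons ⟨a, rfl, rfl⟩, ?_⟩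
    refine (pathLabel_cons _ _ _).trans ?_
    rw [hp, ← labelOf_mul]
    exact congrArg _ (arrowLabel_eq u₂ u₃ _)

theorem exists_walk_of_path (u₂ u₃ : MvPolynomial (Fin 2) K) (a : Arrow n q) {v w : Vertex n q}
    (p : Quiver.Path (V := ((quiverD hν u₂ u₃).delete a).Vertex) v w) :
    ∃ b i j, Walk hν {a' | a' ≠ a} v w b i j ∧
      ((quiverD hν u₂ u₃).delete a).pathLabel p = labelOf u₂ u₃ b i j := by
  induction p with
  | nil => exact ⟨0, 0, 0, Walk.nil, (pathLabel_nil _ _).trans (by simp [labelOf])⟩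
  | cons p e ih =>
    obtain ⟨b, i, j, h, hp⟩ := ih
    obtain ⟨⟨e, he⟩, rfl, rfl⟩ := e
    refine ⟨_, _, _, Walk.cons e he h, ?_⟩
    refine (pathLabel_cons _ _ _).trans ?_
    rw [hp, ← labelOf_mul]
    exact congrArg _ (arrowLabel_eq u₂ u₃ _)

/-! ### Every invariant is visible at every vertex -/

theorem mul_mem_span_symMonomial {m k e : ℕ} (hk : q * k ≤ (n - q) * m) (he : Even (e + m))
    {p : MvPolynomial (Fin 2) K} (hp : p ∈ symSpan K q k e k) :
    (X 0 * X 1) ^ ((n - q) * m - q * k) * p ∈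
      Submodule.span K {p | ∃ k' < k, p = symMonomial K n q m k'} := by
  induction hp using Submodule.span_induction with
  | zero => simp
  | add x y _ _ hx hy => rw [mul_add]; exact add_mem hx hy
  | smul r x _ hx => rw [mul_smul_comm]; exact Submodule.smul_mem _ _ hx
  | mem p hp =>
    obtain ⟨k', hk', -, rfl⟩ := hp
    refine Submodule.subset_span ⟨k', hk', ?_⟩
    have h1 := Nat.mul_le_mul_left q hk'.le
    rw [← mul_assoc, ← pow_add, Nat.mul_sub, symPow_congr he, symMonomial, symPow]
    congr 2
    omega

variable [CharZero K]

/-- Triangularity: a cycle of type `(m, k)` has the wanted polynomial as its top term, and the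
remainder is handled by induction on `k` with `m` fixed. -/
theorem symMonomial_mem_span_pathLabel (H : Numerics n q) {c₂ c₃ : K}
    (h₂ : c₂ = 0 ∨ Even (aEntry n q 2)) (h₃ : c₃ = 0 ∨ Even (aEntry n q 2 + 1))
    {u₂ u₃ : MvPolynomial (Fin 2) K}
    (hu₂ : u₂ = symPow K q 1 (aEntry n q 2) + C c₂ * (X 0 * X 1) ^ q)
    (hu₃ : u₃ = symPow K q 1 (aEntry n q 2 + 1) + C c₃ * (X 0 * X 1) ^ q)
    (v : Vertex n q) (m k : ℕ) (hk : q * k ≤ (n - q) * m) :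
    symMonomial K n q m k ∈ Submodule.span K (Set.range fun
      p : Quiver.Path (V := (quiverD hν u₂ u₃).Vertex) v v => (quiverD hν u₂ u₃).pathLabel p) := by
  induction k using Nat.strong_induction_on with
  | _ k ih =>
    by_cases hmk : 0 < k ∨ Even m
    · obtain ⟨b, i, j, hw, rfl, hb, hpar⟩ := isCycleType_of_le (hν := hν) H v hk hmk
      obtain ⟨p, hp⟩ := exists_path_of_walk u₂ u₃ hw
      have h1 := pow_mul_pow_sub_mem (q := q) h₂ h₃ i j
      rw [← hu₂, ← hu₃] at h1
      have he : Even (aEntry n q 2 * i + (aEntry n q 2 + 1) * j + m) := by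
        convert hpar using 1
        ring
      have h2 := mul_mem_span_symMonomial hk he h1
      have hb' : (n - q) * m - q * (i + j) = b := by omega
      have h3 : (X 0 * X 1) ^ ((n - q) * m - q * (i + j)) * symPow K q (i + j)
          (aEntry n q 2 * i + (aEntry n q 2 + 1) * j) = symMonomial K n q m (i + j) := by
        rw [symPow_congr he, symMonomial, symPow]
      have h4 : Submodule.span K {p | ∃ k' < i + j, p = symMonomial K n q m k'} ≤
          Submodule.span K (Set.range fun p : Quiver.Path (V := (quiverD hν u₂ u₃).Vertex) v v =>
            (quiverD hν u₂ u₃).pathLabel p) := by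
        refine Submodule.span_le.2 ?_
        rintro _ ⟨k', hk', rfl⟩
        exact ih k' hk' ((Nat.mul_le_mul_left q hk'.le).trans hk)
      have h5 := h4 h2
      rw [mul_sub, mul_smul_comm, h3, hb', ← mul_assoc, ← labelOf, ← hp, sub_eq_add_neg] at h5
      have h6 := (Submodule.add_mem_iff_right _ (Submodule.subset_span (Set.mem_range_self p))).1 h5
      rw [neg_mem_iff] at h6
      exact (Submodule.smul_mem_iff _ (topCoeff_ne_zero _)).1 h6
    · push Not at hmk
      obtain rfl : k = 0 := by omega
      have : symMonomial K n q m 0 = 0 := by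
        rw [symMonomial, (Nat.not_even_iff_odd.1 hmk.2).neg_one_pow]
        simp
      rw [this]
      exact Submodule.zero_mem _

theorem seesAll_quiverD (H : Numerics n q) (ε : ℕ → K)
    (hε : ∀ t, 0 < t → IsPrimitiveRoot (ε t) t) {c₂ c₃ : K}
    (h₂ : c₂ = 0 ∨ Even (aEntry n q 2)) (h₃ : c₃ = 0 ∨ Even (aEntry n q 2 + 1))
    {u₂ u₃ : MvPolynomial (Fin 2) K}
    (hu₂ : u₂ = symPow K q 1 (aEntry n q 2) + C c₂ * (X 0 * X 1) ^ q)
    (hu₃ : u₃ = symPow K q 1 (aEntry n q 2 + 1) + C c₃ * (X 0 * X 1) ^ q) :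
    (quiverD hν u₂ u₃).SeesAll (invariantRing (dihedralGroup ε n q)) := by
  intro v f hf
  refine Submodule.span_le.2 ?_ (mem_span_symMonomial ε hε H.q_pos H.q_lt hf)
  rintro _ ⟨m, k, hk, rfl⟩
  exact symMonomial_mem_span_pathLabel H h₂ h₃ hu₂ hu₃ v m k hk

end

section

variable {n q : ℕ} {hν : nu n q + 1 < len n q}

/-! ### Cycles in a quiver with one arrow removed -/

theorem Numerics.sub_pos (H : Numerics n q) : 0 < n - q := Nat.sub_pos_of_lt H.q_lt

theorem Numerics.r_pos_of_walk (H : Numerics n q) {t : ℕ} (h : nu n q + 1 ≤ t)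
    (h' : t ≤ len n q) : 0 < rNat n q (lSeries n q t) :=
  H.r_pos _ (H.three_le_l t h) (H.l_mono h')

theorem Numerics.r_two_pos (H : Numerics n q) : 0 < rNat n q 2 := by
  have := H.sub_pos
  have := H.r_two
  omega

theorem Numerics.r_three_pos (H : Numerics n q) : 0 < rNat n q 3 :=
  H.r_pos _ le_rfl (H.three_le_l _ H.nu_lt.le)

theorem Numerics.extra_index (H : Numerics n q) {s t : ℕ} (hs : nu n q + 1 < s)
    (hs' : s ≤ len n q) (h : t + 2 ≤ alpha n q s) :
    lSeries n q (nu n q + 1) ≤ lSeries n q (s - 1) ∧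
      t + lSeries n q (s - 1) ≤ lSeries n q s ∧ lSeries n q s ≤ lSeries n q (len n q) := by
  have h5 := H.l_succ (s - 1)
  rw [Nat.sub_add_cancel (by omega)] at h5
  exact ⟨H.l_mono (by omega), by omega, H.l_mono hs'⟩

/-- Only `up`, `fwd` and `out` have no factor `xy`, and they form a single loop through `R`. Once it
is broken, a walk without `xy` that leaves `R` is stuck before the gap. -/
theorem walk_of_delete_upward (H : Numerics n q) {a : Arrow n q}
    (ha : a = .up ∨ (∃ t h h', a = .fwd t h h') ∨ a = .out) {w : Vertex n q} {b i j : ℕ}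
    (h : Walk hν {a' | a' ≠ a} .R w b i j) (hb : b = 0) :
    match w with
    | .R => i = 0 ∧ j = 0
    | .W s _ _ => a ≠ .up ∧ ∀ t h h', a = .fwd t h h' → s ≤ t := by
  induction h with
  | nil => exact ⟨rfl, rfl⟩
  | cons a' ha' _ ih =>
    have ih := ih (by omega)
    have ha'' : a' ≠ a := ha'
    cases a' with
    | up => exact ⟨ha''.symm, fun t h _ _ => h⟩
    | down => have := H.r_two_pos; simp only [arrowB] at hb; omega
    | g => have := H.r_three_pos; simp only [arrowB] at hb; omega
    | fwd t h h' =>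
      simp only [arrowSource, arrowTarget] at ih ⊢
      refine ⟨ih.1, fun t' h1 h2 h3 => ?_⟩
      have h4 := ih.2 t' h1 h2 h3
      have : t ≠ t' := by
        rintro rfl
        exact ha'' h3.symm
      omega
    | bwd t h h' => have := H.r_pos_of_walk h h'.le; simp only [arrowB] at hb; omega
    | out =>
      simp only [arrowSource] at ih
      rcases ha with rfl | ⟨t, h, h', rfl⟩ | rfl
      · exact absurd rfl ih.1
      · have := ih.2 t h h' rfl
        omega
      · exact absurd rfl ha''
    | into => have := H.r_pos_of_walk H.nu_lt.le le_rfl; simp only [arrowB] at hb; omega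
    | extraFirst t h h' =>
      rw [← H.l_first] at h'
      have := H.r_pos (t + 2) (by omega) (h'.trans (H.l_mono H.nu_lt.le))
      simp only [arrowB] at hb
      omega
    | extra s t hs hs' h h' =>
      obtain ⟨h1, h2, h3⟩ := H.extra_index hs hs' h'
      have := H.three_le_l _ le_rfl
      have := H.r_pos (t + lSeries n q (s - 1)) (by omega) (by omega)
      simp only [arrowB] at hb
      omega

theorem Numerics.one_le_d_l (H : Numerics n q) {t : ℕ} (h : nu n q + 1 ≤ t) (h' : t ≤ len n q) :
    1 ≤ dNat n q (lSeries n q t) :=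
  H.one_le_d _ (H.three_le_l t h) ((H.l_mono h').trans (Nat.le_succ _))

/-- Without `into`, the vertex `W_N` can be entered only by a forward arrow, since `up` ends at the
different vertex `W_{ν+1}`; every forward arrow contains `u₃`. -/
theorem walk_of_delete_into (H : Numerics n q) {w : Vertex n q} {b i j : ℕ}
    (h : Walk hν {a | a ≠ .into} (.W (len n q) H.nu_lt.le le_rfl) w b i j) :
    match w with
    | .R => True
    | .W s _ _ => s = len n q → 1 ≤ j ∨ b = 0 ∧ i = 0 ∧ j = 0 := by
  induction h with
  | nil => exact fun _ => Or.inr ⟨rfl, rfl, rfl⟩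
  | cons a ha _ ih =>
    cases a with
    | up => exact fun h => by omega
    | fwd t h h' =>
      have := H.one_le_d_l h h'.le
      exact fun _ => Or.inl (by simp only [arrowJ]; omega)
    | bwd t h h' => exact fun h => by omega
    | into => exact absurd rfl ha
    | _ => trivial

/-- Once the deleted arrow is gone, every arrow leaving `W_{t+1}` contains `u₃`: `down` and `g`
leave from `W_{ν+1}` only. -/
theorem walk_of_delete_bwd (H : Numerics n q) {t : ℕ} (h0 : nu n q + 1 ≤ t) (h1 : t < len n q)
    {w : Vertex n q} {b i j : ℕ}
    (h : Walk hν {a | a ≠ .bwd t h0 h1} (.W (t + 1) (h0.trans t.le_succ) h1) w b i j) :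
    1 ≤ j ∨ (b = 0 ∧ i = 0 ∧ j = 0 ∧ w = .W (t + 1) (h0.trans t.le_succ) h1) := by
  induction h with
  | nil => exact Or.inr ⟨rfl, rfl, rfl, rfl⟩
  | cons a ha _ ih =>
    rcases ih with ih | ⟨-, -, -, ih⟩
    · exact Or.inl (by omega)
    · left
      cases a with
      | up => simp [arrowSource] at ih
      | down => simp only [arrowSource, Vertex.W.injEq] at ih; omega
      | g => simp only [arrowSource, Vertex.W.injEq] at ih; omega
      | fwd s h h' => have := H.one_le_d_l h h'.le; simp only [arrowJ]; omega
      | bwd s h h' =>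
        simp only [arrowSource, Vertex.W.injEq] at ih
        obtain rfl : s = t := by omega
        exact absurd rfl ha
      | out => have := H.one_le_d_l H.nu_lt.le le_rfl; simp only [arrowJ]; omega
      | into => simp [arrowSource] at ih
      | extraFirst s h h' => simp only [arrowSource, Vertex.W.injEq] at ih; omega
      | extra s t hs hs' h h' =>
        obtain ⟨h1, h2, h3⟩ := H.extra_index hs hs' h'
        have := H.three_le_l _ le_rfl
        have := H.one_le_d (t - 1 + lSeries n q (s - 1)) (by omega) (by omega)
        simp only [arrowJ]
        omega

/-- The exponent of `u₃` is positive in the label of most arrows. -/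
theorem Numerics.one_le_arrowJ (H : Numerics n q) (a : Arrow n q) :
    a = .up ∨ a = .down ∨ a = .g ∨ a = .into ∨ (∃ t h h', a = .bwd t h h') ∨ 1 ≤ arrowJ a := by
  cases a with
  | up => simp
  | down => simp
  | g => simp
  | bwd t h h' => exact Or.inr (Or.inr (Or.inr (Or.inr (Or.inl ⟨t, h, h', rfl⟩))))
  | into => simp
  | fwd s h h' => simpa [arrowJ] using H.one_le_d_l h h'.le
  | out => simpa [arrowJ] using H.one_le_d_l H.nu_lt.le le_rfl
  | extraFirst t h h' =>
    rw [← H.l_first] at h'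
    have := H.l_mono H.nu_lt.le
    simpa [arrowJ] using H.one_le_d (t + 1) (by omega) (by omega)
  | extra s t hs hs' h h' =>
    obtain ⟨h1, h2, h3⟩ := H.extra_index hs hs' h'
    have := H.three_le_l _ le_rfl
    simpa [arrowJ] using H.one_le_d (t - 1 + lSeries n q (s - 1)) (by omega) (by omega)

/-- While `j = 0`, a factor `u₂` can come only from `up`, after which `down` at cost `r_2` is the
only way on. Reaching `W_N` again then exceeds `r_2 + q`, half the degree of the generator `(a₂,
1)`. -/
theorem walk_of_delete_g (H : Numerics n q) {w : Vertex n q} {b i j : ℕ}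
    (h : Walk hν {a | a ≠ .g} (.W (len n q) H.nu_lt.le le_rfl) w b i j) :
    1 ≤ j ∨ match w with
    | .R => i = 0 ∧ 1 ≤ b ∨ rNat n q 2 + q < b + q * i
    | .W s _ _ => i = 0 ∨ (s = nu n q + 1 ∧ q + 1 ≤ b + q * i) ∨ rNat n q 2 + q < b + q * i := by
  induction h with
  | nil => exact Or.inr (Or.inl rfl)
  | cons a ha _ ih =>
    rcases ih with ih | ih
    · exact Or.inl (by omega)
    rcases H.one_le_arrowJ a with rfl | rfl | rfl | rfl | ⟨t, h, h', rfl⟩ | hj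
    · right
      simp only [arrowSource, arrowTarget, arrowB, arrowI, Nat.mul_add] at ih ⊢
      rcases ih with ⟨rfl, ih⟩ | ih
      · exact Or.inr (Or.inl ⟨by trivial, by omega⟩)
      · exact Or.inr (Or.inr (by omega))
    · right
      have := H.r_two_pos
      simp only [arrowSource, arrowTarget, arrowB, arrowI, Nat.mul_add] at ih ⊢
      rcases ih with rfl | ⟨-, ih⟩ | ih
      · exact Or.inl ⟨by trivial, by omega⟩
      · exact Or.inr (by omega)
      · exact Or.inr (by omega)
    · exact absurd rfl ha
    · right
      simp only [arrowSource, arrowTarget, arrowB, arrowI, Nat.mul_add] at ih ⊢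
      rcases ih with ⟨rfl, ih⟩ | ih
      · exact Or.inl rfl
      · exact Or.inr (Or.inr (by omega))
    · right
      simp only [arrowSource, arrowTarget, arrowB, arrowI, Nat.mul_add] at ih ⊢
      rcases ih with rfl | ⟨ih, -⟩ | ih
      · exact Or.inl rfl
      · omega
      · exact Or.inr (Or.inr (by omega))
    · exact Or.inl (by omega)

/-- While `j = 0`, the only return to `R` is by `g`. The backward chain followed by `g` has
half-degree `r_2 + q - r_{l_N}`, so a closed walk has `i = 1` or exceeds `r_2 + q`, unless it is
trivial. -/
theorem walk_of_delete_down (H : Numerics n q) {w : Vertex n q} {b i j : ℕ}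
    (h : Walk hν {a | a ≠ .down} (.W (len n q) H.nu_lt.le le_rfl) w b i j) :
    1 ≤ j ∨ match w with
    | .R => i = 1 ∧ rNat n q 2 + q ≤ b + q * i + rNat n q (lSeries n q (len n q)) ∨
        rNat n q 2 + q < b + q * i + rNat n q (lSeries n q (len n q))
    | .W s _ _ => i = 0 ∧ b = ∑ p ∈ Finset.Ico s (len n q), rNat n q (lSeries n q p) ∨
        i = 1 ∧ rNat n q 2 + q ≤ b + q * i ∨
        (s = nu n q + 1 ∧ rNat n q 2 + q < b + q * i + rNat n q (lSeries n q (len n q))) ∨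
        rNat n q 2 + q < b + q * i := by
  have hq := H.q_pos
  have hr := H.r_pos_of_walk H.nu_lt.le le_rfl
  have hr3 := H.r_three_pos
  have hr2 := H.r_two
  have hsum := H.r_sum_all
  induction h with
  | nil => exact Or.inr (Or.inl (by simp))
  | cons a ha _ ih =>
    rcases ih with ih | ih
    · exact Or.inl (by omega)
    rcases H.one_le_arrowJ a with rfl | rfl | rfl | rfl | ⟨t, h, h', rfl⟩ | hj
    · right
      simp only [arrowSource, arrowTarget, arrowB, arrowI, Nat.mul_add] at ih ⊢
      exact Or.inr (Or.inr (Or.inl ⟨by trivial, by omega⟩))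
    · exact absurd rfl ha
    · right
      simp only [arrowSource, arrowTarget, arrowB, arrowI, Nat.mul_add] at ih ⊢
      rcases ih with ⟨rfl, rfl⟩ | ⟨rfl, ih⟩ | ⟨-, ih⟩ | ih
      · exact Or.inl ⟨by trivial, by omega⟩
      · exact Or.inr (by omega)
      · exact Or.inr (by omega)
      · exact Or.inr (by omega)
    · right
      simp only [arrowSource, arrowTarget, arrowB, arrowI, Nat.mul_add] at ih ⊢
      rcases ih with ⟨rfl, ih⟩ | ih
      · exact Or.inr (Or.inl ⟨rfl, by omega⟩)
      · exact Or.inr (Or.inr (Or.inr (by omega)))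
    · right
      simp only [arrowSource, arrowTarget, arrowB, arrowI, Nat.mul_add] at ih ⊢
      rcases ih with ⟨rfl, rfl⟩ | ⟨rfl, ih⟩ | ⟨ih, -⟩ | ih
      · refine Or.inl ⟨rfl, ?_⟩
        rw [Finset.sum_eq_sum_Ico_succ_bot h']
        omega
      · exact Or.inr (Or.inl ⟨rfl, by omega⟩)
      · omega
      · exact Or.inr (Or.inr (Or.inr (by omega)))
    · exact Or.inl (by omega)

end

/-! ### Cycles avoiding an extra arrow -/

section

variable {n q : ℕ} {hν : nu n q + 1 < len n q}

theorem Numerics.r_le (H : Numerics n q) {i j : ℕ} (h3 : 3 ≤ i) (hij : i ≤ j)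
    (hj : j ≤ lSeries n q (len n q) + 1) : rNat n q j ≤ rNat n q i := by
  rcases hij.eq_or_lt with rfl | h
  · exact le_rfl
  · exact (H.r_anti i j h3 h hj).le

theorem Numerics.k_le (H : Numerics n q) {i j : ℕ} (h3 : 3 ≤ i) (hij : i ≤ j)
    (hj : j ≤ lSeries n q (len n q) + 1) : kNat n q i ≤ kNat n q j := by
  rcases hij.eq_or_lt with rfl | h
  · exact le_rfl
  · exact (H.k_strictMono i j h3 h hj).le

/-- A budget argument from `W_N`: arrows of larger index spend too much `k`, while `down`, `g` and
extra arrows of smaller index spend too much `xy`, a backward arrow having already been paid for.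
Only backward arrows remain. -/
theorem walk_of_delete_extraFirst (H : Numerics n q) {t : ℕ} (h0 : 2 ≤ t)
    (h1 : t + 2 ≤ alpha n q (nu n q + 1)) {w : Vertex n q} {b i j : ℕ}
    (h : Walk hν {a | a ≠ .extraFirst t h0 h1} (.W (len n q) H.nu_lt.le le_rfl) w b i j)
    (hb : b ≤ rNat n q (t + 1)) (hk : i + j ≤ kNat n q (t + 1)) :
    match w with
    | .R => False
    | .W s _ _ => s = len n q ∧ b = 0 ∧ i + j = 0 ∨ s < len n q ∧ 1 ≤ b := by
  have hl := H.l_mono H.nu_lt.le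
  have hν := H.nu_lt
  have h1' := h1
  rw [← H.l_first] at h1'
  have hr3 := H.r_le (i := 3) (j := t + 1) le_rfl (by omega) (by omega)
  have hr3' := H.r_three_pos
  have hr2 := H.r_two
  have hn := H.sub_pos
  have hkl : ∀ s, lSeries n q (nu n q + 1) ≤ s → s ≤ lSeries n q (len n q) →
      kNat n q (t + 1) < cNat n q s + dNat n q s := fun s h2 h3 =>
    H.k_strictMono _ _ (by omega) (by omega) (by omega)
  induction h with
  | nil => exact Or.inl ⟨rfl, rfl, rfl⟩
  | cons a ha _ ih =>
    have ih := ih (by omega) (by omega)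
    cases a with
    | up => exact ih.elim
    | down => simp only [arrowB] at hb; omega
    | g => simp only [arrowB] at hb; omega
    | fwd s h h' =>
      have := hkl _ (H.l_mono h) (H.l_mono h'.le)
      simp only [arrowI, arrowJ] at hk
      omega
    | bwd s h h' =>
      have := H.r_pos_of_walk h h'.le
      exact Or.inr ⟨h', by simp only [arrowB]; omega⟩
    | out =>
      have := hkl _ hl le_rfl
      simp only [arrowI, arrowJ] at hk
      omega
    | into => exact ih.elim
    | extraFirst s h h' =>
      simp only [arrowSource, arrowB, arrowI, arrowJ] at ih hb hk
      rw [← H.l_first] at h'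
      rcases lt_trichotomy s t with h2 | rfl | h2
      · have := H.r_le (i := s + 2) (j := t + 1) (by omega) (by omega) (by omega)
        have := H.r_pos (t + 1) (by omega) (by omega)
        omega
      · exact absurd rfl ha
      · have := H.k_strictMono (t + 1) (s + 1) (by omega) (by omega) (by omega)
        rw [kNat, kNat] at this
        rw [kNat] at hk
        omega
    | extra s t' hs hs' h h' =>
      obtain ⟨h2, h3, h4⟩ := H.extra_index hs hs' h'
      have := hkl (t' - 1 + lSeries n q (s - 1)) (by omega) (by omega)
      simp only [arrowI, arrowJ] at hk
      omega

/-- The mirror image, from `W_{ν+1}`: a forward arrow must be spent first, which leaves too little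
`k` for `out` or an extra arrow of larger index; returning to `W_{ν+1}` would cost `r_{l_{ν+1}}`,
more than the budget for `xy`. -/
theorem walk_of_delete_extra (H : Numerics n q) {s t : ℕ} (hs0 : nu n q + 1 < s)
    (hs1 : s ≤ len n q) (h0 : 1 ≤ t) (h1 : t + 2 ≤ alpha n q s) {w : Vertex n q} {b i j : ℕ}
    (h : Walk hν {a | a ≠ .extra s t hs0 hs1 h0 h1} (.W (nu n q + 1) le_rfl H.nu_lt.le) w b i j)
    (hb : b ≤ rNat n q (t + lSeries n q (s - 1)))
    (hk : i + j ≤ kNat n q (t + lSeries n q (s - 1))) :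
    match w with
    | .R => False
    | .W p _ _ => p = nu n q + 1 ∧ b = 0 ∧ i + j = 0 ∨ nu n q + 1 < p ∧ 1 ≤ i + j := by
  obtain ⟨hJ1, hJ2, hJ3⟩ := H.extra_index hs0 hs1 h1
  have hν := H.nu_lt
  have hl := H.l_mono H.nu_lt.le
  have hl3 := H.three_le_l _ le_rfl
  obtain ⟨J, hJ⟩ : ∃ J, J = t + lSeries n q (s - 1) := ⟨_, rfl⟩
  rw [← hJ] at hb hk
  have hr3 := H.r_le (i := 3) (j := J) le_rfl (by omega) (by omega)
  have hr3' := H.r_three_pos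
  have hr2 := H.r_two
  have hn := H.sub_pos
  induction h with
  | nil => exact Or.inl ⟨rfl, rfl, rfl⟩
  | cons a ha _ ih =>
    have ih := ih (by omega) (by omega)
    cases a with
    | up => exact ih.elim
    | down => simp only [arrowB] at hb; omega
    | g => simp only [arrowB] at hb; omega
    | fwd p h h' =>
      have := H.one_le_d_l h h'.le
      simp only [arrowTarget, arrowI, arrowJ] at hk ⊢
      exact Or.inr ⟨by omega, by omega⟩
    | bwd p h h' =>
      simp only [arrowSource, arrowTarget, arrowB, arrowI, arrowJ] at hb hk ih ⊢
      right
      refine ⟨?_, by omega⟩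
      rcases h.eq_or_lt with rfl | h2
      · have := H.r_anti (lSeries n q (nu n q + 1)) J hl3 (by omega) (by omega)
        omega
      · exact h2
    | out =>
      simp only [arrowSource, arrowI, arrowJ] at hk ih
      have := H.k_le (i := J) (j := lSeries n q (len n q)) (by omega) (by omega) (by omega)
      rw [kNat, kNat] at this
      rw [kNat] at hk
      omega
    | into => exact ih.elim
    | extraFirst p h h' =>
      rw [← H.l_first] at h'
      have := H.r_anti (p + 2) J (by omega) (by omega) (by omega)
      simp only [arrowB] at hb
      omega
    | extra s' t' hs hs' h h' =>
      obtain ⟨h2, h3, h4⟩ := H.extra_index hs hs' h'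
      simp only [arrowSource, arrowB, arrowI, arrowJ] at hb hk ih
      rcases lt_trichotomy (t' + lSeries n q (s' - 1)) J with h5 | h5 | h5
      · have := H.r_anti _ J (by omega) h5 (by omega)
        omega
      · obtain rfl : s' = s := by
          rcases lt_trichotomy s' s with h6 | h6 | h6
          · have := H.l_mono (show s' ≤ s - 1 by omega)
            omega
          · exact h6
          · have := H.l_mono (show s ≤ s' - 1 by omega)
            omega
        obtain rfl : t' = t := by omega
        exact absurd rfl ha
      · have := H.k_le (i := J) (j := t' - 1 + lSeries n q (s' - 1)) (by omega) (by omega)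
          (by omega)
        rw [kNat, kNat] at this
        rw [kNat] at hk
        omega

/-! ### The top degree of a cycle -/

/-- From `r_3 + q = (a₂ - 1)(n - q) ≥ n - q`, the sum of the backward exponents is at most `q`; it
contains `r_{l_{ν+1}}` and a further positive term. Since `r_J < q`, the degree of generator `J`
leaves no room for `i + j > k_J`. -/
theorem Numerics.r_lt_q (H : Numerics n q) {J : ℕ} (hJ : lSeries n q (nu n q + 1) ≤ J)
    (hJ' : J ≤ lSeries n q (len n q) + 1) : rNat n q J < q := by
  have h1 := H.r_sum_all
  have h2 := H.r_pos_of_walk H.nu_lt.le le_rfl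
  have h3 := H.three_le_l _ le_rfl
  have h4 := H.r_le h3 hJ hJ'
  have h5 : rNat n q (lSeries n q (nu n q + 1)) ≤
      ∑ p ∈ Finset.Ico (nu n q + 1) (len n q), rNat n q (lSeries n q p) :=
    Finset.single_le_sum (f := fun p => rNat n q (lSeries n q p)) (fun _ _ => Nat.zero_le _)
      (Finset.mem_Ico.2 ⟨le_rfl, H.nu_lt⟩)
  have h6 := H.r_type 3 (by norm_num) (by have := H.l_mono H.nu_lt.le; omega)
  have h7 : kNat n q 3 = 1 := rfl
  have h8 := H.two_le_a
  rw [tNat_three H, h7] at h6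
  have h9 : (n - q) * 1 ≤ (n - q) * (aEntry n q 2 - 1) := Nat.mul_le_mul_left _ (by omega)
  omega

theorem Numerics.r_lt_q_of_three_le (H : Numerics n q) (ha : 3 ≤ aEntry n q 2) {J : ℕ}
    (h3 : 3 ≤ J) (hJ : J ≤ lSeries n q (len n q) + 1) : rNat n q J < q := by
  have h1 := H.r_sum_all
  have h2 := H.r_pos_of_walk H.nu_lt.le le_rfl
  have h4 := H.r_le le_rfl h3 hJ
  have h6 := H.r_type 3 (by norm_num) (by omega)
  have h7 : kNat n q 3 = 1 := rfl
  rw [tNat_three H, h7] at h6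
  have h9 : (n - q) * 2 ≤ (n - q) * (aEntry n q 2 - 1) := Nat.mul_le_mul_left _ (by omega)
  omega

theorem Numerics.first_block (H : Numerics n q) {j : ℕ}
    (hj : j + 3 ≤ lSeries n q (nu n q + 1)) :
    kNat n q (j + 3) = j + 1 ∧ dNat n q (j + 3) = 1 := by
  have hl := H.l_mono H.nu_lt.le
  induction j with
  | zero => exact ⟨rfl, rfl⟩
  | succ j ih =>
    have ih := ih (by omega)
    have hs : lSeries n q (nu n q + 1 - 1) ≤ j + 3 := by
      rw [Nat.add_sub_cancel, H.l_nu]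
      omega
    have h1 := H.c_sum (nu n q + 1) (j + 3) le_rfl H.nu_lt.le hs (Or.inl (by omega)) (by omega)
      (by omega)
    have h2 := H.d_sum (nu n q + 1) (j + 3) le_rfl H.nu_lt.le hs (Or.inl (by omega)) (by omega)
      (by omega)
    simp only [Finset.Ico_self, Finset.sum_empty, add_zero] at h1 h2
    simp only [kNat, show j + 1 + 3 = j + 3 + 1 from rfl] at ih ⊢
    omega

theorem Numerics.r_first_block (H : Numerics n q) (ha : aEntry n q 2 = 2) {j : ℕ}
    (hj : j + 3 ≤ lSeries n q (nu n q + 1)) : n - q = rNat n q (j + 3) + q * j + q := by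
  have hl := H.l_mono H.nu_lt.le
  have h1 := H.r_type (j + 3) (by omega) (by omega)
  have h2 := H.t_eq (j + 3) (by omega) (by omega)
  have h3 := H.first_block hj
  rw [h2, h3.1, h3.2, ha] at h1
  simp only [Nat.sub_self, zero_mul, add_zero, mul_one, mul_add] at h1
  omega

/-- For `a₂ = 2`, a label of small degree has degree at most one in `u₃`. -/
theorem Numerics.arrowJ_le (H : Numerics n q) (ha : aEntry n q 2 = 2) {J : ℕ}
    (h3 : lSeries n q (nu n q + 1) ≤ J) (hJ : J ≤ lSeries n q (len n q) + 1) :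
    n - q < q * (cNat n q J + dNat n q J) ∨
      dNat n q J = 1 ∧ rNat n q 3 ≤ q * (cNat n q J + dNat n q J) := by
  have hl3 := H.three_le_l _ le_rfl
  have hr := H.r_lt_q le_rfl (h3.trans hJ)
  obtain ⟨m, hm⟩ := Nat.exists_eq_add_of_le' hl3
  have h1 := H.r_first_block ha hm.ge
  have h2 := H.first_block hm.ge
  have h0 := H.r_first_block ha (j := 0) (by omega)
  simp only [mul_zero, zero_add, add_zero] at h0
  rw [← hm] at h1 h2
  rcases h3.eq_or_lt with rfl | h3
  · right
    refine ⟨h2.2, ?_⟩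
    rw [← kNat, h2.1, mul_add, mul_one]
    omega
  · left
    have h4 := H.k_strictMono _ J hl3 h3 hJ
    rw [h2.1] at h4
    have h5 := Nat.mul_le_mul_left q (show m + 2 ≤ kNat n q J by omega)
    rw [kNat, mul_add] at h5
    omega

/-- Within this degree an arrow containing `u₃` contains it once and has half-degree at least `r_3`.
Here `n - q = r_3 + q` and `r_3 = r_4 + q`, so two such arrows do not fit; without any, `R` is out
of reach from `W_N`. -/
theorem walk_of_aEntry_eq_two (H : Numerics n q) (ha : aEntry n q 2 = 2)
    (hl4 : 4 ≤ lSeries n q (nu n q + 1)) {A : Set (Arrow n q)} {w : Vertex n q} {b i j : ℕ}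
    (h : Walk hν A (.W (len n q) H.nu_lt.le le_rfl) w b i j)
    (hb : b + q * (i + j) ≤ n - q) :
    (j = 1 ∧ rNat n q 3 ≤ b + q * (i + j)) ∨ j = 0 ∧
    match w with
    | .R => False
    | .W s _ _ => s = len n q → b = 0 ∧ i = 0 := by
  have hl := H.l_mono H.nu_lt.le
  have hr3 := H.r_three_pos
  have hr2 := H.r_two
  have hr4 := H.r_pos 4 (by omega) (by omega)
  have h0 := H.r_first_block ha (j := 0) (by omega)
  have h1 := H.r_first_block ha (j := 1) (by omega)
  simp only [zero_add, mul_zero, add_zero, mul_one, Nat.reduceAdd] at h0 h1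
  induction h with
  | nil => exact Or.inr ⟨rfl, fun _ => ⟨rfl, rfl⟩⟩
  | @cons b i j a _ _ ih =>
    have hsum : b + arrowB a + q * (i + arrowI a + (j + arrowJ a)) =
        (b + q * (i + j)) + (arrowB a + q * (arrowI a + arrowJ a)) := by ring
    rw [hsum] at hb ⊢
    have ih := ih (by omega)
    have hpos : (arrowJ a = 1 ∧ rNat n q 3 ≤ arrowB a + q * (arrowI a + arrowJ a)) →
      (j + arrowJ a = 1 ∧ rNat n q 3 ≤ b + q * (i + j) + (arrowB a + q * (arrowI a + arrowJ a))) ∨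
        j + arrowJ a = 0 ∧ match arrowTarget hν a with
        | .R => False
        | .W s _ _ => s = len n q → b + arrowB a = 0 ∧ i + arrowI a = 0 := by
      rintro ⟨h2, h3⟩
      rcases ih with ⟨rfl, ih⟩ | ⟨rfl, -⟩
      · omega
      · exact Or.inl ⟨by omega, by omega⟩
    cases a with
    | up =>
      rcases ih with ⟨rfl, ih⟩ | ⟨rfl, ih⟩
      · exact Or.inl ⟨rfl, by omega⟩
      · exact ih.elim
    | down => simp only [arrowB] at hb; omega
    | g => simp only [arrowB, arrowI, arrowJ] at hb; omega
    | fwd s h h' =>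
      rcases H.arrowJ_le ha (H.l_mono h) ((H.l_mono h'.le).trans (Nat.le_succ _)) with h2 | h2
      · simp only [arrowB, arrowI, arrowJ] at hb
        omega
      · refine hpos ?_
        simp only [arrowB, arrowI, arrowJ]
        omega
    | bwd s h h' =>
      rcases ih with ⟨rfl, ih⟩ | ⟨rfl, ih⟩
      · exact Or.inl ⟨rfl, by omega⟩
      · exact Or.inr ⟨rfl, fun h => by omega⟩
    | out =>
      rcases H.arrowJ_le ha hl (Nat.le_succ _) with h2 | h2
      · simp only [arrowB, arrowI, arrowJ] at hb
        omega
      · refine hpos ?_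
        simp only [arrowB, arrowI, arrowJ]
        omega
    | into =>
      rcases ih with ⟨rfl, ih⟩ | ⟨rfl, ih⟩
      · exact Or.inl ⟨rfl, by omega⟩
      · exact ih.elim
    | extraFirst t h h' =>
      rw [← H.l_first] at h'
      obtain ⟨t, rfl⟩ := Nat.exists_eq_add_of_le' h
      have h2 := H.first_block (j := t) (by omega)
      have h3 := H.r_first_block ha (j := t + 1) (by omega)
      refine hpos ?_
      have h4 := h2.1
      rw [kNat] at h4
      replace h4 : cNat n q (t + 3) = t := by omega
      simp only [arrowB, arrowI, arrowJ, show t + 2 + 1 = t + 3 from rfl, h4, h2.2, true_and]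
      rw [mul_add] at h3 ⊢
      rw [show t + 2 + 2 = t + 1 + 3 from rfl]
      omega
    | extra s t hs hs' h h' =>
      obtain ⟨h2, h3, h4⟩ := H.extra_index hs hs' h'
      rcases H.arrowJ_le ha (J := t - 1 + lSeries n q (s - 1)) (by omega) (by omega) with h2 | h2
      · simp only [arrowB, arrowI, arrowJ] at hb
        omega
      · refine hpos ?_
        simp only [arrowB, arrowI, arrowJ]
        omega

end

section

variable {K : Type*} [Field K]

/-! ### Tests for membership in a span of labels -/

theorem isHomogeneous_symPow (q k e : ℕ) : (symPow K q k e).IsHomogeneous (2 * q * k) := by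
  refine IsHomogeneous.add ?_ ?_
  · simpa using (isHomogeneous_X K (0 : Fin 2)).pow (2 * q * k)
  · have h : ((-1) ^ e : MvPolynomial (Fin 2) K) = C ((-1) ^ e) := by simp
    rw [h]
    simpa using (isHomogeneous_C (Fin 2) ((-1 : K) ^ e)).mul
      ((isHomogeneous_X K (1 : Fin 2)).pow (2 * q * k))

theorem isHomogeneous_mul_pow (b : ℕ) :
    ((X 0 * X 1 : MvPolynomial (Fin 2) K) ^ b).IsHomogeneous (2 * b) := by
  simpa using ((isHomogeneous_X K (0 : Fin 2)).mul (isHomogeneous_X K (1 : Fin 2))).pow b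

theorem isHomogeneous_symMonomial {n q m k : ℕ} (h : q * k ≤ (n - q) * m) :
    (symMonomial K n q m k).IsHomogeneous (2 * ((n - q) * m)) := by
  have := (isHomogeneous_mul_pow (K := K) ((n - q) * m - q * k)).mul (isHomogeneous_symPow q k m)
  rw [mul_assoc 2 q k, ← mul_add, Nat.sub_add_cancel h] at this
  exact this

/-- The polynomials `w₂`, `w₃`, `v₂`, `v₃` have this shape. -/
noncomputable def stdPoly (q e : ℕ) (c : K) : MvPolynomial (Fin 2) K :=
  symPow K q 1 e + C c * (X 0 * X 1) ^ q

theorem isHomogeneous_stdPoly (q e : ℕ) (c : K) : (stdPoly q e c).IsHomogeneous (2 * q) := by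
  refine IsHomogeneous.add (by simpa using isHomogeneous_symPow (K := K) q 1 e) ?_
  simpa using (isHomogeneous_C (Fin 2) c).mul (isHomogeneous_mul_pow (K := K) q)

theorem isHomogeneous_labelOf {q : ℕ} (e e' : ℕ) (c c' : K) (b i j : ℕ) :
    (labelOf (stdPoly q e c) (stdPoly q e' c') b i j).IsHomogeneous (2 * (b + q * (i + j))) := by
  have := ((isHomogeneous_mul_pow (K := K) b).mul ((isHomogeneous_stdPoly q e c).pow i)).mul
    ((isHomogeneous_stdPoly q e' c').pow j)
  rw [show 2 * b + 2 * q * i + 2 * q * j = 2 * (b + q * (i + j)) by ring] at this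
  exact this

/-- Labels and the chosen invariant are homogeneous, so taking a homogeneous component discards all
cycles of other degrees; a linear map and a subspace then detect the failure. -/
theorem not_seesAll_delete {n q : ℕ} {hν : nu n q + 1 < len n q} (a : Arrow n q) {e e' : ℕ}
    {c c' : K} {S : Subalgebra K (MvPolynomial (Fin 2) K)} (v : Vertex n q) {D : ℕ}
    {f : MvPolynomial (Fin 2) K} (hf : f ∈ S) (hD : f.IsHomogeneous (2 * D))
    {M : Type*} [AddCommGroup M] [Module K M] (Φ : MvPolynomial (Fin 2) K →ₗ[K] M)
    (W : Submodule K M) (hΦ : Φ f ∉ W)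
    (hW : ∀ b i j, Walk hν {a' | a' ≠ a} v v b i j → b + q * (i + j) = D →
      Φ (labelOf (stdPoly q e c) (stdPoly q e' c') b i j) ∈ W) :
    ¬ ((quiverD hν (stdPoly q e c) (stdPoly q e' c')).delete a).SeesAll S := by
  intro h
  have h1 := h v f hf
  have h2 : f ∈ W.comap (Φ ∘ₗ homogeneousComponent (2 * D)) := by
    refine Submodule.span_le.2 ?_ h1
    rintro _ ⟨p, rfl⟩
    obtain ⟨b, i, j, hw, hp⟩ := exists_walk_of_path _ _ a p
    have hmem : Φ (homogeneousComponent (2 * D)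
        (labelOf (stdPoly q e c) (stdPoly q e' c') b i j)) ∈ W := by
      rw [homogeneousComponent_of_mem (isHomogeneous_labelOf e e' c c' b i j)]
      split_ifs with h3
      · exact hW b i j hw (by omega)
      · rw [map_zero]
        exact W.zero_mem
    rw [← hp] at hmem
    exact hmem
  rw [Submodule.mem_comap, LinearMap.comp_apply, homogeneousComponent_of_mem hD, if_pos rfl] at h2
  exact hΦ h2

open Polynomial in
theorem natDegree_X_pow_add_of_degree_lt {m : ℕ} {p : K[X]} (h : p.degree < m) :
    (Polynomial.X ^ m + p).natDegree = m :=
  natDegree_eq_of_degree_eq_some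
    ((degree_add_eq_left_of_degree_lt (by rwa [degree_X_pow])).trans (degree_X_pow _))

/-! ### A point where `u₃` vanishes -/

section

open Polynomial in
theorem exists_root_algebra.{u} {K : Type u} [Field K] (q e : ℕ) (hq : 0 < q) (c : K) :
    ∃ (B : Type u) (_ : CommRing B) (_ : Algebra K B) (x y : B), x * y = 1 ∧
      x ^ (2 * q) + (-1) ^ (e + 1) * y ^ (2 * q) + algebraMap K B c = 0 ∧
      ∀ r s : K, algebraMap K B r + algebraMap K B s * x ^ (2 * q) = 0 → r = 0 ∧ s = 0 := by
  have hdeg : (Polynomial.C c * Polynomial.X ^ (2 * q) - Polynomial.C ((-1) ^ e) : K[X]).degree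
      < (4 * q : ℕ) := by
    refine (degree_sub_le _ _).trans_lt (max_lt ?_ ?_)
    · exact (degree_C_mul_X_pow_le _ _).trans_lt (by exact_mod_cast (by omega : 2 * q < 4 * q))
    · exact degree_C_le.trans_lt (by exact_mod_cast (by omega : 0 < 4 * q))
  -- `F` is `x^(2q)` times the desired relation after `y = x⁻¹`. Its degree `4q` exceeds `2q`, so
  -- `1` and `x^(2q)` stay independent in the quotient.
  obtain ⟨F, hF⟩ : ∃ F : K[X], F = Polynomial.X ^ (4 * q) +
    (Polynomial.C c * Polynomial.X ^ (2 * q) - Polynomial.C ((-1) ^ e)) := ⟨_, rfl⟩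
  have hmonic : F.Monic := hF ▸ monic_X_pow_add hdeg
  have hnat : F.natDegree = 4 * q := hF ▸ natDegree_X_pow_add_of_degree_lt hdeg
  have hx : (AdjoinRoot.root F) ^ (4 * q) + algebraMap K (AdjoinRoot F) c *
      (AdjoinRoot.root F) ^ (2 * q) - (-1) ^ e = 0 := by
    have : AdjoinRoot.mk F (Polynomial.X ^ (4 * q) +
        (Polynomial.C c * Polynomial.X ^ (2 * q) - Polynomial.C ((-1) ^ e))) = 0 := by
      rw [← hF]
      exact AdjoinRoot.mk_self
    simp only [map_add, map_sub, map_mul, map_pow, AdjoinRoot.mk_X, AdjoinRoot.mk_C, map_neg,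
      map_one] at this
    rw [AdjoinRoot.algebraMap_eq]
    linear_combination this
  obtain ⟨x, hxdef⟩ : ∃ x, x = AdjoinRoot.root F := ⟨_, rfl⟩
  rw [← hxdef] at hx
  have he : ((-1 : AdjoinRoot F) ^ e) * (-1) ^ e = 1 := by
    rw [← mul_pow]
    simp
  have hxy : x * ((-1) ^ e * (x ^ (4 * q - 1) + algebraMap K (AdjoinRoot F) c * x ^ (2 * q - 1)))
      = 1 := by
    have h1 : x * x ^ (4 * q - 1) = x ^ (4 * q) := mul_pow_sub_one (by omega) x
    have h2 : x * x ^ (2 * q - 1) = x ^ (2 * q) := mul_pow_sub_one (by omega) x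
    linear_combination (-1) ^ e * hx + he + (-1) ^ e * h1 +
      (-1) ^ e * algebraMap K (AdjoinRoot F) c * h2
  obtain ⟨y, hy⟩ : ∃ y, y = (-1) ^ e * (x ^ (4 * q - 1) + algebraMap K (AdjoinRoot F) c *
    x ^ (2 * q - 1)) := ⟨_, rfl⟩
  rw [← hy] at hxy
  refine ⟨AdjoinRoot F, inferInstance, inferInstance, x, y, hxy, ?_, ?_⟩
  · have h3 : x ^ (2 * q) * y ^ (2 * q) = 1 := by rw [← mul_pow, hxy, one_pow]
    have h4 : x ^ (4 * q) = x ^ (2 * q) * x ^ (2 * q) := by ring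
    rw [h4] at hx
    rw [pow_succ]
    linear_combination y ^ (2 * q) * hx - (x ^ (2 * q) + algebraMap K (AdjoinRoot F) c) * h3
  · intro r s hrs
    have h1 : AdjoinRoot.mk F (Polynomial.C r + Polynomial.C s * Polynomial.X ^ (2 * q)) = 0 := by
      rw [← hrs, hxdef]
      simp [AdjoinRoot.algebraMap_eq]
    rw [AdjoinRoot.mk_eq_zero] at h1
    have h2 := eq_zero_of_dvd_of_natDegree_lt h1 (by
      rw [hnat]
      refine (natDegree_add_le _ _).trans_lt (max_lt ?_ ?_)
      · rw [natDegree_C]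
        omega
      · exact (natDegree_C_mul_X_pow_le _ _).trans_lt (by omega))
    constructor
    · have := congrArg (fun p => p.coeff 0) h2
      simpa [Polynomial.coeff_X_pow, (show ¬ (0 = 2 * q) by omega), hq.ne'] using this
    · have := congrArg (fun p => p.coeff (2 * q)) h2
      simpa [Polynomial.coeff_C, hq.ne'] using this

end

/-! ### Leading terms -/

section

open Polynomial in
/-- The substitution `y ↦ 1`. -/
noncomputable def dehomogenize (K : Type*) [Field K] : MvPolynomial (Fin 2) K →ₐ[K] K[X] :=
  aeval ![Polynomial.X, 1]

open Polynomial in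
theorem monic_dehomogenize_stdPoly {q : ℕ} (hq : 0 < q) (e : ℕ) (c : K) :
    (dehomogenize K (stdPoly q e c)).Monic ∧
      (dehomogenize K (stdPoly q e c)).natDegree = 2 * q := by
  have h : dehomogenize K (stdPoly q e c) = Polynomial.X ^ (2 * q) +
      (Polynomial.C c * Polynomial.X ^ q + Polynomial.C ((-1) ^ e)) := by
    simp [dehomogenize, stdPoly, symPow, algHom_C]
    ring
  have hdeg : (Polynomial.C c * Polynomial.X ^ q + Polynomial.C ((-1) ^ e) : K[X]).degree
      < (2 * q : ℕ) := by
    refine (degree_add_le _ _).trans_lt (max_lt ?_ ?_)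
    · exact (degree_C_mul_X_pow_le _ _).trans_lt (by exact_mod_cast (by omega : q < 2 * q))
    · exact degree_C_le.trans_lt (by exact_mod_cast (by omega : 0 < 2 * q))
  rw [h]
  exact ⟨monic_X_pow_add hdeg, natDegree_X_pow_add_of_degree_lt hdeg⟩

theorem monic_dehomogenize_labelOf {q : ℕ} (hq : 0 < q) (e e' : ℕ) (c c' : K) (b i j : ℕ) :
    (dehomogenize K (labelOf (stdPoly q e c) (stdPoly q e' c') b i j)).Monic ∧
      (dehomogenize K (labelOf (stdPoly q e c) (stdPoly q e' c') b i j)).natDegree =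
        b + 2 * q * (i + j) := by
  obtain ⟨h1, h2⟩ := monic_dehomogenize_stdPoly hq e c
  obtain ⟨h3, h4⟩ := monic_dehomogenize_stdPoly hq e' c'
  have h5 : dehomogenize K (labelOf (stdPoly q e c) (stdPoly q e' c') b i j) =
      Polynomial.X ^ b * dehomogenize K (stdPoly q e c) ^ i *
        dehomogenize K (stdPoly q e' c') ^ j := by
    simp [labelOf, dehomogenize]
  rw [h5]
  refine ⟨((Polynomial.monic_X_pow b).mul (h1.pow i)).mul (h3.pow j), ?_⟩
  rw [((Polynomial.monic_X_pow b).mul (h1.pow i)).natDegree_mul (h3.pow j),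
    (Polynomial.monic_X_pow b).natDegree_mul (h1.pow i), h1.natDegree_pow, h3.natDegree_pow, h2, h4,
    Polynomial.natDegree_X_pow]
  ring

theorem monic_dehomogenize_symMonomial {n q m k : ℕ} (hq : 0 < q) (hk : 0 < k) :
    (dehomogenize K (symMonomial K n q m k)).Monic ∧
      (dehomogenize K (symMonomial K n q m k)).natDegree =
        (n - q) * m - q * k + 2 * q * k := by
  have h : dehomogenize K (symMonomial K n q m k) = Polynomial.X ^ ((n - q) * m - q * k) *
      (Polynomial.X ^ (2 * q * k) + Polynomial.C ((-1) ^ m)) := by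
    simp [dehomogenize, symMonomial]
  have h0 : 2 * q * k ≠ 0 := by positivity
  rw [h]
  have h1 := Polynomial.monic_X_pow_add_C ((-1 : K) ^ m) h0
  refine ⟨(Polynomial.monic_X_pow _).mul h1, ?_⟩
  rw [(Polynomial.monic_X_pow _).natDegree_mul h1, Polynomial.natDegree_X_pow,
    Polynomial.natDegree_X_pow_add_C]

/-- Distinct degrees above `d` prevent cancellation: the largest index occurring in a combination
leaves a nonzero coefficient in degree greater than `d`. -/
theorem notMem_degreeLT_sup_span {d : ℕ} {g : ℕ → Polynomial K} (hg : ∀ x, (g x).Monic)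
    (hmono : StrictMono fun x => (g x).natDegree) (hd : ∀ x, d < (g x).natDegree)
    {f : Polynomial K} (hf : f.Monic) (hfd : f.natDegree = d) :
    f ∉ Polynomial.degreeLT K d ⊔ Submodule.span K (Set.range g) := by
  intro h
  obtain ⟨l, hl, y, hy, rfl⟩ := Submodule.mem_sup.1 h
  obtain ⟨c, rfl⟩ := Finsupp.mem_span_range_iff_exists_finsupp.1 hy
  rw [Polynomial.mem_degreeLT] at hl
  rcases c.support.eq_empty_or_nonempty with h0 | h0
  · rw [Finsupp.support_eq_empty.1 h0, Finsupp.sum_zero_index, add_zero] at hf hfd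
    rw [Polynomial.degree_eq_natDegree hf.ne_zero, hfd] at hl
    exact lt_irrefl _ hl
  · have hN := Finset.max'_mem _ h0
    obtain ⟨N, hNdef⟩ : ∃ N, N = c.support.max' h0 := ⟨_, rfl⟩
    rw [← hNdef] at hN
    have h1 : (l + c.sum fun i a => a • g i).coeff (g N).natDegree = 0 :=
      Polynomial.coeff_eq_zero_of_natDegree_lt (hfd ▸ hd N)
    rw [Polynomial.coeff_add, Polynomial.coeff_eq_zero_of_degree_lt
      (hl.trans (by exact_mod_cast hd N)), zero_add, Finsupp.sum, Polynomial.finsetSum_coeff,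
      Finset.sum_eq_single N, Polynomial.coeff_smul, (hg N).coeff_natDegree] at h1
    · rw [smul_eq_mul, mul_one] at h1
      exact (Finsupp.mem_support_iff.1 hN) h1
    · intro x hx hxN
      have h2 : x < N := lt_of_le_of_ne (hNdef ▸ Finset.le_max' _ x hx) hxN
      rw [Polynomial.coeff_smul, Polynomial.coeff_eq_zero_of_natDegree_lt (hmono h2), smul_zero]
    · exact fun h => absurd hN h

end

end

section

variable {K : Type*} [Field K]

/-- There is an algebra in which `xy = 1` and `u₃ = 0`, but `v₂` and `u₂` are not constants. -/
theorem exists_algHom_eq_zero.{u} {K : Type u} [Field K] {q : ℕ} (hq : 0 < q) (e : ℕ) (c : K) :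
    ∃ (B : Type u) (_ : CommRing B) (_ : Algebra K B) (ρ : MvPolynomial (Fin 2) K →ₐ[K] B) (z : B),
      ρ (X 0 * X 1) = 1 ∧ ρ (stdPoly q (e + 1) c) = 0 ∧
      ρ (symPow K q 1 e) = algebraMap K B 2 * z + algebraMap K B c ∧
      ∀ r s : K, algebraMap K B r + algebraMap K B s * z = 0 → r = 0 ∧ s = 0 := by
  obtain ⟨B, _, _, x, y, hxy, h3, hind⟩ := exists_root_algebra q e hq c
  refine ⟨B, _, _, aeval ![x, y], x ^ (2 * q), by simpa using hxy, ?_, ?_, hind⟩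
  · simp only [stdPoly, symPow, map_add, map_mul, map_pow, map_neg, map_one, aeval_X, algHom_C,
      Matrix.cons_val_zero, Matrix.cons_val_one, mul_one, hxy, one_pow]
    exact h3
  · simp only [symPow, map_add, map_mul, map_pow, map_neg, map_one, aeval_X, map_ofNat,
      Matrix.cons_val_zero, Matrix.cons_val_one, mul_one]
    rw [pow_succ] at h3
    linear_combination -h3

variable {n q : ℕ} {hν : nu n q + 1 < len n q} (ε : ℕ → K) (c₂ c₃ : K)

/-! ### No arrow can be removed -/

theorem not_seesAll_delete_upward (H : Numerics n q) {a : Arrow n q}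
    (ha : a = .up ∨ (∃ t h h', a = .fwd t h h') ∨ a = .out)
    (hε : ∀ t, 0 < t → IsPrimitiveRoot (ε t) t) :
    ¬ ((quiverD hν (stdPoly q (aEntry n q 2) c₂) (stdPoly q (aEntry n q 2 + 1) c₃)).delete
      a).SeesAll (invariantRing (dihedralGroup ε n q)) := by
  -- The lattice point `(q, n - q)` lies on the boundary of the cone, so its invariant has no factor
  -- `xy`.
  have hle : q * (n - q) ≤ (n - q) * q := (mul_comm _ _).le
  have hn := H.sub_pos
  have hq := H.q_pos
  have hpos : 2 * q * (n - q) ≠ 0 := by positivity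
  refine not_seesAll_delete a .R (symMonomial_mem ε hε H.q_pos H.q_lt hle)
    (isHomogeneous_symMonomial hle) (aeval ![1, 0] : MvPolynomial (Fin 2) K →ₐ[K] K).toLinearMap ⊥
    ?_ ?_
  · simp [symMonomial, mul_comm q (n - q), hpos]
  · intro b i j hw hD
    have hb : b ≠ 0 := by
      intro hb
      obtain ⟨rfl, rfl⟩ := walk_of_delete_upward H ha hw hb
      rw [hb] at hD
      have : 0 < (n - q) * q := by positivity
      simp at hD
      omega
    simp [labelOf, hb]

theorem ne_zero_of_two [CharZero K] {B : Type*} [CommRing B] [Algebra K B] {z : B}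
    (hind : ∀ r s : K, algebraMap K B r + algebraMap K B s * z = 0 → r = 0 ∧ s = 0) :
    (2 : B) ≠ 0 := by
  intro h
  have := (hind 2 0 (by rw [map_zero, zero_mul, add_zero, map_ofNat]; exact h)).1
  exact two_ne_zero this

theorem not_seesAll_delete_of_walk [CharZero K] (H : Numerics n q) {a : Arrow n q}
    (hε : ∀ t, 0 < t → IsPrimitiveRoot (ε t) t) (v : Vertex n q)
    (ha : ∀ b i j, Walk hν {a' | a' ≠ a} v v b i j → 1 ≤ j ∨ b = 0 ∧ i = 0 ∧ j = 0) :
    ¬ ((quiverD hν (stdPoly q (aEntry n q 2) c₂) (stdPoly q (aEntry n q 2 + 1) c₃)).delete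
      a).SeesAll (invariantRing (dihedralGroup ε n q)) := by
  obtain ⟨B, _, _, ρ, z, h1, h3, h2, hind⟩ := exists_algHom_eq_zero H.q_pos (aEntry n q 2) c₃
  have hle : q * 0 ≤ (n - q) * 2 := by simp
  have hn := H.sub_pos
  refine not_seesAll_delete a v (symMonomial_mem ε hε H.q_pos H.q_lt hle)
    (isHomogeneous_symMonomial hle) ρ.toLinearMap ⊥ ?_ ?_
  · have := ne_zero_of_two hind
    simp only [symMonomial, AlgHom.toLinearMap_apply, map_mul, map_pow, Submodule.mem_bot] at h1 ⊢
    rw [h1]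
    simpa [one_add_one_eq_two, map_ofNat] using this
  · intro b i j hw hD
    have hj : j ≠ 0 := by
      rcases ha b i j hw with h | ⟨rfl, rfl, rfl⟩
      · omega
      · simp at hD
        omega
    simp [labelOf, h3, hj]

/-- With `xy = 1` and `u₃ = 0`, the invariant `2 (xy)^(2(n-q))` becomes `2`, whereas cycles of its
degree give `0` or `u₂ = 2z +` constant; `2` is no multiple of the latter because `1` and `z` are
independent. -/
theorem not_seesAll_delete_down [CharZero K] (H : Numerics n q)
    (hε : ∀ t, 0 < t → IsPrimitiveRoot (ε t) t) :
    ¬ ((quiverD hν (stdPoly q (aEntry n q 2) c₂) (stdPoly q (aEntry n q 2 + 1) c₃)).delete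
      .down).SeesAll (invariantRing (dihedralGroup ε n q)) := by
  obtain ⟨B, _, _, ρ, z, h1, h3, h2, hind⟩ := exists_algHom_eq_zero H.q_pos (aEntry n q 2) c₃
  have hle : q * 0 ≤ (n - q) * 2 := by simp
  have hn := H.sub_pos
  have hu : ρ (stdPoly q (aEntry n q 2) c₂) = algebraMap K B 2 * z + algebraMap K B (c₃ + c₂) := by
    rw [stdPoly, map_add, h2, map_mul, map_pow, h1, algHom_C, map_add]
    ring
  refine not_seesAll_delete .down (.W (len n q) H.nu_lt.le le_rfl)
    (symMonomial_mem ε hε H.q_pos H.q_lt hle) (isHomogeneous_symMonomial hle) ρ.toLinearMap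
    (Submodule.span K {ρ (stdPoly q (aEntry n q 2) c₂)}) ?_ ?_
  · have hf : ρ.toLinearMap (symMonomial K n q 2 0) = 2 := by
      simp only [symMonomial, AlgHom.toLinearMap_apply, map_mul, map_pow] at h1 ⊢
      rw [h1]
      simp [one_add_one_eq_two, map_ofNat]
    rw [hf, Submodule.mem_span_singleton, hu]
    rintro ⟨r, hr⟩
    have h4 := hind (r * (c₃ + c₂) - 2) (r * 2) (by
      rw [Algebra.smul_def] at hr
      simp only [map_sub, map_mul, map_add, map_ofNat] at hr ⊢
      linear_combination hr)
    have h5 : r = 0 := by simpa using h4.2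
    rw [h5] at h4
    simp at h4
  · intro b i j hw hD
    rcases walk_of_delete_down H hw with hj | ⟨rfl, hb⟩ | ⟨rfl, -⟩ | ⟨h, -⟩ | h
    · have hj' : j ≠ 0 := by omega
      simp [labelOf, h3, hj']
    · rcases Nat.eq_zero_or_pos j with rfl | hj
      · simp at hb hD
        omega
      · simp [labelOf, h3, hj.ne']
    · rcases Nat.eq_zero_or_pos j with rfl | hj
      · have : ρ.toLinearMap (labelOf (stdPoly q (aEntry n q 2) c₂)
            (stdPoly q (aEntry n q 2 + 1) c₃) b 1 0) = ρ (stdPoly q (aEntry n q 2) c₂) := by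
          rw [AlgHom.toLinearMap_apply, labelOf, map_mul, map_mul, map_pow, h1]
          simp
        rw [this]
        exact Submodule.mem_span_singleton_self _
      · simp [labelOf, h3, hj.ne']
    · have := H.nu_lt
      omega
    -- The bound `r_2 + q = a₂ (n - q) ≥ 2 (n - q)` rules out the heavy walks.
    · have h4 := H.r_type 2 le_rfl (by have := H.three_le_l _ H.nu_lt.le; omega)
      have h5 : kNat n q 2 = 1 := rfl
      have h6 : tNat n q 2 = aEntry n q 2 := by simp [tNat, tSeries]
      rw [h5, h6] at h4
      have h7 := Nat.mul_le_mul_left (n - q) H.two_le_a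
      rw [mul_add] at hD
      omega

/-- Here the roles are reversed: cycles of the degree of generator `(a₂, 1)` become constants, while
the invariant becomes `2z +` constant. -/
theorem not_seesAll_delete_g [CharZero K] (H : Numerics n q)
    (hε : ∀ t, 0 < t → IsPrimitiveRoot (ε t) t) :
    ¬ ((quiverD hν (stdPoly q (aEntry n q 2) c₂) (stdPoly q (aEntry n q 2 + 1) c₃)).delete
      .g).SeesAll (invariantRing (dihedralGroup ε n q)) := by
  obtain ⟨B, _, _, ρ, z, h1, h3, h2, hind⟩ := exists_algHom_eq_zero H.q_pos (aEntry n q 2) c₃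
  have h4 := H.r_type 2 le_rfl (by have := H.three_le_l _ H.nu_lt.le; omega)
  have h5 : kNat n q 2 = 1 := rfl
  have h6 : tNat n q 2 = aEntry n q 2 := by simp [tNat, tSeries]
  rw [h5, h6] at h4
  have hle : q * 1 ≤ (n - q) * aEntry n q 2 := by omega
  refine not_seesAll_delete .g (.W (len n q) H.nu_lt.le le_rfl)
    (symMonomial_mem ε hε H.q_pos H.q_lt hle) (isHomogeneous_symMonomial hle) ρ.toLinearMap
    (Submodule.span K {1}) ?_ ?_
  · have hf : ρ.toLinearMap (symMonomial K n q (aEntry n q 2) 1) =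
        algebraMap K B 2 * z + algebraMap K B c₃ := by
      rw [← h2, symMonomial, ← symPow, AlgHom.toLinearMap_apply, map_mul, map_pow, h1, one_pow,
        one_mul]
    rw [hf, Submodule.mem_span_singleton]
    rintro ⟨r, hr⟩
    have h4 := hind (c₃ - r) 2 (by
      rw [Algebra.smul_def] at hr
      simp only [map_sub, map_ofNat] at hr ⊢
      linear_combination -hr)
    exact two_ne_zero h4.2
  · intro b i j hw hD
    rcases walk_of_delete_g H hw with hj | rfl | ⟨h, -⟩ | h
    · have hj' : j ≠ 0 := by omega
      simp [labelOf, h3, hj']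
    · rcases Nat.eq_zero_or_pos j with rfl | hj
      · have : ρ.toLinearMap (labelOf (stdPoly q (aEntry n q 2) c₂)
            (stdPoly q (aEntry n q 2 + 1) c₃) b 0 0) = 1 := by
          rw [AlgHom.toLinearMap_apply, labelOf, map_mul, map_mul, map_pow, h1]
          simp
        rw [this]
        exact Submodule.mem_span_singleton_self _
      · simp [labelOf, h3, hj.ne']
    · have := H.nu_lt
      omega
    · rw [mul_add] at hD
      omega

/-- After `y ↦ 1`, in a fixed total degree, the degree of a label grows with `i + j`. For `i + j >
k` the condition `j = 1` leaves at most one label in each degree, so these labels cannot cancel each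
other's leading terms. -/
theorem not_seesAll_delete_of_span (H : Numerics n q) {a : Arrow n q}
    (hε : ∀ t, 0 < t → IsPrimitiveRoot (ε t) t) (v : Vertex n q) {m k r : ℕ} (hk : 0 < k)
    (hr : (n - q) * m = r + q * k)
    (hw : ∀ b i j, Walk hν {a' | a' ≠ a} v v b i j → b + q * (i + j) = r + q * k →
      i + j < k ∨ k < i + j ∧ j = 1) :
    ¬ ((quiverD hν (stdPoly q (aEntry n q 2) c₂) (stdPoly q (aEntry n q 2 + 1) c₃)).delete
      a).SeesAll (invariantRing (dihedralGroup ε n q)) := by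
  have hq := H.q_pos
  have hle : q * k ≤ (n - q) * m := by omega
  have hg : ∀ x, _ := fun x => monic_dehomogenize_labelOf hq (aEntry n q 2) (aEntry n q 2 + 1) c₂ c₃
    (r + q * k - q * (k + 1 + x)) (k + x) 1
  obtain ⟨hf1, hf2⟩ := monic_dehomogenize_symMonomial (K := K) (n := n) (m := m) hq hk
  refine not_seesAll_delete a v (symMonomial_mem ε hε H.q_pos H.q_lt hle)
    (isHomogeneous_symMonomial hle) (dehomogenize K).toLinearMap
    (Polynomial.degreeLT K (r + 2 * q * k) ⊔ Submodule.span K (Set.range fun x =>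
      dehomogenize K (labelOf (stdPoly q (aEntry n q 2) c₂) (stdPoly q (aEntry n q 2 + 1) c₃)
        (r + q * k - q * (k + 1 + x)) (k + x) 1))) ?_ ?_
  · refine notMem_degreeLT_sup_span (fun x => (hg x).1) ?_ ?_ hf1 ?_
    · intro x y hxy
      simp only [(hg _).2]
      have h1 : q * (k + 1 + x) < q * (k + 1 + y) := Nat.mul_lt_mul_of_pos_left (by omega) hq
      rw [mul_assoc, mul_assoc, show k + x + 1 = k + 1 + x by ring,
        show k + y + 1 = k + 1 + y by ring]
      omega
    · intro x
      rw [(hg _).2, mul_assoc, mul_assoc, show k + x + 1 = k + 1 + x by ring]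
      have h1 : q * k < q * (k + 1 + x) := Nat.mul_lt_mul_of_pos_left (by omega) hq
      omega
    · rw [AlgHom.toLinearMap_apply, hf2]
      omega
  · intro b i j hwalk hD
    rw [hr] at hD
    rw [AlgHom.toLinearMap_apply]
    rcases hw b i j hwalk hD with h | ⟨h, rfl⟩
    · refine Submodule.mem_sup_left ?_
      obtain ⟨h1, h2⟩ := monic_dehomogenize_labelOf hq (aEntry n q 2) (aEntry n q 2 + 1) c₂ c₃ b i j
      rw [Polynomial.mem_degreeLT, Polynomial.degree_eq_natDegree h1.ne_zero, h2]
      have h1 : q * (i + j) < q * k := Nat.mul_lt_mul_of_pos_left h hq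
      rw [mul_assoc, mul_assoc]
      exact_mod_cast (by omega)
    · refine Submodule.mem_sup_right (Submodule.subset_span ⟨i - k, ?_⟩)
      simp only
      congr 2
      · rw [show k + 1 + (i - k) = i + 1 by omega]
        omega
      · omega

theorem not_seesAll_delete_extraFirst (H : Numerics n q)
    (hε : ∀ t, 0 < t → IsPrimitiveRoot (ε t) t) {t : ℕ} (h0 : 2 ≤ t)
    (h1 : t + 2 ≤ alpha n q (nu n q + 1)) :
    ¬ ((quiverD hν (stdPoly q (aEntry n q 2) c₂) (stdPoly q (aEntry n q 2 + 1) c₃)).delete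
      (.extraFirst t h0 h1)).SeesAll (invariantRing (dihedralGroup ε n q)) := by
  have hl := H.l_mono H.nu_lt.le
  have h1' := h1
  rw [← H.l_first] at h1'
  have hq := H.q_pos
  have hk : 0 < kNat n q (t + 1) := by
    have := H.one_le_d (t + 1) (by omega) (by omega)
    rw [kNat]
    omega
  refine not_seesAll_delete_of_span ε c₂ c₃ H hε (.W (len n q) H.nu_lt.le le_rfl) hk
    (H.r_type (t + 1) (by omega) (by omega)) fun b i j hw hD => ?_
  rcases lt_trichotomy (i + j) (kNat n q (t + 1)) with h | h | h
  · exact Or.inl h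
  · rw [h] at hD
    rcases walk_of_delete_extraFirst H h0 h1 hw (by omega) h.le with h2 | h2
    · omega
    · omega
  · right
    refine ⟨h, ?_⟩
    have h3 : q * (kNat n q (t + 1) + 1) ≤ q * (i + j) := Nat.mul_le_mul_left _ h
    rw [mul_add] at h3
    have ha := H.two_le_a
    -- Only for `a₂ = 2` can `r_{t+1}` reach `q` and allow cycles with `i + j > k`; these have `j =
    -- 1`. For `a₂ ≥ 3` the degree excludes them.
    rcases ha.eq_or_lt with ha | ha
    · obtain ⟨t, rfl⟩ := Nat.exists_eq_add_of_le' h0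
      have h4 := H.first_block (j := t) (by omega)
      have h5 := H.r_first_block ha.symm (j := t) (by omega)
      rw [show t + 2 + 1 = t + 3 from rfl, h4.1] at hD
      rw [mul_add q t] at hD
      rcases walk_of_aEntry_eq_two H ha.symm (by omega) hw (by omega) with h6 | ⟨rfl, h6⟩
      · exact h6.1
      · obtain ⟨rfl, rfl⟩ := h6 rfl
        omega
    · have := H.r_lt_q_of_three_le ha (J := t + 1) (by omega) (by omega)
      omega

theorem not_seesAll_delete_extra (H : Numerics n q)
    (hε : ∀ t, 0 < t → IsPrimitiveRoot (ε t) t) {s t : ℕ} (hs : nu n q + 1 < s)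
    (hs' : s ≤ len n q) (h0 : 1 ≤ t) (h1 : t + 2 ≤ alpha n q s) :
    ¬ ((quiverD hν (stdPoly q (aEntry n q 2) c₂) (stdPoly q (aEntry n q 2 + 1) c₃)).delete
      (.extra s t hs hs' h0 h1)).SeesAll (invariantRing (dihedralGroup ε n q)) := by
  obtain ⟨hJ1, hJ2, hJ3⟩ := H.extra_index hs hs' h1
  have hq := H.q_pos
  have hl3 := H.three_le_l _ le_rfl
  have hk : 0 < kNat n q (t + lSeries n q (s - 1)) := by
    have := H.one_le_d (t + lSeries n q (s - 1)) (by omega) (by omega)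
    rw [kNat]
    omega
  refine not_seesAll_delete_of_span ε c₂ c₃ H hε (.W (nu n q + 1) le_rfl H.nu_lt.le) hk
    (H.r_type (t + lSeries n q (s - 1)) (by omega) (by omega)) fun b i j hw hD => ?_
  left
  have hr := H.r_lt_q (J := t + lSeries n q (s - 1)) (by omega) (by omega)
  by_contra! h
  rcases h.eq_or_lt with h | h
  · rw [← h] at hD
    rcases walk_of_delete_extra H hs hs' h0 h1 hw (by omega) h.ge with h2 | h2
    · omega
    · omega
  · have h3 : q * (kNat n q (t + lSeries n q (s - 1)) + 1) ≤ q * (i + j) :=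
      Nat.mul_le_mul_left _ h
    rw [mul_add] at h3
    omega

theorem not_seesAll_delete_quiverD [CharZero K] (H : Numerics n q)
    (hε : ∀ t, 0 < t → IsPrimitiveRoot (ε t) t) (a : Arrow n q) :
    ¬ ((quiverD hν (stdPoly q (aEntry n q 2) c₂) (stdPoly q (aEntry n q 2 + 1) c₃)).delete
      a).SeesAll (invariantRing (dihedralGroup ε n q)) := by
  cases a with
  | up => exact not_seesAll_delete_upward ε c₂ c₃ H (Or.inl rfl) hε
  | down => exact not_seesAll_delete_down ε c₂ c₃ H hε
  | g => exact not_seesAll_delete_g ε c₂ c₃ H hε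
  | fwd t h h' =>
    exact not_seesAll_delete_upward ε c₂ c₃ H (Or.inr (Or.inl ⟨t, h, h', rfl⟩)) hε
  | bwd t h h' =>
    refine not_seesAll_delete_of_walk ε c₂ c₃ H hε (.W (t + 1) (h.trans t.le_succ) h')
      fun b i j hw => ?_
    rcases walk_of_delete_bwd H h h' hw with h1 | ⟨h1, h2, h3, -⟩
    · exact Or.inl h1
    · exact Or.inr ⟨h1, h2, h3⟩
  | out => exact not_seesAll_delete_upward ε c₂ c₃ H (Or.inr (Or.inr rfl)) hε
  | into =>
    exact not_seesAll_delete_of_walk ε c₂ c₃ H hε (.W (len n q) H.nu_lt.le le_rfl)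
      fun b i j hw => walk_of_delete_into H hw rfl
  | extraFirst t h h' => exact not_seesAll_delete_extraFirst ε c₂ c₃ H hε h h'
  | extra s t hs hs' h h' => exact not_seesAll_delete_extra ε c₂ c₃ H hε hs hs' h h'

/-! ### Common shape of the label polynomials, and conclusion -/

theorem w₂_eq (n q : ℕ) : w₂ K n q = stdPoly q (aEntry n q 2) (1 + (-1) ^ aEntry n q 2) := by
  simp only [w₂, stdPoly, symPow, C_add, C_1, C_pow, C_neg, mul_one]
  ring

theorem w₃_eq (n q : ℕ) : w₃ K n q = stdPoly q (aEntry n q 2 + 1) ((-1) ^ aEntry n q 2 - 1) := by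
  simp only [w₃, stdPoly, symPow, C_sub, C_1, C_pow, C_neg, mul_one]
  ring

theorem v₂_eq (n q : ℕ) : v₂ K n q = stdPoly q (aEntry n q 2) 0 := by
  simp [v₂, stdPoly, symPow]

theorem v₃_eq {n q : ℕ} (h : 2 ≤ aEntry n q 2) :
    v₃ K n q = stdPoly q (aEntry n q 2 + 1) 0 := by
  have : ((-1) ^ (aEntry n q 2 - 1) : MvPolynomial (Fin 2) K) = (-1) ^ (aEntry n q 2 + 1) := by
    obtain ⟨a, ha⟩ := Nat.exists_eq_add_of_le' h
    rw [ha]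
    simp [pow_succ]
  simp [v₃, stdPoly, symPow, this]

theorem seesAll_and_minimal [CharZero K] (H : Numerics n q)
    (hε : ∀ t, 0 < t → IsPrimitiveRoot (ε t) t) {c₂ c₃ : K}
    (h₂ : c₂ = 0 ∨ Even (aEntry n q 2)) (h₃ : c₃ = 0 ∨ Even (aEntry n q 2 + 1))
    {u₂ u₃ : MvPolynomial (Fin 2) K} (hu₂ : u₂ = stdPoly q (aEntry n q 2) c₂)
    (hu₃ : u₃ = stdPoly q (aEntry n q 2 + 1) c₃) :
    (quiverD hν u₂ u₃).SeesAll (invariantRing (dihedralGroup ε n q)) ∧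
      ∀ a : Arrow n q,
        ¬ ((quiverD hν u₂ u₃).delete a).SeesAll (invariantRing (dihedralGroup ε n q)) := by
  refine ⟨seesAll_quiverD H ε hε h₂ h₃ hu₂ hu₃, fun a => ?_⟩
  subst hu₂ hu₃
  exact not_seesAll_delete_quiverD ε c₂ c₃ H hε a

end

end DihedralQuiver

theorem mainTheorem10 {K : Type*} [Field K] [IsAlgClosed K] [CharZero K]
    (ε : ℕ → K) (hε : ∀ t, 0 < t → IsPrimitiveRoot (ε t) t)
    (n q : ℕ) (hq : 1 < q) (hqn : q < n) (hcop : Nat.Coprime n q)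
    (hν : DihedralQuiver.nu n q + 1 < DihedralQuiver.len n q) :
    ((DihedralQuiver.D₁ K hν).SeesAll
        (DihedralQuiver.invariantRing (DihedralQuiver.dihedralGroup ε n q)) ∧
      ∀ a : (DihedralQuiver.D₁ K hν).Arrow,
        ¬ ((DihedralQuiver.D₁ K hν).delete a).SeesAll
          (DihedralQuiver.invariantRing (DihedralQuiver.dihedralGroup ε n q))) ∧
    ((DihedralQuiver.D₂ K hν).SeesAll
        (DihedralQuiver.invariantRing (DihedralQuiver.dihedralGroup ε n q)) ∧
      ∀ a : (DihedralQuiver.D₂ K hν).Arrow,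
        ¬ ((DihedralQuiver.D₂ K hν).delete a).SeesAll
          (DihedralQuiver.invariantRing (DihedralQuiver.dihedralGroup ε n q))) := by
  have H := DihedralQuiver.numerics (zero_lt_one.trans hq) hqn hν
  refine ⟨?_, ?_⟩
  · refine DihedralQuiver.seesAll_and_minimal ε H hε ?_ ?_ (DihedralQuiver.w₂_eq n q)
      (DihedralQuiver.w₃_eq n q)
    · rcases Nat.even_or_odd (DihedralQuiver.aEntry n q 2) with h | h
      · exact Or.inr h
      · exact Or.inl (by rw [h.neg_one_pow]; ring)
    · rcases Nat.even_or_odd (DihedralQuiver.aEntry n q 2) with h | h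
      · exact Or.inl (by rw [h.neg_one_pow]; ring)
      · exact Or.inr h.add_one
  · exact DihedralQuiver.seesAll_and_minimal ε H hε (Or.inl rfl) (Or.inl rfl)
      (DihedralQuiver.v₂_eq n q) (DihedralQuiver.v₃_eq H.two_le_a)
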